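/- Let $\widetilde M$ be a complex manifold of dimension $n+1$ (Hausdorff, second countable) and $M\subset\widetilde M$ an open subset with smooth boundary $bM$, $\overline M=M\cup bM$. Let $G$ be a (second countable) Lie group of dimension $d\ge 1$ that acts smoothly on $\widetilde M$ by biholomorphisms, preserves $M$, and acts freely and properly on $\overline M$; write $z\cdot t$ for the corresponding right action. Let $\mu$ be a measure with smooth positive density on $\widetilde M$ and $\nu$ a left Haar measure on $G$. For $\Delta\in C^\infty(G)$ put $(R_\Delta u)(z)=\int_G\Delta(t)\,u(z\cdot t)\,d\nu(t)$. *Levi polynomials.* Let $x\in bM$. Holomorphic coordinates $(z_0,z)\in\mathbb C\times\mathbb C^n$ near $x$ are adapted if $x$ corresponds to $0$ and near $x$ the set $M$ is $\{\operatorname{Im}z_0>g(\operatorname{Re}z_0,z)\}$ with $g$ smooth, $g(0)=0$, $dg(0)=0$. Write the Taylor expansion of $g$ as $$g(t,z)=t\,\ell(t,z)+2\operatorname{Re}P(z)+L(z,\bar z)+O(3),$$ with $\ell$ a real linear form, $P$ a homogeneous holomorphic quadratic polynomial and $L$ a Hermitian form. The associated Levi polynomial at $x$ is $\Lambda=z_0-2iP(z)$.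 Negative powers of it are taken as $\Lambda^{-\tau}:=(-i\Lambda)^{-\tau}$ with the principal branch (another branch changes this by a constant factor of modulus one). *Amenability.* The action is amenable at $x\in bM$ with exponent $\tau>0$ if for every Levi polynomial $\Lambda$ at $x$ there is a neighbourhood $U$ of $x$ such that for every real-valued $\chi\in C_c^\infty(U)$ with $\chi=1$ near $x$: 1. $\chi\Lambda^{-\tau}\in L^2(M,\mu)$; 2. for every $z\in\overline M$ the function $t\mapsto(\chi\Lambda^{-\tau})(z\cdot t)$ belongs to $L^1(G,\nu)$; 3. for every nonzero $\Delta\in C^\infty(G)$, $R_\Delta(\chi\Lambda^{-\tau})\notin C^\infty(\overline M)$; that is, its restriction to $M$ has no extension that is smooth on $\overline M$. The action is amenable if it is amenable at some $x\in bM$ with some exponent $\tau>0$. **Statement.** Suppose that $p\in bM$ is a strongly pseudoconvex boundary point and that $T_p(G\cdot p)\subset T_p(bM)\cap i\,T_p(bM)$. Then the action of $G$ on $M$ is amenable. More precisely, there is $\tau>0$ such that the action is amenable at $p$ with exponent $\tau$, and such that moreover, for every Levi polynomial $\Lambda$ at $p$ there is a neighbourhood $U$ of $p$ such that for every real-valued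 $\chi\in C_c^\infty(U)$ with $\chi=1$ near $p$ and every $\Delta\in C^\infty(G)$ with $\Delta(e)\neq0$, the function $R_\Delta(\chi\Lambda^{-\tau})$ is not smooth up to the boundary near $p$. -/

import Mathlib

open Set Filter Topology MeasureTheory
open scoped Manifold ContDiff

noncomputable section

/-- The model space `ℂ × ℂⁿ`, with coordinates `(z₀, z)`. -/
abbrev Cmodel (n : ℕ) : Type := ℂ × (Fin n → ℂ)

section Boundary

variable {n : ℕ} {X : Type*} [TopologicalSpace X] [ChartedSpace (Cmodel n) X]

/-- `ρ` is a smooth local defining function of the open set `M` at `x`: near `x` the set `M`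
is `{ρ < 0}`, and `dρ` does not vanish at `x`. -/
def IsLocalDefiningFunction (M : Set X) (x : X) (ρ : X → ℝ) : Prop :=
  (∃ V : Set X, IsOpen V ∧ x ∈ V ∧
    ContMDiffOn 𝓘(ℝ, Cmodel n) 𝓘(ℝ, ℝ) ∞ ρ V ∧ M ∩ V = {z | z ∈ V ∧ ρ z < 0}) ∧
  mfderiv 𝓘(ℝ, Cmodel n) 𝓘(ℝ, ℝ) ρ x ≠ 0

/-- The open set `M` has smooth boundary `bM = frontier M` and lies locally on one side of it. -/
def HasSmoothBoundary (M : Set X) : Prop :=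
  ∀ x ∈ frontier M, ∃ ρ : X → ℝ, IsLocalDefiningFunction (n := n) M x ρ

/-- The Levi form `∑ ∂²r/∂zⱼ∂z̄ₖ (a) wⱼ w̄ₖ` of a real function `r` on `ℂ × ℂⁿ`. -/
def leviForm (r : Cmodel n → ℝ) (a w : Cmodel n) : ℝ :=
  (fderiv ℝ (fderiv ℝ r) a w w
    + fderiv ℝ (fderiv ℝ r) a (Complex.I • w) (Complex.I • w)) / 4

/-- `bM` is strongly pseudoconvex at `x`: in holomorphic coordinates the Levi form of a local
defining function is positive definite on the complex tangent space of `bM` at `x`. -/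
def IsStronglyPseudoconvexAt (M : Set X) (x : X) : Prop :=
  ∃ ρ : X → ℝ, IsLocalDefiningFunction (n := n) M x ρ ∧
    ∀ w : Cmodel n, w ≠ 0 →
      fderiv ℝ (ρ ∘ (chartAt (Cmodel n) x).symm) (chartAt (Cmodel n) x x) w = 0 →
      fderiv ℝ (ρ ∘ (chartAt (Cmodel n) x).symm) (chartAt (Cmodel n) x x)
        (Complex.I • w) = 0 →
      0 < leviForm (ρ ∘ (chartAt (Cmodel n) x).symm) (chartAt (Cmodel n) x x) w

/-- The complex structure on the real tangent space of the complex manifold at `x`. -/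
def tangentMulI (x : X) (w : TangentSpace 𝓘(ℝ, Cmodel n) x) :
    TangentSpace 𝓘(ℝ, Cmodel n) x :=
  (Complex.I • (show Cmodel n from w) : Cmodel n)

/-- The real tangent space `T_x(bM)`, as a subset of the real tangent space of the manifold. -/
def boundaryTangentSpace (M : Set X) (x : X) : Set (TangentSpace 𝓘(ℝ, Cmodel n) x) :=
  {w | ∀ ρ : X → ℝ, IsLocalDefiningFunction (n := n) M x ρ →
    mfderiv 𝓘(ℝ, Cmodel n) 𝓘(ℝ, ℝ) ρ x w = 0}

/-- The complex tangent space `T_x(bM) ∩ i T_x(bM)`. -/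
def complexTangentSpace (M : Set X) (x : X) : Set (TangentSpace 𝓘(ℝ, Cmodel n) x) :=
  {w | w ∈ boundaryTangentSpace M x ∧ tangentMulI x w ∈ boundaryTangentSpace M x}

/-- `f` agrees near `x` with the adapted Levi polynomial `Λ = z₀ - 2 i P(z)` of `bM` at `x` in
some adapted holomorphic coordinates `(z₀, z)`. That is: `x` corresponds to `0`, near `x` the
set `M` is `{Im z₀ > g (Re z₀, z)}` with `g` smooth, and
`g (t, z) = t ℓ(t, z) + 2 Re P(z) + L(z, z̄) + O(3)` with `ℓ` real linear,
`P(z) = ∑ Aⱼₖ zⱼ zₖ` and `L(z, z̄) = ∑ Bⱼₖ zⱼ z̄ₖ`, `B` Hermitian. -/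
def IsLeviPolynomial (M : Set X) (x : X) (f : X → ℂ) : Prop :=
  ∃ e ∈ IsManifold.maximalAtlas 𝓘(ℂ, Cmodel n) ω X, x ∈ e.source ∧ e x = 0 ∧
  ∃ (g : ℝ × (Fin n → ℂ) → ℝ) (ℓ : ℝ × (Fin n → ℂ) →L[ℝ] ℝ)
    (A B : Matrix (Fin n) (Fin n) ℂ),
    (∀ᶠ v in 𝓝 0, ContDiffAt ℝ ∞ g v) ∧
    B.IsHermitian ∧
    ((fun v : ℝ × (Fin n → ℂ) => g v - (v.1 * ℓ v
        + 2 * (∑ j, ∑ k, A j k * v.2 j * v.2 k).re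
        + (∑ j, ∑ k, B j k * v.2 j * (starRingEnd ℂ) (v.2 k)).re))
      =O[𝓝 0] fun v => ‖v‖ ^ 3) ∧
    (∀ᶠ z in 𝓝 x, z ∈ M ↔ g ((e z).1.re, (e z).2) < (e z).1.im) ∧
    ∀ᶠ z in 𝓝 x,
      f z = (e z).1 - 2 * Complex.I * ∑ j, ∑ k, A j k * (e z).2 j * (e z).2 k

/-- `χ` is a smooth, compactly supported cut-off function at `x` with support in `U`. -/
def IsCutoff (U : Set X) (x : X) (χ : X → ℝ) : Prop :=
  ContMDiff 𝓘(ℝ, Cmodel n) 𝓘(ℝ, ℝ) ∞ χ ∧ HasCompactSupport χ ∧ tsupport χ ⊆ U ∧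
    ∀ᶠ z in 𝓝 x, χ z = 1

/-- `χ f^{-τ}`. Near the boundary point, a Levi polynomial `f` maps `M` to the complement of the
closed negative imaginary half-axis. The branch of the power is the one that is given by the
principal branch for the normalization `-i f`; other branches differ by a constant phase. -/
def cutoffPower (χ : X → ℝ) (f : X → ℂ) (τ : ℝ) (z : X) : ℂ :=
  (χ z : ℂ) * (-Complex.I * f z) ^ (-(τ : ℂ))

/-- `h`, a function on `M`, belongs to `C^∞(M̄)`: it extends to a function that is smooth
on `closure M`, up to the boundary. -/
def IsSmoothUpToBoundary (M : Set X) (h : X → ℂ) : Prop :=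
  ∃ H : X → ℂ, ContMDiffOn 𝓘(ℝ, Cmodel n) 𝓘(ℝ, ℂ) ∞ H (closure M) ∧ EqOn H h M

/-- `h`, a function on `M`, is smooth up to the boundary near the point `x` of `closure M`. -/
def IsSmoothUpToBoundaryAt (M : Set X) (x : X) (h : X → ℂ) : Prop :=
  ∃ V ∈ 𝓝 x, ∃ H : X → ℂ,
    ContMDiffOn 𝓘(ℝ, Cmodel n) 𝓘(ℝ, ℂ) ∞ H (closure M ∩ V) ∧ EqOn H h (M ∩ V)

/-- A measure with a smooth positive density with respect to Lebesgue measure in every chart. -/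
def IsSmoothMeasure [MeasurableSpace X] (μ : Measure X) : Prop :=
  ∀ x : X, ∃ w : Cmodel n → ℝ,
    ContDiffOn ℝ ∞ w (chartAt (Cmodel n) x).target ∧
    (∀ y ∈ (chartAt (Cmodel n) x).target, 0 < w y) ∧
    (μ.restrict (chartAt (Cmodel n) x).source).map (chartAt (Cmodel n) x)
      = (volume.restrict (chartAt (Cmodel n) x).target).withDensity
          (fun y => ENNReal.ofReal (w y))

end Boundary

section Action

variable {n : ℕ} {X : Type*} [TopologicalSpace X] [ChartedSpace (Cmodel n) X]

/-- The tangent space `T_p(G · p)` of the orbit: the image of the differential of the orbit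
map at the identity. -/
def orbitTangentSpace (d : ℕ) (G : Type*) [TopologicalSpace G]
    [ChartedSpace (EuclideanSpace ℝ (Fin d)) G] [Group G] [MulAction G X] (p : X) :
    Set (TangentSpace 𝓘(ℝ, Cmodel n) p) :=
  {w | ∃ v : TangentSpace (𝓡 d) (1 : G),
    mfderiv (𝓡 d) 𝓘(ℝ, Cmodel n) (fun t : G => t • p) 1 v = w}

/-- `G` acts smoothly on the complex manifold by biholomorphic maps that preserve `M`, and the
action on `closure M` is free and proper. -/
structure IsFreeProperHolomorphicAction (d : ℕ) (G : Type*) [TopologicalSpace G]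
    [ChartedSpace (EuclideanSpace ℝ (Fin d)) G] [Group G] [MulAction G X] (M : Set X) :
    Prop where
  smooth : ContMDiff ((𝓡 d).prod 𝓘(ℝ, Cmodel n)) 𝓘(ℝ, Cmodel n) ∞
    (fun q : G × X => q.1 • q.2)
  holomorphic : ∀ g : G, MDifferentiable 𝓘(ℂ, Cmodel n) 𝓘(ℂ, Cmodel n) (fun z : X => g • z)
  invariant : ∀ g : G, ∀ z ∈ M, g • z ∈ M
  free : ∀ z ∈ closure M, ∀ g : G, g • z = z → g = 1
  proper : IsProperMap (fun q : G × closure M => ((q.1 • (q.2 : X), (q.2 : X)) : X × X))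

/-- `(R_Δ u)(z) = ∫ Δ(t) u(z · t) dν(t)`, where `z · t = t⁻¹ • z` is the right action. -/
def convolutionOp {G X : Type*} [Group G] [MulAction G X] [MeasurableSpace G] (ν : Measure G)
    (Δ : G → ℂ) (u : X → ℂ) (z : X) : ℂ :=
  ∫ t, Δ t * u (t⁻¹ • z) ∂ν

/-- The conditions of amenability at the boundary point `x` with the exponent `τ`: for every
Levi polynomial `f` at `x` and every cut-off function `χ` at `x` with small enough support,
1) `χ f^{-τ} ∈ L²(M)`; 2) the restriction of `χ f^{-τ}` to each orbit in `closure M` belongs to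
`L¹(G)`; 3) `R_Δ (χ f^{-τ}) ∉ C^∞(M̄)` for every nonzero `Δ ∈ C^∞(G)`. -/
def IsAmenableAt (d : ℕ) [MeasurableSpace X] {G : Type*} [TopologicalSpace G]
    [ChartedSpace (EuclideanSpace ℝ (Fin d)) G] [Group G] [MeasurableSpace G] [MulAction G X]
    (μ : Measure X) (ν : Measure G)
    (M : Set X) (x : X) (τ : ℝ) : Prop :=
  ∀ f : X → ℂ, IsLeviPolynomial (n := n) M x f →
    ∃ U ∈ 𝓝 x, ∀ χ : X → ℝ, IsCutoff (n := n) U x χ →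
      MemLp (cutoffPower χ f τ) 2 (μ.restrict M) ∧
      (∀ z ∈ closure M, Integrable (fun t : G => cutoffPower χ f τ (t⁻¹ • z)) ν) ∧
      ∀ Δ : G → ℂ, ContMDiff (𝓡 d) 𝓘(ℝ, ℂ) ∞ Δ → Δ ≠ 0 →
        ¬ IsSmoothUpToBoundary (n := n) M (convolutionOp ν Δ (cutoffPower χ f τ))

/-- The action of `G` is amenable. -/
def IsAmenableAction (d : ℕ) [MeasurableSpace X] {G : Type*} [TopologicalSpace G]
    [ChartedSpace (EuclideanSpace ℝ (Fin d)) G] [Group G] [MeasurableSpace G] [MulAction G X]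
    (μ : Measure X) (ν : Measure G)
    (M : Set X) : Prop :=
  ∃ x ∈ frontier M, ∃ τ : ℝ, 0 < τ ∧ IsAmenableAt (n := n) d μ ν M x τ

end Action

end

/-!
The exponent `τ = 1 / 4` works at every strongly pseudoconvex point `p` whose orbit is complex
tangential. Let `u = χ Λ ^ (-τ)`, with `χ` supported near `p`. The third condition of amenability
is the essential one: it follows from a lower bound for finite differences of `R_Δ u` along the
inner normal at `p`, obtained from a parabolic scaling.

In adapted coordinates, strong pseudoconvexity at `p` says that the Hermitian form of the expansion
is positive definite (`AdaptedExpansion.hermPart_pos`). On the closure of `M` near `p`, the real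
part of `-i Λ` is therefore at least `c ‖z‖ ^ 2 - η |Re z₀|` for every `η > 0`, and `-i Λ` takes its
values in the slit plane, except at `p` where it vanishes (`AdaptedExpansion.re_lower_bound`,
`AdaptedExpansion.mem_slitPlane`). Hence `u` is smooth on the closure of `M` away from `p`.

Let `z(s)` be the point `(i s, 0)` of the inner normal, let `θ` be the inverse of a chart of the
group at the identity, and put `F (s, y) = -i Λ (θ(y) • z(s))` (`orbitLevi`). Then `F (s, 0) = s`,
and the `y`-derivative of `F` vanishes at the origin since the orbit of `p` is tangent to
`{z₀ = 0}`. The orbit map of a free action is an immersion (`eq_zero_of_mfderiv_orbit_eq_zero`), so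
that `‖z‖ ≥ c ‖y‖` and `|z₀| ≤ K ‖y‖ ^ 2` along the orbit, and `Re F (0, y) ≥ c ‖y‖ ^ 2`
(`IsAdaptedNhd.fderiv_orbitLevi`, `IsAdaptedNhd.re_orbitLevi_lower_bound`). Consequently
`F (s x, √s y) / s` tends to `x + B(y, y)` with `B` a quadratic form whose real part is positive
definite.

Suppose that `Δ(1) ≠ 0` and that `R_Δ u` is smooth up to the boundary near `p`. Its `d`-th
differences with step `s`, taken at `z(s)`, are then `O(s ^ d)`. So is the contribution to these
differences of the complement of a neighbourhood of the identity in the group: by properness only a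
compact set of group elements matters, and these move `p` to points at which `u` is smooth
(`IsAdaptedNhd.exists_norm_fwdDiff_iter_le`). Haar measure has a continuous density in the chart,
positive at the identity (`exists_density_of_isMulRightInvariant`), and the substitution `y ↦ √s y`
with dominated convergence shows that the contribution of a neighbourhood of the identity is
asymptotic to a constant times `s ^ (d / 2 - τ)` (`tendsto_integral_fwdDiff`). Up to nonzero factors
the constant is the integral over `y` of the `d`-th difference of `x ↦ (x + B(y, y)) ^ (-τ)`.
Writing the power as a Gamma integral turns it into a positive multiple of `± ∫ exp(-B(y, y)) dy`, a complex
Gaussian integral, which is not zero (`integral_fwdDiff_cpow_ne_zero`,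
`integral_cexp_neg_quadratic_ne_zero`). As `d / 2 - τ < d`, this is a contradiction
(`IsAdaptedNhd.not_isSmoothUpToBoundaryAt`). If only `Δ ≠ 0` is known, a translation in the group
moves a point at which `Δ` does not vanish to the identity (`convolutionOp_smul`).

For the other two conditions: `u` is square integrable since for fixed `z` the function `Λ` is a
translate of the coordinate `z₀` of the plane and `2 τ < 2` (`exists_memLp_cutoffPower`). Along the
orbits `u` is integrable, by properness if the orbit avoids `p`, and otherwise because
`|Λ| ^ (-τ)` is at most a multiple of `‖y‖ ^ (-2 τ)` and `2 τ < d`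
(`IsAdaptedNhd.integrable_cutoffPower_orbit`).
-/

noncomputable section

/-! ### Finite differences of smooth functions -/

/-- Mean value step for iterated differences: a bound for the `k`-th differences of the derivative
gives one for the `(k+1)`-st differences of the function. -/
theorem norm_fwdDiff_iter_succ_le {φ φ' : ℝ → ℂ} {x s B : ℝ} {k : ℕ} (hs : 0 ≤ s) {S : Set ℝ}
    (hS : Icc x (x + (k + 1) * s) ⊆ S)
    (hφ : ∀ y ∈ S, HasDerivWithinAt φ (φ' y) S y)
    (hB : ∀ y ∈ Icc x (x + s), ‖(fwdDiff s)^[k] φ' y‖ ≤ B) :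
    ‖(fwdDiff s)^[k + 1] φ x‖ ≤ B * s := by
  have key : ∀ y ∈ Icc x (x + s),
      HasDerivWithinAt ((fwdDiff s)^[k] φ) ((fwdDiff s)^[k] φ' y) (Icc x (x + s)) y := by
    intro y hy
    have e1 : (fwdDiff s)^[k] φ = fun y => ∑ j ∈ Finset.range (k + 1),
        (((-1 : ℤ) ^ (k - j) * (k.choose j : ℤ)) • φ (y + j • s)) := by
      funext y; exact fwdDiff_iter_eq_sum_shift s φ k y
    rw [e1, fwdDiff_iter_eq_sum_shift s φ' k y]
    refine HasDerivWithinAt.fun_sum fun j hj => ?_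
    have hj' : (j : ℝ) ≤ k := by
      exact_mod_cast Nat.lt_succ_iff.mp (Finset.mem_range.mp hj)
    have hmaps : MapsTo (fun y : ℝ => y + j • s) (Icc x (x + s)) S := by
      intro w hw
      apply hS
      simp only [nsmul_eq_mul, mem_Icc] at hw ⊢
      have h1 : (j : ℝ) * s ≤ k * s := mul_le_mul_of_nonneg_right hj' hs
      have h2 : 0 ≤ (j : ℝ) * s := by positivity
      constructor <;> nlinarith [hw.1, hw.2]
    have hd : HasDerivWithinAt (fun y => φ (y + j • s)) (φ' (y + j • s)) (Icc x (x + s)) y := by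
      have := (hφ _ (hmaps hy)).scomp (h := fun y : ℝ => y + j • s) y
        ((hasDerivWithinAt_id y _).add_const (j • s)) hmaps
      rw [one_smul] at this
      exact this
    exact hd.fun_const_smul ((-1 : ℤ) ^ (k - j) * (k.choose j : ℤ))
  have hmv := (convex_Icc x (x + s)).norm_image_sub_le_of_norm_hasDerivWithin_le key hB
    (left_mem_Icc.mpr (by linarith)) (right_mem_Icc.mpr (by linarith))
  rw [Function.iterate_succ_apply']
  simpa [fwdDiff, abs_of_nonneg hs] using hmv

/-- The `k`-th differences of a smooth function on a compact interval are `O(s ^ k)`. -/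
theorem exists_norm_fwdDiff_iter_le_of_contDiffOn {a b : ℝ} (hab : a < b) (k : ℕ) :
    ∀ φ : ℝ → ℂ, ContDiffOn ℝ ∞ φ (Icc a b) →
      ∃ B : ℝ, ∀ x s : ℝ, a ≤ x → 0 ≤ s → x + k * s ≤ b →
        ‖(fwdDiff s)^[k] φ x‖ ≤ B * s ^ k := by
  induction k with
  | zero =>
    intro φ hφ
    obtain ⟨B, hB⟩ := isCompact_Icc.exists_bound_of_continuousOn hφ.continuousOn
    refine ⟨B, fun x s hx _ hb => ?_⟩
    simpa using hB x ⟨hx, by simpa using hb⟩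
  | succ k ih =>
    intro φ hφ
    have hu := uniqueDiffOn_Icc hab
    obtain ⟨B, hB⟩ := ih (derivWithin φ (Icc a b)) (hφ.derivWithin hu (by simp))
    refine ⟨B, fun x s hx hs hb => ?_⟩
    push_cast at hb
    rw [pow_succ, ← mul_assoc]
    refine norm_fwdDiff_iter_succ_le hs (Icc_subset_Icc hx hb)
      (fun y hy => (hφ.differentiableOn (by simp) y hy).hasDerivWithinAt) fun y hy => ?_
    refine hB y s (hx.trans hy.1) hs ?_
    have := hy.2
    linarith

theorem ContinuousAt.exists_ball_norm_le {E : Type*} [NormedAddCommGroup E] {W : ℝ × E → ℂ}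
    {y₀ : E} (hW : ContinuousAt W (0, y₀)) :
    ∃ ε > 0, ∃ B ≥ 0, ∀ x ∈ Ioo (-ε) ε, ∀ y ∈ Metric.ball y₀ ε, ‖W (x, y)‖ ≤ B := by
  have h1 : ∀ᶠ v in 𝓝 ((0 : ℝ), y₀), ‖W v‖ < ‖W (0, y₀)‖ + 1 :=
    hW.norm.eventually_lt continuousAt_const (by linarith)
  obtain ⟨ε, hε, h⟩ := Metric.eventually_nhds_iff_ball.mp h1
  refine ⟨ε, hε, ‖W (0, y₀)‖ + 1, by positivity, fun x hx y hy => (h _ ?_).le⟩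
  rw [Metric.mem_ball, Prod.dist_eq, max_lt_iff]
  exact ⟨by rw [Real.dist_eq, sub_zero, abs_lt]; exact hx, hy⟩

section Family

variable {E : Type*} [NormedAddCommGroup E] [NormedSpace ℝ E]

/-- The partial derivative of a function on `ℝ × E` in the first variable. -/
def timeDeriv (W : ℝ × E → ℂ) (v : ℝ × E) : ℂ := fderiv ℝ W v (1, 0)

theorem contDiffAt_timeDeriv {W : ℝ × E → ℂ} {v : ℝ × E} (hW : ContDiffAt ℝ ∞ W v) :
    ContDiffAt ℝ ∞ (timeDeriv W) v :=
  (hW.fderiv_right (m := ∞) (by simp)).clm_apply contDiffAt_const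

theorem hasDerivAt_timeDeriv {W : ℝ × E → ℂ} {x : ℝ} {y : E}
    (hW : DifferentiableAt ℝ W (x, y)) :
    HasDerivAt (fun x => W (x, y)) (timeDeriv W (x, y)) x := by
  have h1 : HasDerivAt (fun x : ℝ => (x, y)) ((1 : ℝ), (0 : E)) x :=
    (hasDerivAt_id x).prodMk (hasDerivAt_const x y)
  exact hW.hasFDerivAt.comp_hasDerivAt x h1

theorem ContDiffAt.exists_ball_differentiableAt {W : ℝ × E → ℂ} {y₀ : E}
    (hW : ContDiffAt ℝ ∞ W (0, y₀)) :
    ∃ ε > 0, ∀ x ∈ Ioo (-ε) ε, ∀ y ∈ Metric.ball y₀ ε, DifferentiableAt ℝ W (x, y) := by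
  have h1 : ∀ᶠ v in 𝓝 ((0 : ℝ), y₀), DifferentiableAt ℝ W v := by
    have := (hW.of_le (m := 1) (by norm_cast)).eventually (by simp)
    exact this.mono fun v hv => hv.differentiableAt (by simp)
  obtain ⟨ε, hε, h⟩ := Metric.eventually_nhds_iff_ball.mp h1
  refine ⟨ε, hε, fun x hx y hy => h _ ?_⟩
  rw [Metric.mem_ball, Prod.dist_eq, max_lt_iff]
  exact ⟨by rw [Real.dist_eq, sub_zero, abs_lt]; exact hx, hy⟩

/-- Differences in the first variable of `W * G ^ (-τ)` lose one power of a lower bound `m` of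
`Re G` for each step. The class of such products is stable under differentiation up to replacing
`τ` by `τ + 1`, which is what the induction uses. -/
theorem exists_norm_fwdDiff_iter_mul_cpow_le {G : ℝ × E → ℂ} {y₀ : E}
    (hG : ContDiffAt ℝ ∞ G (0, y₀)) (k : ℕ) :
    ∀ (W : ℝ × E → ℂ) (τ : ℝ), 0 ≤ τ → ContDiffAt ℝ ∞ W (0, y₀) →
      ∃ ε > 0, ∃ B ≥ 0, ∀ y ∈ Metric.ball y₀ ε, ∀ x s m : ℝ, -ε < x → 0 ≤ s → x + k * s < ε →
        0 < m → m ≤ 1 → (∀ σ ∈ Icc x (x + k * s), m ≤ (G (σ, y)).re) →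
        ‖(fwdDiff s)^[k] (fun σ => W (σ, y) * G (σ, y) ^ (-(τ : ℂ))) x‖ ≤
          B * s ^ k * m ^ (-(τ + k)) := by
  have hcp : ∀ (w : ℂ) (m τ : ℝ), 0 ≤ τ → 0 < m → m ≤ w.re → ‖w ^ (-(τ : ℂ))‖ ≤ m ^ (-τ) := by
    intro w m τ hτ hm hw
    have h1 : ‖w ^ (-(τ : ℂ))‖ = ‖w‖ ^ (-τ) := by
      rw [← Complex.ofReal_neg, Complex.norm_cpow_real]
    rw [h1]
    exact Real.rpow_le_rpow_of_nonpos hm (hw.trans (Complex.re_le_norm w)) (by linarith)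
  induction k with
  | zero =>
    intro W τ hτ hW
    obtain ⟨ε, hε, B, hB0, hB⟩ := hW.continuousAt.exists_ball_norm_le
    refine ⟨ε, hε, B, hB0, fun y hy x s m hx _ hxs hm _ hre => ?_⟩
    simp only [CharP.cast_eq_zero, zero_mul, add_zero, Icc_self, mem_singleton_iff,
      forall_eq] at hre hxs
    simp only [Function.iterate_zero, id_eq, norm_mul, pow_zero, mul_one, CharP.cast_eq_zero,
      add_zero]
    exact mul_le_mul (hB x ⟨hx, hxs⟩ y hy) (hcp _ _ _ hτ hm hre) (norm_nonneg _) hB0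
  | succ k ih =>
    intro W τ hτ hW
    obtain ⟨ε₁, hε₁, B₁, hB₁, h₁⟩ := ih (timeDeriv W) τ hτ (contDiffAt_timeDeriv hW)
    obtain ⟨ε₂, hε₂, B₂, hB₂, h₂⟩ := ih (fun v => -(τ : ℂ) * W v * timeDeriv G v) (τ + 1)
      (by linarith) ((contDiffAt_const.mul hW).mul (contDiffAt_timeDeriv hG))
    obtain ⟨ε₃, hε₃, h₃⟩ := hW.exists_ball_differentiableAt
    obtain ⟨ε₄, hε₄, h₄⟩ := hG.exists_ball_differentiableAt
    refine ⟨min (min ε₁ ε₂) (min ε₃ ε₄), by positivity, B₁ + B₂, by positivity,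
      fun y hy x s m hx hs hxs hm hm1 hre => ?_⟩
    simp only [Metric.mem_ball, lt_min_iff, neg_lt] at hy hx hxs
    push_cast at hxs hre ⊢
    have hks : (k + 1 : ℝ) * s = k * s + s := by ring
    rw [hks] at hxs hre
    have hs' : (0 : ℝ) ≤ k * s := by positivity
    -- the derivative of `W * G ^ (-τ)`, a sum of two products of the same kind
    set φ' : ℝ → ℂ := (fun σ => timeDeriv W (σ, y) * G (σ, y) ^ (-(τ : ℂ))) +
      (fun σ => (-(τ : ℂ) * W (σ, y) * timeDeriv G (σ, y)) * G (σ, y) ^ (-((τ + 1 : ℝ) : ℂ)))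
      with hφ'
    have hpow : s ^ (k + 1) = s ^ k * s := pow_succ _ _
    have goal : ‖(fwdDiff s)^[k + 1] (fun σ => W (σ, y) * G (σ, y) ^ (-(τ : ℂ))) x‖ ≤
        ((B₁ + B₂) * s ^ k * m ^ (-(τ + (k + 1)))) * s := by
      refine norm_fwdDiff_iter_succ_le (φ' := φ') (S := Icc x (x + (k + 1) * s)) hs
        Subset.rfl ?_ ?_
      · intro σ hσ
        rw [hks] at hσ
        have hσ3 : σ ∈ Ioo (-ε₃) ε₃ := ⟨by linarith [hσ.1, hx.2.1], by linarith [hσ.2, hxs.2.1]⟩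
        have hσ4 : σ ∈ Ioo (-ε₄) ε₄ := ⟨by linarith [hσ.1, hx.2.2], by linarith [hσ.2, hxs.2.2]⟩
        have d1 := hasDerivAt_timeDeriv (h₃ σ hσ3 y hy.2.1)
        have d2 := hasDerivAt_timeDeriv (h₄ σ hσ4 y hy.2.2)
        have hpos : 0 < (G (σ, y)).re := hm.trans_le (hre σ hσ)
        have hsl : G (σ, y) ∈ Complex.slitPlane := Or.inl hpos
        have d3 := (hasStrictDerivAt_id (G (σ, y))).cpow_const (c := -(τ : ℂ)) hsl
        have d4 := HasDerivAt.comp σ d3.hasDerivAt d2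
        have d5 := d1.mul d4
        refine HasDerivAt.hasDerivWithinAt (d5.congr_deriv ?_)
        simp only [hφ', Pi.add_apply, Function.comp, id]
        push_cast
        rw [neg_add' (τ : ℂ) 1]
        ring
      · intro σ hσ
        rw [hφ', fwdDiff_iter_add]
        have hre' : ∀ σ' ∈ Icc σ (σ + k * s), m ≤ (G (σ', y)).re := fun σ' h' =>
          hre σ' ⟨hσ.1.trans h'.1, by linarith [h'.2, hσ.2]⟩
        have b1 := h₁ y hy.1.1 σ s m (by linarith [hσ.1, hx.1.1]) hs
          (by linarith [hσ.2, hxs.1.1]) hm hm1 hre'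
        have b2 := h₂ y hy.1.2 σ s m (by linarith [hσ.1, hx.1.2]) hs
          (by linarith [hσ.2, hxs.1.2]) hm hm1 hre'
        have hmm : m ^ (-(τ + k)) ≤ m ^ (-(τ + (k + 1))) :=
          Real.rpow_le_rpow_of_exponent_ge hm hm1 (by linarith)
        have hee : -(τ + 1 + (k : ℝ)) = -(τ + (k + 1)) := by ring
        rw [hee] at b2
        calc _ ≤ _ := norm_add_le _ _
          _ ≤ B₁ * s ^ k * m ^ (-(τ + k)) + B₂ * s ^ k * m ^ (-(τ + (k + 1))) := add_le_add b1 b2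
          _ ≤ B₁ * s ^ k * m ^ (-(τ + (k + 1))) + B₂ * s ^ k * m ^ (-(τ + (k + 1))) := by gcongr
          _ = _ := by ring
    rw [hpow]
    calc _ ≤ _ := goal
      _ = _ := by ring

/-- The differences in the first variable of a smooth function on `ℝ × E` are `O(s ^ k)`, locally
uniformly in the second variable. -/
theorem ContDiffAt.exists_norm_fwdDiff_iter_le {W : ℝ × E → ℂ} {y₀ : E}
    (hW : ContDiffAt ℝ ∞ W (0, y₀)) (k : ℕ) :
    ∃ ε > 0, ∃ B ≥ 0, ∀ y ∈ Metric.ball y₀ ε, ∀ x s : ℝ, -ε < x → 0 ≤ s → x + k * s < ε →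
      ‖(fwdDiff s)^[k] (fun σ => W (σ, y)) x‖ ≤ B * s ^ k := by
  obtain ⟨ε, hε, B, hB, h⟩ := exists_norm_fwdDiff_iter_mul_cpow_le (G := fun _ : ℝ × E => (1 : ℂ))
    (y₀ := y₀) contDiffAt_const k W 0 le_rfl hW
  refine ⟨ε, hε, B, hB, fun y hy x s hx hs hxs => ?_⟩
  simpa using h y hy x s 1 hx hs hxs one_pos le_rfl (by simp)

end Family

/-- Second order Taylor expansion with the Peano remainder, in several variables. -/
theorem ContDiffAt.taylor_two {E F : Type*} [NormedAddCommGroup E] [NormedSpace ℝ E]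
    [NormedAddCommGroup F] [NormedSpace ℝ F] {f : E → F} {x : E} (hf : ContDiffAt ℝ 2 f x) :
    (fun h => f (x + h) - f x - fderiv ℝ f x h - (1 / 2 : ℝ) • fderiv ℝ (fderiv ℝ f) x h h)
      =o[𝓝 0] fun h => ‖h‖ ^ 2 := by
  have hsymm : IsSymmSndFDerivAt ℝ f x := hf.isSymmSndFDerivAt (by simp)
  have hd2 : HasFDerivAt (fderiv ℝ f) (fderiv ℝ (fderiv ℝ f) x) x :=
    ((hf.fderiv_right (m := 1) (by norm_num)).differentiableAt (by simp)).hasFDerivAt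
  have hd1 : ∀ᶠ y in 𝓝 x, DifferentiableAt ℝ f y :=
    (hf.eventually (by simp)).mono fun y hy => hy.differentiableAt (by simp)
  set A := fderiv ℝ (fderiv ℝ f) x with hA
  rw [Asymptotics.isLittleO_iff]
  intro c hc
  have h1 := hd2.isLittleO
  have h2 := (Asymptotics.isLittleO_iff.mp h1) hc
  obtain ⟨ε, hε, hb⟩ := Metric.eventually_nhds_iff_ball.mp (h2.and hd1)
  refine Metric.eventually_nhds_iff_ball.mpr ⟨ε, hε, fun h hh => ?_⟩
  -- the mean value inequality for the remainder, whose derivative at `k` is `o(k)` because the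
  -- second derivative is symmetric
  set R : E → F := fun h => f (x + h) - f x - fderiv ℝ f x h - (1 / 2 : ℝ) • A h h with hR
  have hder : ∀ k ∈ Metric.closedBall (0 : E) ‖h‖, HasFDerivWithinAt R
      (fderiv ℝ f (x + k) - fderiv ℝ f x - A k) (Metric.closedBall 0 ‖h‖) k := by
    intro k hk
    have hxk : x + k ∈ Metric.ball x ε := by
      simp only [Metric.mem_ball, dist_self_add_left, Metric.mem_closedBall, dist_zero_right]
        at hk hh ⊢
      linarith
    have e1 : HasFDerivAt (fun h => f (x + h)) (fderiv ℝ f (x + k)) k := by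
      have := (hb _ hxk).2.hasFDerivAt.comp k ((hasFDerivAt_id k).const_add x)
      simpa [Function.comp_def] using this
    have e2 : HasFDerivAt (fun h => A h h) (A k + A.flip k) k := by
      have := A.hasFDerivAt (x := k) |>.clm_apply (hasFDerivAt_id k)
      exact this
    have e3 : A.flip k = A k := by
      ext v; exact hsymm v k
    have e4 := ((e1.sub_const (f x)).sub ((fderiv ℝ f x).hasFDerivAt (x := k))).sub
      (e2.const_smul (1 / 2 : ℝ))
    refine HasFDerivAt.hasFDerivWithinAt (e4.congr_fderiv ?_)
    rw [e3, ← two_smul ℝ (A k), smul_smul]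
    norm_num
  have hbound : ∀ k ∈ Metric.closedBall (0 : E) ‖h‖,
      ‖fderiv ℝ f (x + k) - fderiv ℝ f x - A k‖ ≤ c * ‖h‖ := by
    intro k hk
    have hxk : x + k ∈ Metric.ball x ε := by
      simp only [Metric.mem_ball, dist_self_add_left, Metric.mem_closedBall, dist_zero_right]
        at hk hh ⊢
      linarith
    have := (hb _ hxk).1
    simp only [add_sub_cancel_left] at this
    refine this.trans ?_
    gcongr
    simpa using hk
  have := (convex_closedBall (0 : E) ‖h‖).norm_image_sub_le_of_norm_hasFDerivWithin_le hder hbound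
    (Metric.mem_closedBall_self (norm_nonneg h)) (y := h) (by simp)
  have hR0 : R 0 = 0 := by simp [hR]
  rw [hR0, sub_zero, sub_zero] at this
  calc ‖R h‖ ≤ c * ‖h‖ * ‖h‖ := this
    _ = c * ‖‖h‖ ^ 2‖ := by rw [norm_pow, norm_norm]; ring

/-! ### Gaussian integrals with complex quadratic forms -/

section

theorem integrableOn_rpow_mul_exp_neg {τ b : ℝ} (hτ : 0 < τ) (hb : 0 < b) :
    IntegrableOn (fun x : ℝ => x ^ (τ - 1) * Real.exp (-(b * x))) (Ioi 0) := by
  have := integrableOn_rpow_mul_exp_neg_mul_rpow (s := τ - 1) (p := 1) (b := b)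
    (by linarith) one_pos hb
  simpa [Real.rpow_one] using this

theorem norm_rpow_mul_cexp_neg {x τ : ℝ} (hx : 0 < x) (r : ℂ) :
    ‖((x ^ (τ - 1) : ℝ) : ℂ) * Complex.exp (-(r * x))‖ =
      x ^ (τ - 1) * Real.exp (-(r.re * x)) := by
  rw [norm_mul, Complex.norm_exp, Complex.norm_real, Real.norm_of_nonneg (by positivity)]
  simp

theorem integrableOn_rpow_mul_cexp_neg {τ : ℝ} (hτ : 0 < τ) {r : ℂ} (hr : 0 < r.re) :
    IntegrableOn (fun x : ℝ => ((x ^ (τ - 1) : ℝ) : ℂ) * Complex.exp (-(r * x))) (Ioi 0) := by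
  refine (integrableOn_rpow_mul_exp_neg hτ hr).mono' ?_ ?_
  · refine Measurable.aestronglyMeasurable ?_
    fun_prop
  · filter_upwards [ae_restrict_mem measurableSet_Ioi] with x hx
    exact (norm_rpow_mul_cexp_neg hx r).le

/-- The Gamma integral with a complex rate in the right half-plane; it follows from the case of a
real rate by analytic continuation. -/
theorem integral_rpow_mul_cexp_neg {τ : ℝ} (hτ : 0 < τ) {r : ℂ} (hr : 0 < r.re) :
    ∫ x : ℝ in Ioi 0, ((x ^ (τ - 1) : ℝ) : ℂ) * Complex.exp (-(r * x)) =
      r ^ (-(τ : ℂ)) * Complex.Gamma τ := by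
  set U : Set ℂ := {z | 0 < z.re} with hU
  have hUo : IsOpen U := isOpen_lt continuous_const Complex.continuous_re
  set F : ℂ → ℂ := fun r => ∫ x : ℝ in Ioi 0, ((x ^ (τ - 1) : ℝ) : ℂ) * Complex.exp (-(r * x))
    with hF
  have hFd : DifferentiableOn ℂ F U := by
    intro z hz
    have hz' : 0 < z.re := hz
    have hball : ∀ w ∈ Metric.ball z (z.re / 2), z.re / 2 < w.re := by
      intro w hw
      have h1 := Complex.abs_re_le_norm (w - z)
      rw [Metric.mem_ball, dist_eq_norm] at hw
      rw [Complex.sub_re] at h1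
      have h3 := (abs_lt.mp (h1.trans_lt hw)).1
      linarith
    have key := hasDerivAt_integral_of_dominated_loc_of_deriv_le
      (μ := volume.restrict (Ioi (0 : ℝ))) (𝕜 := ℂ)
      (F := fun (r : ℂ) (x : ℝ) => ((x ^ (τ - 1) : ℝ) : ℂ) * Complex.exp (-(r * x)))
      (F' := fun (r : ℂ) (x : ℝ) =>
        ((x ^ (τ - 1) : ℝ) : ℂ) * (Complex.exp (-(r * x)) * (-(x : ℂ))))
      (bound := fun x : ℝ => x ^ (τ + 1 - 1) * Real.exp (-(z.re / 2 * x)))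
      (x₀ := z) (s := Metric.ball z (z.re / 2)) (Metric.ball_mem_nhds z (by positivity))
      (Eventually.of_forall fun r => Measurable.aestronglyMeasurable (by fun_prop))
      (integrableOn_rpow_mul_cexp_neg hτ hz')
      (Measurable.aestronglyMeasurable (by fun_prop)) ?_
      (integrableOn_rpow_mul_exp_neg (by linarith) (by positivity)) ?_
    · exact key.2.differentiableAt.differentiableWithinAt
    · filter_upwards [ae_restrict_mem measurableSet_Ioi] with x hx w hw
      have hx' : (0 : ℝ) < x := hx
      rw [← mul_assoc, norm_mul, norm_rpow_mul_cexp_neg hx', norm_neg, Complex.norm_real,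
        Real.norm_of_nonneg hx'.le]
      have e1 : x ^ (τ + 1 - 1) = x ^ (τ - 1) * x := by
        rw [← Real.rpow_add_one hx'.ne']; congr 1; ring
      rw [e1, mul_right_comm]
      have := hball w hw
      gcongr
    · refine Eventually.of_forall fun x w _ => ?_
      have h1 : HasDerivAt (fun r : ℂ => -(r * x)) (-(x : ℂ)) w := by
        simpa using! ((hasDerivAt_id w).mul_const (x : ℂ)).neg
      exact (h1.cexp).const_mul _
  have hGd : DifferentiableOn ℂ (fun r : ℂ => r ^ (-(τ : ℂ)) * Complex.Gamma τ) U := by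
    intro z hz
    refine DifferentiableAt.differentiableWithinAt ?_
    exact ((differentiableAt_id.cpow_const (Or.inl hz)).mul_const _)
  have hreal : ∀ x : ℝ, 0 < x → F x = (x : ℂ) ^ (-(τ : ℂ)) * Complex.Gamma τ := by
    intro x hx
    have h1 := Complex.integral_cpow_mul_exp_neg_mul_Ioi (a := τ) (r := x) (by simpa using hτ) hx
    have h2 : ((1 / x : ℂ)) ^ (τ : ℂ) = (x : ℂ) ^ (-(τ : ℂ)) := by
      rw [one_div, ← Complex.ofReal_inv, ← Complex.ofReal_cpow (by positivity),
        ← Complex.ofReal_neg, ← Complex.ofReal_cpow hx.le, Real.inv_rpow hx.le,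
        Real.rpow_neg hx.le]
    rw [← h2, ← h1]
    refine setIntegral_congr_fun measurableSet_Ioi fun t ht => ?_
    have ht' : (0 : ℝ) < t := ht
    rw [Complex.ofReal_cpow ht'.le]
    push_cast
    rfl
  -- the positive reals accumulate at `1`, so the identity theorem applies
  have hfreq : ∃ᶠ z in 𝓝[≠] (1 : ℂ), F z = z ^ (-(τ : ℂ)) * Complex.Gamma τ := by
    have hseq : Tendsto (fun n : ℕ => (((1 : ℝ) + 1 / ((n : ℝ) + 1) : ℝ) : ℂ)) atTop (𝓝[≠] 1) := by
      refine tendsto_nhdsWithin_iff.mpr ⟨?_, Eventually.of_forall fun n => ?_⟩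
      · have := (tendsto_one_div_add_atTop_nhds_zero_nat (𝕜 := ℝ)).const_add 1
        rw [add_zero] at this
        have h2 := (Complex.continuous_ofReal.tendsto (1 : ℝ)).comp this
        rw [Complex.ofReal_one] at h2
        exact h2
      · have : (0 : ℝ) < 1 / ((n : ℝ) + 1) := by positivity
        simp only [mem_compl_iff, mem_singleton_iff]
        intro h
        have h2 := congrArg Complex.re h
        rw [Complex.ofReal_re, Complex.one_re] at h2
        linarith
    refine hseq.frequently (Frequently.of_forall fun n => hreal _ (by positivity))
  exact (hFd.analyticOnNhd hUo).eqOn_of_preconnected_of_frequently_eq (hGd.analyticOnNhd hUo)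
    (convex_halfSpace_re_gt 0).isPreconnected (by simp [hU]) hfreq hr

variable {d : ℕ}

/-- A symmetric bilinear form on Euclidean space is diagonal in orthonormal coordinates. -/
theorem exists_linearIsometryEquiv_diagonal
    (B : EuclideanSpace ℝ (Fin d) →L[ℝ] EuclideanSpace ℝ (Fin d) →L[ℝ] ℝ)
    (hB : ∀ x y, B x y = B y x) :
    ∃ (O : EuclideanSpace ℝ (Fin d) ≃ₗᵢ[ℝ] EuclideanSpace ℝ (Fin d)) (l : Fin d → ℝ),
      ∀ x, B (O x) (O x) = ∑ i, l i * x i ^ 2 := by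
  let T : EuclideanSpace ℝ (Fin d) →ₗ[ℝ] EuclideanSpace ℝ (Fin d) :=
    ((InnerProductSpace.toDual ℝ
      (EuclideanSpace ℝ (Fin d))).symm.toLinearEquiv.toLinearMap) ∘ₗ
    (B : EuclideanSpace ℝ (Fin d) →ₗ[ℝ] (EuclideanSpace ℝ (Fin d) →L[ℝ] ℝ))
  have hT : ∀ x y, inner ℝ (T x) y = B x y := by
    intro x y
    exact InnerProductSpace.toDual_symm_apply
  have hTs : T.IsSymmetric := by
    intro x y
    rw [hT, real_inner_comm, hT, hB]
  have hn : Module.finrank ℝ (EuclideanSpace ℝ (Fin d)) = d := finrank_euclideanSpace_fin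
  let b := hTs.eigenvectorBasis hn
  refine ⟨b.repr.symm, hTs.eigenvalues hn, fun x => ?_⟩
  rw [← hT, ← b.repr.inner_map_map, LinearIsometryEquiv.apply_symm_apply,
    PiLp.inner_apply]
  refine Finset.sum_congr rfl fun i _ => ?_
  rw [hTs.eigenvectorBasis_apply_self_apply hn, LinearIsometryEquiv.apply_symm_apply]
  simp
  ring

theorem integral_cexp_neg_diagonal_ne_zero (l : Fin d → ℝ) :
    ∫ x : EuclideanSpace ℝ (Fin d),
      Complex.exp (-∑ i, (1 + Complex.I * l i) * (x i : ℂ) ^ 2) ≠ 0 := by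
  have h := (EuclideanSpace.volume_preserving_symm_measurableEquiv_toLp (Fin d)).integral_comp'
    (fun v : Fin d → ℝ => Complex.exp (-∑ i, (1 + Complex.I * l i) * (v i : ℂ) ^ 2))
  have h2 := GaussianFourier.integral_cexp_neg_sum_mul_add (ι := Fin d)
    (b := fun i => 1 + Complex.I * l i) (by simp) 0
  simp only [Pi.zero_apply, zero_mul, Finset.sum_const_zero, add_zero] at h2
  have h3 : ∫ x : EuclideanSpace ℝ (Fin d),
        Complex.exp (-∑ i, (1 + Complex.I * l i) * (x i : ℂ) ^ 2) =
      ∫ v : Fin d → ℝ, Complex.exp (-∑ i, (1 + Complex.I * l i) * (v i : ℂ) ^ 2) := h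
  rw [h3, h2]
  refine Finset.prod_ne_zero_iff.mpr fun i _ => mul_ne_zero ?_ (Complex.exp_ne_zero _)
  have hne : (1 + Complex.I * l i : ℂ) ≠ 0 := by
    intro h0
    simpa using congrArg Complex.re h0
  rw [Ne, Complex.cpow_eq_zero_iff]
  intro h0
  exact div_ne_zero (by exact_mod_cast Real.pi_ne_zero) hne h0.1

theorem integral_comp_linearEquiv_eq_zero
    (L : EuclideanSpace ℝ (Fin d) ≃ₗ[ℝ] EuclideanSpace ℝ (Fin d)) {f : EuclideanSpace ℝ (Fin d) → ℂ}
    (hf : ∫ x, f x = 0) : ∫ x, f (L x) = 0 := by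
  have hdet : LinearMap.det (L : EuclideanSpace ℝ (Fin d) →ₗ[ℝ] EuclideanSpace ℝ (Fin d)) ≠ 0 :=
    (LinearEquiv.isUnit_det' L).ne_zero
  have h1 := Measure.map_linearMap_addHaar_eq_smul_addHaar
    (volume : Measure (EuclideanSpace ℝ (Fin d))) hdet
  have h2 := integral_map_equiv (μ := (volume : Measure (EuclideanSpace ℝ (Fin d))))
    L.toContinuousLinearEquiv.toHomeomorph.toMeasurableEquiv f
  have h3 : (⇑(L.toContinuousLinearEquiv.toHomeomorph.toMeasurableEquiv) :
      EuclideanSpace ℝ (Fin d) → EuclideanSpace ℝ (Fin d)) =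
    ⇑(L : EuclideanSpace ℝ (Fin d) →ₗ[ℝ] EuclideanSpace ℝ (Fin d)) := rfl
  rw [h3, h1, integral_smul_measure, hf, smul_zero] at h2
  exact h2.symm

/-- A Gaussian integral with a complex quadratic form of positive definite real part does not
vanish: the real and the imaginary part of the form are diagonalized simultaneously. -/
theorem integral_cexp_neg_quadratic_ne_zero
    (B : EuclideanSpace ℝ (Fin d) →L[ℝ] EuclideanSpace ℝ (Fin d) →L[ℝ] ℂ)
    (hB : ∀ x y, B x y = B y x) {c : ℝ} (hc : 0 < c) (hpos : ∀ x, c * ‖x‖ ^ 2 ≤ (B x x).re) :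
    ∫ x : EuclideanSpace ℝ (Fin d), Complex.exp (-(B x x)) ≠ 0 := by
  obtain ⟨O, l, hl⟩ := exists_linearIsometryEquiv_diagonal
    ((ContinuousLinearMap.compL ℝ (EuclideanSpace ℝ (Fin d)) ℂ ℝ Complex.reCLM).comp B)
    (by intro x y; simp [hB x y])
  have hlpos : ∀ i, 0 < l i := by
    intro i
    have h1 := hl (EuclideanSpace.single i 1)
    have h2 := hpos (O (EuclideanSpace.single i 1))
    rw [LinearIsometryEquiv.norm_map] at h2
    simp at h1 h2
    linarith
  -- after a dilation of the axes the real part is the standard form `∑ xᵢ²`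
  let D : EuclideanSpace ℝ (Fin d) ≃ₗ[ℝ] EuclideanSpace ℝ (Fin d) :=
    { toFun := fun x => WithLp.toLp 2 fun i => (Real.sqrt (l i))⁻¹ * x i
      invFun := fun x => WithLp.toLp 2 fun i => Real.sqrt (l i) * x i
      map_add' := fun x y => by ext i; simp [mul_add]
      map_smul' := fun r x => by ext i; simp; ring
      left_inv := fun x => by
        ext i
        have := (Real.sqrt_pos.mpr (hlpos i)).ne'
        simp [this]
      right_inv := fun x => by
        ext i
        have := (Real.sqrt_pos.mpr (hlpos i)).ne'
        simp [this] }
  let L₁ : EuclideanSpace ℝ (Fin d) ≃ₗ[ℝ] EuclideanSpace ℝ (Fin d) := D.trans O.toLinearEquiv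
  have hL₁ : ∀ x, (B (L₁ x) (L₁ x)).re = ∑ i, x i ^ 2 := by
    intro x
    have := hl (D x)
    refine Eq.trans this (Finset.sum_congr rfl fun i _ => ?_)
    have h0 := Real.sq_sqrt (hlpos i).le
    have h1 := (hlpos i).ne'
    simp only [D, LinearEquiv.coe_mk, LinearMap.coe_mk, AddHom.coe_mk, mul_pow, inv_pow, h0]
    field_simp
  let L₁' : EuclideanSpace ℝ (Fin d) →L[ℝ] EuclideanSpace ℝ (Fin d) := L₁.toContinuousLinearEquiv
  -- a rotation that diagonalizes the imaginary part keeps this form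
  obtain ⟨O₂, l₂, hl₂⟩ := exists_linearIsometryEquiv_diagonal
    ((ContinuousLinearMap.compL ℝ (EuclideanSpace ℝ (Fin d)) ℂ ℝ Complex.imCLM).comp
      (B.bilinearComp L₁' L₁'))
    (by intro x y; simp [hB (L₁' x) (L₁' y)])
  intro h0
  have h1 := integral_comp_linearEquiv_eq_zero (O₂.toLinearEquiv.trans L₁) h0
  refine integral_cexp_neg_diagonal_ne_zero l₂ (Eq.trans (integral_congr_ae ?_) h1)
  refine Eventually.of_forall fun x => ?_
  simp only
  congr 2
  apply Complex.ext
  · have e1 := hL₁ (O₂ x)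
    have e2 : ∑ i, (O₂ x) i ^ 2 = ∑ i, x i ^ 2 := by
      have h3 := LinearIsometryEquiv.norm_map O₂ x
      rw [EuclideanSpace.norm_eq, EuclideanSpace.norm_eq, Real.sqrt_inj (by positivity)
        (by positivity)] at h3
      simpa using h3
    rw [e2] at e1
    refine Eq.trans ?_ e1.symm
    rw [Complex.re_sum]
    refine Finset.sum_congr rfl fun i _ => ?_
    simp [← Complex.ofReal_pow]
  · have e1 := hl₂ x
    refine Eq.trans ?_ e1.symm
    rw [Complex.im_sum]
    refine Finset.sum_congr rfl fun i _ => ?_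
    simp [← Complex.ofReal_pow]

end

/-! ### The constant in the asymptotics -/

section

variable {d : ℕ}

theorem integral_comp_sqrt_smul {F : Type*} [NormedAddCommGroup F] [NormedSpace ℝ F]
    (f : EuclideanSpace ℝ (Fin d) → F) {t : ℝ} (ht : 0 < t) :
    ∫ u, f (Real.sqrt t • u) = (t ^ (-(d / 2 : ℝ))) • ∫ u, f u := by
  rw [Measure.integral_comp_smul, finrank_euclideanSpace_fin, abs_of_nonneg (by positivity),
    Real.sqrt_eq_rpow, ← Real.rpow_natCast, ← Real.rpow_mul ht.le, Real.rpow_neg ht.le]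
  congr 3
  ring

theorem fwdDiff_iter_cexp_neg (l : ℝ) (q : ℂ) (k : ℕ) (x : ℝ) :
    (fwdDiff (1 : ℝ))^[k] (fun x : ℝ => Complex.exp (-((x + q) * l))) x =
      (Complex.exp (-l) - 1) ^ k * Complex.exp (-((x + q) * l)) := by
  induction k generalizing x with
  | zero => simp
  | succ k ih =>
    rw [Function.iterate_succ_apply']
    simp only [fwdDiff, ih]
    have : Complex.exp (-(((x + 1 : ℝ) + q) * l)) =
        Complex.exp (-((x + q) * l)) * Complex.exp (-l) := by
      rw [← Complex.exp_add]
      congr 1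
      push_cast
      ring
    rw [this]
    ring

/-- Subordination of the differences of `x ↦ (x + q) ^ (-τ)` to exponentials. -/
theorem fwdDiff_iter_cpow_mul_Gamma {τ : ℝ} (hτ : 0 < τ) {q : ℂ} (hq : 0 ≤ q.re) (k : ℕ) :
    (fwdDiff (1 : ℝ))^[k] (fun x : ℝ => ((x : ℂ) + q) ^ (-(τ : ℂ))) 1 * Complex.Gamma τ =
      ∫ l : ℝ in Ioi 0, ((l ^ (τ - 1) : ℝ) : ℂ) *
        ((Complex.exp (-l) - 1) ^ k * Complex.exp (-((1 + q) * l))) := by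
  have h1 : ∀ l : ℝ, ((l ^ (τ - 1) : ℝ) : ℂ) *
        ((Complex.exp (-l) - 1) ^ k * Complex.exp (-((1 + q) * l))) =
      ∑ j ∈ Finset.range (k + 1), ((-1 : ℤ) ^ (k - j) * (k.choose j : ℤ)) •
        (((l ^ (τ - 1) : ℝ) : ℂ) * Complex.exp (-((((1 + j • (1 : ℝ) : ℝ) : ℂ) + q) * l))) := by
    intro l
    have := fwdDiff_iter_cexp_neg l q k 1
    rw [Complex.ofReal_one] at this
    rw [← this, fwdDiff_iter_eq_sum_shift, Finset.mul_sum]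
    refine Finset.sum_congr rfl fun j _ => ?_
    rw [mul_smul_comm]
  have hre : ∀ j : ℕ, 0 < ((((1 + j • (1 : ℝ) : ℝ) : ℂ) + q)).re := by
    intro j
    rw [Complex.add_re, Complex.ofReal_re]
    have : (0 : ℝ) ≤ j • (1 : ℝ) := by positivity
    linarith
  simp_rw [h1, zsmul_eq_mul]
  rw [integral_finsetSum _ fun j _ => (integrableOn_rpow_mul_cexp_neg hτ (hre j)).const_mul _,
    fwdDiff_iter_eq_sum_shift, Finset.sum_mul]
  refine Finset.sum_congr rfl fun j _ => ?_
  rw [integral_const_mul, integral_rpow_mul_cexp_neg hτ (hre j), zsmul_eq_mul, mul_assoc]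

theorem integrable_exp_neg_mul_of_le {q : EuclideanSpace ℝ (Fin d) → ℂ} (hqc : Continuous q)
    {c : ℝ} (hc : 0 < c) (hpos : ∀ x, c * ‖x‖ ^ 2 ≤ (q x).re) {t : ℝ} (ht : 0 < t) :
    Integrable fun x => Complex.exp (-(q x * t)) := by
  have h := (GaussianFourier.integrable_cexp_neg_mul_sq_norm_add
    (V := EuclideanSpace ℝ (Fin d)) (b := ((c * t : ℝ) : ℂ)) (by simp; positivity) 0 0).norm
  refine h.mono' (Continuous.aestronglyMeasurable (by fun_prop)) (Eventually.of_forall fun x => ?_)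
  rw [Complex.norm_exp, Complex.norm_exp]
  apply Real.exp_le_exp.mpr
  simp [← Complex.ofReal_pow]
  nlinarith [hpos x]

/-- The leading coefficient of the singularity of `∫ (s + B(u, u)) ^ (-τ)` in `s` does not vanish.
By subordination it is, up to `Γ(τ)` and a sign, the product of a positive integral and of the
Gaussian integral of the quadratic form. The differences are needed for convergence: without them
the integral over `u` diverges when `τ ≤ d / 2`. -/
theorem integral_fwdDiff_cpow_ne_zero
    (B : EuclideanSpace ℝ (Fin d) →L[ℝ] EuclideanSpace ℝ (Fin d) →L[ℝ] ℂ)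
    (hB : ∀ x y, B x y = B y x) {c : ℝ} (hc : 0 < c) (hpos : ∀ x, c * ‖x‖ ^ 2 ≤ (B x x).re)
    {τ : ℝ} (hτ : 0 < τ) {k : ℕ} (hk : (d / 2 : ℝ) < τ + k) :
    ∫ u, (fwdDiff (1 : ℝ))^[k] (fun x : ℝ => ((x : ℂ) + B u u) ^ (-(τ : ℂ))) 1 ≠ 0 := by
  have hZ := integral_cexp_neg_quadratic_ne_zero B hB hc hpos
  set Z := ∫ u, Complex.exp (-(B u u)) with hZdef
  have hqc : Continuous fun u => B u u := B.continuous.clm_apply continuous_id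
  have hnn : ∀ u, 0 ≤ (B u u).re := fun u => le_trans (by positivity) (hpos u)
  have hscale : ∀ t : ℝ, 0 < t → ∀ u, B (Real.sqrt t • u) (Real.sqrt t • u) = B u u * t := by
    intro t ht u
    have h2 : ((Real.sqrt t : ℝ) : ℂ) * (Real.sqrt t : ℝ) = t := by
      rw [← Complex.ofReal_mul, Real.mul_self_sqrt ht.le]
    simp only [map_smul, smul_apply, Complex.real_smul]
    rw [← mul_assoc, h2, mul_comm]
  have hZt : ∀ t : ℝ, 0 < t → ∫ u, Complex.exp (-(B u u * t)) =
      ((t ^ (-(d / 2 : ℝ)) : ℝ) : ℂ) * Z := by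
    intro t ht
    have := integral_comp_sqrt_smul (fun u => Complex.exp (-(B u u))) ht
    simp_rw [hscale t ht] at this
    rw [this, Complex.real_smul]
  set K := ∫ u, Real.exp (-(B u u).re)
  have hKt : ∀ t : ℝ, 0 < t → ∫ u, Real.exp (-((B u u).re * t)) = t ^ (-(d / 2 : ℝ)) * K := by
    intro t ht
    have := integral_comp_sqrt_smul (fun u => Real.exp (-(B u u).re)) ht
    simp_rw [hscale t ht, Complex.re_mul_ofReal] at this
    rw [this, smul_eq_mul]
  set g : EuclideanSpace ℝ (Fin d) → ℝ → ℂ := fun u l => ((l ^ (τ - 1) : ℝ) : ℂ) *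
        ((Complex.exp (-l) - 1) ^ k * Complex.exp (-((1 + B u u) * l))) with hg
  have hg' : ∀ u l, g u l = (((l ^ (τ - 1) * Real.exp (-l) * (Real.exp (-l) - 1) ^ k : ℝ)) : ℂ) *
      Complex.exp (-(B u u * l)) := by
    intro u l
    simp only [hg]
    rw [show -((1 + B u u) * (l : ℂ)) = -(l : ℂ) + -(B u u * l) by ring, Complex.exp_add]
    push_cast
    ring
  have hnorm : ∀ l : ℝ, 0 < l → ∀ u, ‖g u l‖ =
      (l ^ (τ - 1) * Real.exp (-l) * (1 - Real.exp (-l)) ^ k) * Real.exp (-((B u u).re * l)) := by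
    intro l hl u
    have h1 : Real.exp (-l) ≤ 1 := Real.exp_le_one_iff.mpr (by linarith)
    rw [hg', norm_mul, Complex.norm_exp, Complex.norm_real, norm_mul, norm_pow,
      Real.norm_of_nonneg (by positivity), Real.norm_eq_abs, abs_sub_comm,
      abs_of_nonneg (by linarith)]
    simp
  -- the weight that remains after the integration over `u`; it is of order
  -- `l ^ (τ + k - d / 2 - 1)` at `0`, which is integrable by `hk`
  set w : ℝ → ℝ := fun l => l ^ (τ - 1 - d / 2) * Real.exp (-l) * (1 - Real.exp (-l)) ^ k with hw
  have hwpow : ∀ l : ℝ, 0 < l → l ^ (τ - 1) * l ^ (-(d / 2 : ℝ)) = l ^ (τ - 1 - d / 2) := by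
    intro l hl
    rw [← Real.rpow_add hl]
    congr 1
  have hwint : IntegrableOn w (Ioi 0) := by
    refine (integrableOn_rpow_mul_exp_neg (τ := τ + k - d / 2) (b := 1) (by linarith)
      one_pos).mono' (Measurable.aestronglyMeasurable (by fun_prop)) ?_
    filter_upwards [ae_restrict_mem measurableSet_Ioi] with l hl
    have hl' : (0 : ℝ) < l := hl
    have h1 : Real.exp (-l) ≤ 1 := Real.exp_le_one_iff.mpr (by linarith)
    have h2 : 1 - Real.exp (-l) ≤ l := by linarith [Real.add_one_le_exp (-l)]
    have h0 : 0 ≤ 1 - Real.exp (-l) := by linarith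
    rw [Real.norm_of_nonneg (by positivity), one_mul]
    calc w l ≤ l ^ (τ - 1 - d / 2) * Real.exp (-l) * l ^ k := by
          simp only [hw]; gcongr
      _ = l ^ (τ - 1 - d / 2) * l ^ (k : ℝ) * Real.exp (-l) := by rw [Real.rpow_natCast]; ring
      _ = _ := by rw [← Real.rpow_add hl']; congr 2; ring
  have hwpos : 0 < ∫ l in Ioi 0, w l := by
    have hpos : ∀ l : ℝ, 0 < l → 0 < w l := by
      intro l hl
      have : Real.exp (-l) < 1 := Real.exp_lt_one_iff.mpr (by linarith)
      have h0 : 0 < 1 - Real.exp (-l) := by linarith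
      positivity
    rw [setIntegral_pos_iff_support_of_nonneg_ae _ hwint]
    · have : Function.support w ∩ Ioi 0 = Ioi 0 := by
        ext l
        simp only [mem_inter_iff, Function.mem_support, mem_Ioi, and_iff_right_iff_imp]
        exact fun hl => (hpos l hl).ne'
      rw [this]
      simp
    · filter_upwards [ae_restrict_mem measurableSet_Ioi] with l hl
      exact (hpos l hl).le
  have hint : Integrable (Function.uncurry fun (l : ℝ) (u : EuclideanSpace ℝ (Fin d)) => g u l)
      ((volume.restrict (Ioi (0 : ℝ))).prod volume) := by
    rw [integrable_prod_iff]
    · constructor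
      · filter_upwards [ae_restrict_mem measurableSet_Ioi] with l hl
        have h := integrable_exp_neg_mul_of_le hqc hc hpos (t := l) hl
        simp only [Function.uncurry, hg']
        exact h.const_mul _
      · refine (hwint.mul_const K).congr ?_
        filter_upwards [ae_restrict_mem measurableSet_Ioi] with l hl
        simp only [Function.uncurry]
        simp_rw [hnorm l hl]
        rw [integral_const_mul, hKt l hl]
        simp only [hw]
        rw [← hwpow l hl]
        ring
    · refine Measurable.aestronglyMeasurable ?_
      have hq' : Measurable fun u => B u u := hqc.measurable
      simp only [hg]
      fun_prop
  have hmain : (∫ u, (fwdDiff (1 : ℝ))^[k] (fun x : ℝ => ((x : ℂ) + B u u) ^ (-(τ : ℂ))) 1) *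
      Complex.Gamma τ = ((((-1) ^ k * ∫ l in Ioi 0, w l : ℝ)) : ℂ) * Z := by
    rw [← integral_mul_const]
    simp_rw [fwdDiff_iter_cpow_mul_Gamma hτ (hnn _) k]
    have hswap := integral_integral_swap hint
    calc _ = ∫ u, ∫ l in Ioi 0, g u l := rfl
      _ = ∫ l in Ioi 0, ∫ u, g u l := hswap.symm
      _ = ∫ l in Ioi 0, (((-1) ^ k * w l : ℝ) : ℂ) * Z := by
          refine setIntegral_congr_fun measurableSet_Ioi fun l hl => ?_
          simp only [hg']
          rw [integral_const_mul, hZt l hl, ← mul_assoc, ← Complex.ofReal_mul]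
          congr 2
          simp only [hw]
          rw [← hwpow l hl, ← neg_sub 1 (Real.exp (-l)), neg_pow]
          ring
      _ = _ := by
          rw [integral_mul_const, integral_complex_ofReal, integral_const_mul]
  intro h0
  rw [h0, zero_mul] at hmain
  have := mul_ne_zero (Complex.ofReal_ne_zero.mpr
    (mul_ne_zero (pow_ne_zero k (by norm_num : (-1 : ℝ) ≠ 0)) hwpos.ne')) hZ
  exact this hmain.symm

end

/-! ### Asymptotics of differences of singular integrals -/

section

theorem cpow_ofReal_mul {r : ℝ} (hr : 0 < r) {z : ℂ} (hz : z ≠ 0) (τ : ℝ) :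
    ((r : ℂ) * z) ^ (-(τ : ℂ)) = ((r ^ (-τ) : ℝ) : ℂ) * z ^ (-(τ : ℂ)) := by
  have hr' : (r : ℂ) ≠ 0 := Complex.ofReal_ne_zero.mpr hr.ne'
  rw [Complex.cpow_def_of_ne_zero (mul_ne_zero hr' hz), Complex.cpow_def_of_ne_zero hz,
    Complex.log_ofReal_mul hr hz, add_mul, Complex.exp_add, Real.rpow_def_of_pos hr]
  push_cast
  rfl

section

variable {E : Type*} [NormedAddCommGroup E] [NormedSpace ℝ E] {G : ℝ × E → ℂ}

/-- If `G (0, y)` dominates `‖y‖ ^ 2` and `∂G/∂s = 1` at the origin, then `Re G (s, y)` dominates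
`s + ‖y‖ ^ 2` for small `s ≥ 0`. -/
theorem exists_re_lower_bound (hG : ContDiffAt ℝ ∞ G 0)
    (hD : ∀ s y, fderiv ℝ G 0 (s, y) = (s : ℂ)) {c : ℝ} (hc : 0 < c)
    (hlow : ∀ᶠ y in 𝓝 (0 : E), c * ‖y‖ ^ 2 ≤ (G (0, y)).re) :
    ∃ ε > 0, ∃ c' > 0, ∀ s ∈ Ico 0 ε, ∀ y ∈ Metric.ball (0 : E) ε,
      c' * (s + ‖y‖ ^ 2) ≤ (G (s, y)).re := by
  have hst := (hG.hasStrictFDerivAt (by simp)).isLittleO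
  have h1 := (Asymptotics.isLittleO_iff.mp hst) (c := 1 / 2) (by norm_num)
  rw [← Prod.mk_zero_zero, nhds_prod_eq, nhds_prod_eq] at h1
  obtain ⟨ε₁, hε₁, hb₁⟩ := Metric.eventually_nhds_iff_ball.mp
    (show ∀ᶠ p in 𝓝 ((((0 : ℝ), (0 : E))), ((0 : ℝ), (0 : E))), _ by
      rw [nhds_prod_eq, nhds_prod_eq]; exact h1)
  obtain ⟨ε₂, hε₂, hb₂⟩ := Metric.eventually_nhds_iff_ball.mp hlow
  refine ⟨min ε₁ ε₂, by positivity, min (1 / 2) c, by positivity, fun s hs y hy => ?_⟩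
  rw [Metric.mem_ball, dist_zero_right, lt_min_iff] at hy
  have hs2 := lt_min_iff.mp hs.2
  have h2 := hb₁ (((s, y)), (0, y)) (by
    simp only [Metric.mem_ball, Prod.dist_eq, max_lt_iff, dist_zero_right, Real.norm_eq_abs,
      abs_of_nonneg hs.1, norm_zero]
    exact ⟨⟨hs2.1, hy.1⟩, hε₁, hy.1⟩)
  have h3 := hb₂ y (by simpa using hy.2)
  simp only [Prod.mk_sub_mk, sub_zero, sub_self, Prod.mk_zero_zero, hD] at h2
  have h4 : ‖((s : ℝ), (0 : E))‖ = s := by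
    rw [Prod.norm_mk, norm_zero, Real.norm_of_nonneg hs.1, max_eq_left hs.1]
  rw [h4] at h2
  have h5 := (abs_le.mp ((Complex.abs_re_le_norm _).trans h2)).1
  simp only [Complex.sub_re, Complex.ofReal_re] at h5
  have h6 : min (1 / 2) c * s ≤ 1 / 2 * s := mul_le_mul_of_nonneg_right (min_le_left _ _) hs.1
  have h7 : min (1 / 2) c * ‖y‖ ^ 2 ≤ c * ‖y‖ ^ 2 :=
    mul_le_mul_of_nonneg_right (min_le_right _ _) (by positivity)
  rw [mul_add]
  linarith

/-- Half of the second derivative of `G` at the origin in the directions of `E`. -/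
def halfHessian (G : ℝ × E → ℂ) : E →L[ℝ] E →L[ℝ] ℂ :=
  (1 / 2 : ℝ) • (fderiv ℝ (fderiv ℝ G) 0).bilinearComp (ContinuousLinearMap.inr ℝ ℝ E)
    (ContinuousLinearMap.inr ℝ ℝ E)

theorem halfHessian_comm (hG : ContDiffAt ℝ ∞ G 0) (x y : E) :
    halfHessian G x y = halfHessian G y x := by
  have hs : IsSymmSndFDerivAt ℝ G 0 :=
    (hG.of_le (m := 2) (by norm_cast)).isSymmSndFDerivAt (by simp)
  simp only [halfHessian, smul_apply, ContinuousLinearMap.bilinearComp_apply]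
  rw [hs]

/-- Under the parabolic dilation `(x, u) ↦ (s x, √s u)`, the function `G` is asymptotic to `s` times
its quadratic model. -/
theorem tendsto_parabolic_scaling (hG : ContDiffAt ℝ ∞ G 0) (h0 : G 0 = 0)
    (hD : ∀ s y, fderiv ℝ G 0 (s, y) = (s : ℂ)) (x : ℝ) (u : E) :
    Tendsto (fun s : ℝ => ((s⁻¹ : ℝ) : ℂ) * G (s * x, Real.sqrt s • u)) (𝓝[>] 0)
      (𝓝 (x + halfHessian G u u)) := by
  have hT := (hG.of_le (m := 2) (by norm_cast)).taylor_two
  set A := fderiv ℝ (fderiv ℝ G) 0 with hA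
  have hsq : Tendsto (fun s : ℝ => Real.sqrt s) (𝓝[>] 0) (𝓝 0) := by
    have := (Real.continuous_sqrt.tendsto 0).mono_left (nhdsWithin_le_nhds (s := Ioi 0))
    rwa [Real.sqrt_zero] at this
  have hid : Tendsto (fun s : ℝ => s) (𝓝[>] 0) (𝓝 0) := nhdsWithin_le_nhds
  set v : ℝ → ℝ × E := fun s => (s * x, Real.sqrt s • u) with hv
  set v' : ℝ → ℝ × E := fun s => (Real.sqrt s * x, u) with hv'
  have hvv : ∀ s : ℝ, 0 < s → v s = Real.sqrt s • v' s := by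
    intro s hs
    simp only [hv, hv', Prod.smul_mk, smul_eq_mul, ← mul_assoc, Real.mul_self_sqrt hs.le]
  have hv't : Tendsto v' (𝓝[>] 0) (𝓝 (0, u)) := by
    have := (hsq.mul_const x).prodMk_nhds (tendsto_const_nhds (x := u))
    rwa [zero_mul] at this
  have hvt : Tendsto v (𝓝[>] 0) (𝓝 0) := by
    have := (hid.mul_const x).prodMk_nhds (hsq.smul_const u)
    rwa [zero_mul, zero_smul] at this
  have hrem := hT.comp_tendsto hvt
  have hrem2 : Tendsto (fun s => ((s⁻¹ : ℝ) : ℂ) * (G (0 + v s) - G 0 - fderiv ℝ G 0 (v s)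
      - (1 / 2 : ℝ) • A (v s) (v s))) (𝓝[>] 0) (𝓝 0) := by
    have hO : (fun s => ‖v s‖ ^ 2) =O[𝓝[>] 0] fun s : ℝ => s := by
      have h1 : ∀ᶠ s in 𝓝[>] (0 : ℝ), ‖v' s‖ ^ 2 ≤ ‖((0 : ℝ), u)‖ ^ 2 + 1 :=
        ((hv't.norm.pow 2).eventually_lt_const (by linarith)).mono fun s hs => hs.le
      refine Asymptotics.IsBigO.of_bound (‖((0 : ℝ), u)‖ ^ 2 + 1) ?_
      filter_upwards [h1, self_mem_nhdsWithin] with s hs1 hs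
      have hs' : (0 : ℝ) < s := hs
      rw [hvv s hs', norm_smul, mul_pow, Real.norm_of_nonneg (Real.sqrt_nonneg s),
        Real.sq_sqrt hs'.le, Real.norm_of_nonneg (by positivity), Real.norm_of_nonneg hs'.le,
        mul_comm]
      gcongr
    have := (hrem.trans_isBigO hO).tendsto_inv_smul_nhds_zero
    simpa [Function.comp_def] using this
  have hquad : Tendsto (fun s => (1 / 2 : ℝ) • A (v' s) (v' s)) (𝓝[>] 0)
      (𝓝 (halfHessian G u u)) := by
    have hc : Continuous fun w : ℝ × E => (1 / 2 : ℝ) • A w w :=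
      (continuous_const_smul (1 / 2 : ℝ)).comp (A.continuous.clm_apply continuous_id)
    have := (hc.tendsto (0, u)).comp hv't
    exact this
  have hsum := (hrem2.add hquad).const_add (x : ℂ)
  rw [zero_add] at hsum
  refine hsum.congr' ?_
  filter_upwards [self_mem_nhdsWithin] with s hs
  have hs' : (0 : ℝ) < s := hs
  have hAv : A (v s) (v s) = (s : ℂ) * A (v' s) (v' s) := by
    have h2 : ((Real.sqrt s : ℝ) : ℂ) * (Real.sqrt s : ℝ) = s := by
      rw [← Complex.ofReal_mul, Real.mul_self_sqrt hs'.le]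
    rw [hvv s hs']
    simp only [map_smul, smul_apply, Complex.real_smul]
    rw [← mul_assoc, h2]
  have hne : (s : ℂ) ≠ 0 := Complex.ofReal_ne_zero.mpr hs'.ne'
  rw [zero_add, h0, sub_zero, hAv, hD]
  simp only [Complex.real_smul]
  push_cast
  field_simp
  ring

end

variable {d : ℕ} {G : ℝ × EuclideanSpace ℝ (Fin d) → ℂ}

theorem halfHessian_re_lower_bound (hG : ContDiffAt ℝ ∞ G 0) (h0 : G 0 = 0)
    (hD : ∀ s y, fderiv ℝ G 0 (s, y) = (s : ℂ)) {c : ℝ}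
    (hlow : ∀ᶠ y in 𝓝 (0 : EuclideanSpace ℝ (Fin d)), c * ‖y‖ ^ 2 ≤ (G (0, y)).re)
    (u : EuclideanSpace ℝ (Fin d)) : c * ‖u‖ ^ 2 ≤ (halfHessian G u u).re := by
  have h1 := (Complex.continuous_re.tendsto _).comp (tendsto_parabolic_scaling hG h0 hD 0 u)
  simp only [mul_zero, Complex.ofReal_zero, zero_add] at h1
  have hsq : Tendsto (fun s : ℝ => Real.sqrt s • u) (𝓝[>] 0) (𝓝 0) := by
    have := ((Real.continuous_sqrt.tendsto 0).mono_left
      (nhdsWithin_le_nhds (s := Ioi 0))).smul_const u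
    rwa [Real.sqrt_zero, zero_smul] at this
  refine ge_of_tendsto h1 ?_
  filter_upwards [hsq.eventually hlow, self_mem_nhdsWithin] with s hs hs0
  have hs' : (0 : ℝ) < s := hs0
  simp only [Function.comp, Complex.re_ofReal_mul]
  rw [norm_smul, mul_pow, Real.norm_of_nonneg (Real.sqrt_nonneg s), Real.sq_sqrt hs'.le] at hs
  rw [inv_mul_eq_div, le_div_iff₀ hs']
  linarith

/-- Asymptotics of the differences of `s ↦ ∫ a(y) G(s, y) ^ (-τ) dy`. The parabolic dilation
`y = √s u` and dominated convergence reduce the integral to that of the quadratic model. -/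
theorem tendsto_integral_fwdDiff (hG : ContDiffAt ℝ ∞ G 0) (h0 : G 0 = 0)
    (hD : ∀ s y, fderiv ℝ G 0 (s, y) = (s : ℂ)) {c : ℝ} (hc : 0 < c)
    (hlow : ∀ᶠ y in 𝓝 (0 : EuclideanSpace ℝ (Fin d)), c * ‖y‖ ^ 2 ≤ (G (0, y)).re)
    {τ : ℝ} (hτ : 0 < τ) {k : ℕ} (hk : (d / 2 : ℝ) < τ + k) :
    ∃ ε > 0, ∀ δ, 0 < δ → δ < ε → ∀ a : EuclideanSpace ℝ (Fin d) → ℂ,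
      ContinuousOn a (Metric.closedBall 0 δ) →
      Tendsto (fun s : ℝ => ((s ^ (τ - d / 2) : ℝ) : ℂ) * ∫ y in Metric.ball 0 δ,
        a y * (fwdDiff s)^[k] (fun x => G (x, y) ^ (-(τ : ℂ))) s) (𝓝[>] 0)
        (𝓝 (a 0 * ∫ u, (fwdDiff (1 : ℝ))^[k]
          (fun x : ℝ => ((x : ℂ) + halfHessian G u u) ^ (-(τ : ℂ))) 1)) := by
  obtain ⟨ε₁, hε₁, c', hc', hre⟩ := exists_re_lower_bound hG hD hc hlow
  obtain ⟨ε₂, hε₂, B, hB0, hB⟩ := exists_norm_fwdDiff_iter_mul_cpow_le (y₀ := 0) hG k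
    (fun _ => 1) τ hτ.le contDiffAt_const
  obtain ⟨ε₃, hε₃, hdiff⟩ := ContDiffAt.exists_ball_differentiableAt (y₀ := 0) hG
  -- the last two entries make `c' * (s + ‖y‖ ^ 2) ≤ 1` on the region considered
  set ε := min (min ε₁ ε₂) (min (min ε₃ 1) (1 / (2 * c'))) with hε
  have hε0 : 0 < ε := by positivity
  have hle : ε ≤ ε₁ ∧ ε ≤ ε₂ ∧ ε ≤ ε₃ ∧ ε ≤ 1 ∧ ε ≤ 1 / (2 * c') := by
    simp only [hε]
    refine ⟨?_, ?_, ?_, ?_, ?_⟩ <;> simp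
  obtain ⟨hl1, hl2, hl3, hl4, hl5⟩ := hle
  refine ⟨ε, hε0, fun δ hδ hδε a ha => ?_⟩
  obtain ⟨K, hK⟩ :=
    (isCompact_closedBall (0 : EuclideanSpace ℝ (Fin d)) δ).exists_bound_of_continuousOn ha
  have hK0 : 0 ≤ K := (norm_nonneg _).trans (hK 0 (Metric.mem_closedBall_self hδ.le))
  set D : ℝ → EuclideanSpace ℝ (Fin d) → ℂ :=
    fun s y => (fwdDiff s)^[k] (fun x => G (x, y) ^ (-(τ : ℂ))) s with hDdef
  have hDsum : ∀ s y, D s y = ∑ j ∈ Finset.range (k + 1),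
      ((-1 : ℤ) ^ (k - j) * (k.choose j : ℤ)) • G (s + j • s, y) ^ (-(τ : ℂ)) := fun s y =>
    fwdDiff_iter_eq_sum_shift s _ k s
  set f : ℝ → EuclideanSpace ℝ (Fin d) → ℂ := fun s =>
    (Metric.ball 0 δ).indicator fun y => a y * D s y with hf
  have hsm : ∀ᶠ s : ℝ in 𝓝[>] 0, 0 < s ∧ s + k * s < ε := by
    have h1 : Tendsto (fun s : ℝ => s + k * s) (𝓝 0) (𝓝 0) := by
      have : Continuous fun s : ℝ => s + k * s := by fun_prop
      simpa using this.tendsto 0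
    filter_upwards [nhdsWithin_le_nhds (h1.eventually_lt_const hε0), self_mem_nhdsWithin]
      with s h2 h3
    exact ⟨h3, h2⟩
  have hjs : ∀ s : ℝ, 0 < s → s + k * s < ε → ∀ j ∈ Finset.range (k + 1),
      0 < s + j • s ∧ s + j • s < ε := by
    intro s hs hsε j hj
    have hj' : (j : ℝ) ≤ k := by exact_mod_cast Nat.lt_succ_iff.mp (Finset.mem_range.mp hj)
    have h1 : (j : ℝ) * s ≤ k * s := mul_le_mul_of_nonneg_right hj' hs.le
    have h2 : 0 ≤ (j : ℝ) * s := by positivity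
    rw [nsmul_eq_mul]
    constructor <;> linarith
  have hrepos : ∀ x, 0 < x → x < ε → ∀ y ∈ Metric.ball (0 : EuclideanSpace ℝ (Fin d)) δ,
      0 < (G (x, y)).re := by
    intro x hx hxε y hy
    refine lt_of_lt_of_le ?_ (hre x ⟨hx.le, by linarith⟩ y
      (Metric.ball_subset_ball (by linarith) hy))
    positivity
  have hcontD : ∀ s : ℝ, 0 < s → s + k * s < ε → ContinuousOn (D s) (Metric.ball 0 δ) := by
    intro s hs hsε
    simp only [funext (hDsum s)]
    refine continuousOn_finsetSum _ fun j hj => ContinuousOn.const_smul ?_ _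
    obtain ⟨hj1, hj2⟩ := hjs s hs hsε j hj
    intro y hy
    have hd : ContinuousAt G (s + j • s, y) := (hdiff _ ⟨by linarith, by linarith⟩ y
      (Metric.ball_subset_ball (by linarith) hy)).continuousAt
    have hd' : ContinuousAt (fun y => G (s + j • s, y)) y :=
      ContinuousAt.comp (f := fun y => (s + j • s, y)) hd (by fun_prop)
    exact (hd'.cpow continuousAt_const (Or.inl (hrepos _ hj1 hj2 y hy))).continuousWithinAt
  have hscal : ∀ᶠ s : ℝ in 𝓝[>] 0, ∫ u, ((s ^ τ : ℝ) : ℂ) * f s (Real.sqrt s • u) =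
      ((s ^ (τ - d / 2) : ℝ) : ℂ) * ∫ y in Metric.ball 0 δ, a y * D s y := by
    filter_upwards [self_mem_nhdsWithin] with s hs
    have hs' : (0 : ℝ) < s := hs
    rw [integral_const_mul, integral_comp_sqrt_smul (f s) hs',
      integral_indicator measurableSet_ball, Complex.real_smul, ← mul_assoc,
      ← Complex.ofReal_mul, ← Real.rpow_add hs', ← sub_eq_add_neg]
  refine Tendsto.congr' hscal ?_
  rw [← integral_const_mul]
  -- after the dilation the integrand is dominated by a multiple of `(1 + ‖u‖ ^ 2) ^ (-(τ + k))`,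
  -- which is integrable since `2 (τ + k) > d`
  refine tendsto_integral_filter_of_dominated_convergence
    (fun u => K * (B * c' ^ (-(τ + k))) * (1 + ‖u‖ ^ 2) ^ (-(2 * (τ + k)) / 2)) ?_ ?_ ?_ ?_
  · filter_upwards [hsm] with s hs
    have hm : AEStronglyMeasurable (f s) := by
      rw [aestronglyMeasurable_indicator_iff measurableSet_ball]
      exact ((ha.mono Metric.ball_subset_closedBall).mul
        (hcontD s hs.1 hs.2)).aestronglyMeasurable measurableSet_ball
    have hq : Measure.QuasiMeasurePreserving
        (fun u : EuclideanSpace ℝ (Fin d) => Real.sqrt s • u) := by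
      refine ⟨by fun_prop, ?_⟩
      have hne : Real.sqrt s ≠ 0 := (Real.sqrt_pos.mpr hs.1).ne'
      rw [Measure.map_addHaar_smul volume hne]
      exact Measure.smul_absolutelyContinuous
    exact (hm.comp_quasiMeasurePreserving hq).const_mul _
  · filter_upwards [hsm] with s hs
    refine Eventually.of_forall fun u => ?_
    have hnn : 0 ≤ K * (B * c' ^ (-(τ + k))) * (1 + ‖u‖ ^ 2) ^ (-(2 * (τ + k)) / 2) := by positivity
    by_cases hu : Real.sqrt s • u ∈ Metric.ball (0 : EuclideanSpace ℝ (Fin d)) δ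
    swap
    · simp only [hf, indicator_of_notMem hu, mul_zero, norm_zero]
      exact hnn
    simp only [hf, indicator_of_mem hu]
    have hs0 := hs.1
    have hks : (0 : ℝ) ≤ k * s := by positivity
    have hnu : ‖Real.sqrt s • u‖ ^ 2 = s * ‖u‖ ^ 2 := by
      rw [norm_smul, mul_pow, Real.norm_of_nonneg (Real.sqrt_nonneg s), Real.sq_sqrt hs0.le]
    have hnu2 : ‖Real.sqrt s • u‖ ^ 2 ≤ ε := by
      rw [Metric.mem_ball, dist_zero_right] at hu
      nlinarith [norm_nonneg (Real.sqrt s • u)]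
    set m := c' * (s + s * ‖u‖ ^ 2) with hm
    have hm0 : 0 < m := by positivity
    have hm1 : m ≤ 1 := by
      rw [hnu] at hnu2
      calc m ≤ c' * (ε + ε) := by rw [hm]; gcongr; linarith [hs.2]
        _ = 2 * c' * ε := by ring
        _ ≤ 2 * c' * (1 / (2 * c')) := by gcongr
        _ = 1 := by field_simp
    have hb := hB (Real.sqrt s • u) (Metric.ball_subset_ball (by linarith) hu) s s m
      (by linarith) hs0.le (by linarith [hs.2]) hm0 hm1 (fun σ hσ => by
        have := hre σ ⟨by linarith [hσ.1], by linarith [hσ.2, hs.2]⟩ (Real.sqrt s • u)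
          (Metric.ball_subset_ball (by linarith) hu)
        rw [hnu] at this
        refine le_trans ?_ this
        rw [hm]
        gcongr
        exact hσ.1)
    simp only [one_mul] at hb
    rw [norm_mul, norm_mul, Complex.norm_real, Real.norm_of_nonneg (by positivity)]
    have hmp : m ^ (-(τ + k)) = c' ^ (-(τ + k)) * (s ^ (-(τ + k)) *
        (1 + ‖u‖ ^ 2) ^ (-(2 * (τ + k)) / 2)) := by
      rw [hm, show s + s * ‖u‖ ^ 2 = s * (1 + ‖u‖ ^ 2) by ring,
        Real.mul_rpow hc'.le (by positivity), Real.mul_rpow hs0.le (by positivity)]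
      congr 3
      ring
    have hsp : s ^ τ * (s ^ k * s ^ (-(τ + k))) = 1 := by
      rw [← Real.rpow_natCast s k, ← Real.rpow_add hs0, ← Real.rpow_add hs0]
      simp
    calc _ ≤ s ^ τ * (K * (B * s ^ k * m ^ (-(τ + k)))) := by
          gcongr
          exact hK _ (Metric.ball_subset_closedBall hu)
      _ = (s ^ τ * (s ^ k * s ^ (-(τ + k)))) * (K * (B * c' ^ (-(τ + k))) *
          (1 + ‖u‖ ^ 2) ^ (-(2 * (τ + k)) / 2)) := by rw [hmp]; ring
      _ = _ := by rw [hsp, one_mul]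
  · refine (integrable_rpow_neg_one_add_norm_sq ?_).const_mul _
    rw [finrank_euclideanSpace_fin]
    linarith
  · refine Eventually.of_forall fun u => ?_
    have hsq : Tendsto (fun s : ℝ => Real.sqrt s • u) (𝓝[>] 0) (𝓝 0) := by
      have := ((Real.continuous_sqrt.tendsto 0).mono_left
        (nhdsWithin_le_nhds (s := Ioi 0))).smul_const u
      rwa [Real.sqrt_zero, zero_smul] at this
    have hmem : ∀ᶠ s : ℝ in 𝓝[>] 0,
        Real.sqrt s • u ∈ Metric.ball (0 : EuclideanSpace ℝ (Fin d)) δ :=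
      hsq.eventually (Metric.ball_mem_nhds _ hδ)
    have hat : Tendsto (fun s : ℝ => a (Real.sqrt s • u)) (𝓝[>] 0) (𝓝 (a 0)) :=
      ((ha.continuousAt (Metric.closedBall_mem_nhds _ hδ)).tendsto).comp hsq
    have hqre : 0 ≤ (halfHessian G u u).re :=
      le_trans (by positivity) (halfHessian_re_lower_bound hG h0 hD hlow u)
    have hDt : Tendsto (fun s : ℝ => ((s ^ τ : ℝ) : ℂ) * D s (Real.sqrt s • u)) (𝓝[>] 0)
        (𝓝 ((fwdDiff (1 : ℝ))^[k]
          (fun x : ℝ => ((x : ℂ) + halfHessian G u u) ^ (-(τ : ℂ))) 1)) := by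
      rw [fwdDiff_iter_eq_sum_shift]
      have hterm : ∀ j ∈ Finset.range (k + 1), Tendsto (fun s : ℝ =>
          ((-1 : ℤ) ^ (k - j) * (k.choose j : ℤ)) •
            (((s⁻¹ : ℝ) : ℂ) * G (s * (1 + j • (1 : ℝ)), Real.sqrt s • u)) ^ (-(τ : ℂ))) (𝓝[>] 0)
          (𝓝 (((-1 : ℤ) ^ (k - j) * (k.choose j : ℤ)) •
            (((1 + j • (1 : ℝ) : ℝ) : ℂ) + halfHessian G u u) ^ (-(τ : ℂ)))) := by
        intro j _
        refine Tendsto.const_smul ?_ _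
        refine (tendsto_parabolic_scaling hG h0 hD _ u).cpow tendsto_const_nhds (Or.inl ?_)
        rw [Complex.add_re, Complex.ofReal_re]
        have : (0 : ℝ) ≤ j • (1 : ℝ) := by positivity
        linarith
      refine (tendsto_finsetSum _ hterm).congr' ?_
      filter_upwards [hsm, hmem] with s hs hu
      rw [hDsum, Finset.mul_sum]
      refine Finset.sum_congr rfl fun j hj => ?_
      obtain ⟨hj1, hj2⟩ := hjs s hs.1 hs.2 j hj
      have hne : G (s + j • s, Real.sqrt s • u) ≠ 0 := by
        intro h
        have := hrepos _ hj1 hj2 _ hu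
        rw [h] at this
        simp at this
      have e1 : s * (1 + j • (1 : ℝ)) = s + j • s := by simp; ring
      rw [e1, cpow_ofReal_mul (inv_pos.mpr hs.1) hne, mul_smul_comm, Real.inv_rpow hs.1.le,
        Real.rpow_neg hs.1.le, inv_inv]
    refine (hat.mul hDt).congr' ?_
    filter_upwards [hmem] with s hu
    simp only [hf, indicator_of_mem hu]
    ring

end

/-! ### Adapted expansions of the graphing function -/

/-- The holomorphic quadratic polynomial `∑ Aⱼₖ zⱼ zₖ`. -/
def quadPart {n : ℕ} (A : Matrix (Fin n) (Fin n) ℂ) (z : Fin n → ℂ) : ℂ :=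
  ∑ j, ∑ k, A j k * z j * z k

/-- The real part of the form `∑ Bⱼₖ zⱼ z̄ₖ`. -/
def hermPart {n : ℕ} (B : Matrix (Fin n) (Fin n) ℂ) (z : Fin n → ℂ) : ℝ :=
  (∑ j, ∑ k, B j k * z j * (starRingEnd ℂ) (z k)).re

section Forms

variable {n : ℕ} (A B : Matrix (Fin n) (Fin n) ℂ)

theorem quadPart_smul (c : ℂ) (z : Fin n → ℂ) : quadPart A (c • z) = c ^ 2 * quadPart A z := by
  simp only [quadPart, Finset.mul_sum, Pi.smul_apply, smul_eq_mul]
  refine Finset.sum_congr rfl fun j _ => Finset.sum_congr rfl fun k _ => ?_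
  ring

theorem hermPart_smul (c : ℂ) (z : Fin n → ℂ) :
    hermPart B (c • z) = ‖c‖ ^ 2 * hermPart B z := by
  have : (∑ j, ∑ k, B j k * (c • z) j * (starRingEnd ℂ) ((c • z) k)) =
      ((‖c‖ ^ 2 : ℝ) : ℂ) * ∑ j, ∑ k, B j k * z j * (starRingEnd ℂ) (z k) := by
    simp only [Finset.mul_sum, Pi.smul_apply, smul_eq_mul, map_mul]
    refine Finset.sum_congr rfl fun j _ => Finset.sum_congr rfl fun k _ => ?_
    rw [Complex.ofReal_pow, ← Complex.mul_conj']
    ring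
  rw [hermPart, this, Complex.re_ofReal_mul, hermPart]

theorem continuous_hermPart : Continuous (hermPart B) := by
  unfold hermPart
  refine Complex.continuous_re.comp ?_
  refine continuous_finsetSum _ fun j _ => continuous_finsetSum _ fun k _ => ?_
  exact (continuous_const.mul (continuous_apply j)).mul
    (Complex.continuous_conj.comp (continuous_apply k))

theorem quadPart_zero : quadPart A 0 = 0 := by simp [quadPart]

theorem hermPart_zero : hermPart B 0 = 0 := by simp [hermPart]

theorem exists_norm_quadPart_le : ∃ K ≥ 0, ∀ z, ‖quadPart A z‖ ≤ K * ‖z‖ ^ 2 := by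
  refine ⟨∑ j, ∑ k, ‖A j k‖, by positivity, fun z => ?_⟩
  simp only [quadPart, Finset.sum_mul]
  refine (norm_sum_le _ _).trans (Finset.sum_le_sum fun j _ => (norm_sum_le _ _).trans
    (Finset.sum_le_sum fun k _ => ?_))
  rw [norm_mul, norm_mul, mul_assoc, sq]
  gcongr <;> exact norm_le_pi_norm z _

theorem exists_abs_hermPart_le : ∃ K ≥ 0, ∀ z, |hermPart B z| ≤ K * ‖z‖ ^ 2 := by
  refine ⟨∑ j, ∑ k, ‖B j k‖, by positivity, fun z => ?_⟩
  refine (Complex.abs_re_le_norm _).trans ?_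
  simp only [Finset.sum_mul]
  refine (norm_sum_le _ _).trans (Finset.sum_le_sum fun j _ => (norm_sum_le _ _).trans
    (Finset.sum_le_sum fun k _ => ?_))
  rw [norm_mul, norm_mul, mul_assoc, sq, RCLike.norm_conj]
  gcongr <;> exact norm_le_pi_norm z _

theorem exists_hermPart_lower_bound (h : ∀ z, z ≠ 0 → 0 < hermPart B z) :
    ∃ c > 0, ∀ z, c * ‖z‖ ^ 2 ≤ hermPart B z := by
  have hS : IsCompact (Metric.sphere (0 : Fin n → ℂ) 1) := isCompact_sphere 0 1
  rcases (Metric.sphere (0 : Fin n → ℂ) 1).eq_empty_or_nonempty with he | hne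
  · refine ⟨1, one_pos, fun z => ?_⟩
    by_cases hz : z = 0
    · simp [hz, hermPart_zero]
    · exfalso
      have hmem : ((‖z‖⁻¹ : ℝ) : ℂ) • z ∈ Metric.sphere (0 : Fin n → ℂ) 1 := by
        rw [mem_sphere_zero_iff_norm, norm_smul, Complex.norm_real, norm_inv, norm_norm,
          inv_mul_cancel₀ (norm_ne_zero_iff.mpr hz)]
      rw [he] at hmem
      exact hmem
  · obtain ⟨z₀, hz₀, hmin⟩ := hS.exists_isMinOn hne (continuous_hermPart B).continuousOn
    have hz₀0 : z₀ ≠ 0 := by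
      rintro rfl
      simp at hz₀
    refine ⟨hermPart B z₀, h z₀ hz₀0, fun z => ?_⟩
    by_cases hz : z = 0
    · simp [hz, hermPart_zero]
    · have hn : ‖z‖ ≠ 0 := norm_ne_zero_iff.mpr hz
      have hmem : ((‖z‖⁻¹ : ℝ) : ℂ) • z ∈ Metric.sphere (0 : Fin n → ℂ) 1 := by
        rw [mem_sphere_zero_iff_norm, norm_smul, Complex.norm_real, norm_inv, norm_norm,
          inv_mul_cancel₀ hn]
      have h1 : hermPart B z₀ ≤ hermPart B (((‖z‖⁻¹ : ℝ) : ℂ) • z) := hmin hmem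
      rw [hermPart_smul, Complex.norm_real, norm_inv, norm_norm, inv_pow, inv_mul_eq_div,
        le_div_iff₀ (by positivity)] at h1
      exact h1

end Forms

section Adapted

variable {n : ℕ} {g : ℝ × (Fin n → ℂ) → ℝ} {ℓ : ℝ × (Fin n → ℂ) →L[ℝ] ℝ}
  {A B : Matrix (Fin n) (Fin n) ℂ}

/-- The normal form of the Taylor expansion of the graphing function `g` of a boundary in adapted
coordinates. -/
def AdaptedExpansion (g : ℝ × (Fin n → ℂ) → ℝ) (ℓ : ℝ × (Fin n → ℂ) →L[ℝ] ℝ)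
    (A B : Matrix (Fin n) (Fin n) ℂ) : Prop :=
  (fun v : ℝ × (Fin n → ℂ) => g v - (v.1 * ℓ v + 2 * (quadPart A v.2).re + hermPart B v.2))
    =O[𝓝 0] fun v => ‖v‖ ^ 3

theorem AdaptedExpansion.exists_bound (h : AdaptedExpansion g ℓ A B) :
    ∃ C ≥ 0, ∀ᶠ v in 𝓝 0,
      |g v - (v.1 * ℓ v + 2 * (quadPart A v.2).re + hermPart B v.2)| ≤ C * ‖v‖ ^ 3 := by
  obtain ⟨C, hC, hb⟩ := h.exists_nonneg
  refine ⟨C, hC, hb.bound.mono fun v hv => ?_⟩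
  simpa using hv

theorem AdaptedExpansion.map_zero (h : AdaptedExpansion g ℓ A B) : g 0 = 0 := by
  obtain ⟨C, -, hb⟩ := h.exists_bound
  have := hb.self_of_nhds
  simpa [quadPart_zero, hermPart_zero] using this

theorem AdaptedExpansion.exists_abs_le (h : AdaptedExpansion g ℓ A B) :
    ∃ C ≥ 0, ∀ᶠ v in 𝓝 0, |g v| ≤ C * ‖v‖ ^ 2 := by
  obtain ⟨C, hC, hb⟩ := h.exists_bound
  obtain ⟨KA, hKA, hA⟩ := exists_norm_quadPart_le A
  obtain ⟨KB, hKB, hB⟩ := exists_abs_hermPart_le B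
  refine ⟨C + ‖ℓ‖ + 2 * KA + KB, by positivity, ?_⟩
  filter_upwards [hb, Metric.ball_mem_nhds 0 one_pos] with v hv hv1
  have hn : ‖v‖ ≤ 1 := by simpa using (mem_ball_zero_iff.mp hv1).le
  have h1 : |v.1 * ℓ v| ≤ ‖ℓ‖ * ‖v‖ ^ 2 := by
    rw [abs_mul]
    have a1 : |v.1| ≤ ‖v‖ := norm_fst_le v
    have a2 : |ℓ v| ≤ ‖ℓ‖ * ‖v‖ := ℓ.le_opNorm v
    calc _ ≤ ‖v‖ * (‖ℓ‖ * ‖v‖) := by gcongr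
      _ = _ := by ring
  have h2 : |2 * (quadPart A v.2).re| ≤ 2 * KA * ‖v‖ ^ 2 := by
    rw [abs_mul, abs_two, mul_assoc]
    have a1 : ‖v.2‖ ≤ ‖v‖ := norm_snd_le v
    have := (Complex.abs_re_le_norm _).trans (hA v.2)
    have : |(quadPart A v.2).re| ≤ KA * ‖v‖ ^ 2 := this.trans (by gcongr)
    linarith
  have h3 : |hermPart B v.2| ≤ KB * ‖v‖ ^ 2 := by
    have a1 : ‖v.2‖ ≤ ‖v‖ := norm_snd_le v
    exact (hB v.2).trans (by gcongr)
  have h4 : C * ‖v‖ ^ 3 ≤ C * ‖v‖ ^ 2 := by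
    gcongr C * ?_
    exact pow_le_pow_of_le_one (norm_nonneg _) hn (by norm_num)
  have h5 : g v = (g v - (v.1 * ℓ v + 2 * (quadPart A v.2).re + hermPart B v.2)) + v.1 * ℓ v
    + 2 * (quadPart A v.2).re + hermPart B v.2 := by ring
  rw [h5]
  refine (abs_add_le _ _).trans ?_
  have := (abs_add_le ((g v - (v.1 * ℓ v + 2 * (quadPart A v.2).re + hermPart B v.2)) + v.1 * ℓ v)
    (2 * (quadPart A v.2).re))
  have := abs_add_le (g v - (v.1 * ℓ v + 2 * (quadPart A v.2).re + hermPart B v.2)) (v.1 * ℓ v)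
  linarith

theorem AdaptedExpansion.hasFDerivAt (h : AdaptedExpansion g ℓ A B) :
    HasFDerivAt g (0 : ℝ × (Fin n → ℂ) →L[ℝ] ℝ) 0 := by
  obtain ⟨C, hC, hb⟩ := h.exists_abs_le
  rw [hasFDerivAt_iff_isLittleO]
  have h1 : g =O[𝓝 0] fun v : ℝ × (Fin n → ℂ) => ‖v‖ ^ 2 :=
    Asymptotics.IsBigO.of_bound C (hb.mono fun v hv => by simpa using hv)
  have h2 : (fun v : ℝ × (Fin n → ℂ) => ‖v‖ ^ 2) =o[𝓝 0] fun v => v := by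
    refine Asymptotics.isLittleO_norm_right.mp ?_
    simpa using Asymptotics.isLittleO_norm_pow_norm_pow (E' := ℝ × (Fin n → ℂ))
      (m := 1) (n := 2) (by norm_num)
  simpa [h.map_zero] using h1.trans_isLittleO h2

/-- On the closure of the domain, the real part of `-i` times the Levi polynomial dominates the
positive definite form, up to an arbitrarily small multiple of `|Re z₀|`. -/
theorem AdaptedExpansion.re_lower_bound (h : AdaptedExpansion g ℓ A B) {c₀ : ℝ} (hc₀ : 0 < c₀)
    (hL : ∀ z, c₀ * ‖z‖ ^ 2 ≤ hermPart B z) {η : ℝ} (hη : 0 < η) :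
    ∀ᶠ v in 𝓝 (0 : Cmodel n), g (v.1.re, v.2) ≤ v.1.im →
      c₀ / 2 * ‖v.2‖ ^ 2 - η * |v.1.re| ≤
        (-Complex.I * (v.1 - 2 * Complex.I * quadPart A v.2)).re := by
  obtain ⟨C, hC, hb⟩ := h.exists_bound
  have ht : Tendsto (fun v : Cmodel n => (v.1.re, v.2)) (𝓝 0) (𝓝 0) := by
    have : Continuous fun v : Cmodel n => (v.1.re, v.2) := by fun_prop
    exact this.tendsto' 0 0 (by simp)
  -- in a ball of radius `r`, the term `t ℓ` is at most `η / 2 |t|` and the cubic remainder is at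
  -- most `η / 2 |t| + c₀ / 2 ‖z‖ ^ 2`
  set r : ℝ := min 1 (min (η / (2 * (‖ℓ‖ + 1))) (min (η / (2 * (C + 1))) (c₀ / (2 * (C + 1)))))
    with hr
  have hr0 : 0 < r := by positivity
  have hr1 : r ≤ 1 := min_le_left _ _
  have hr2 : r * (2 * (‖ℓ‖ + 1)) ≤ η := by
    rw [← le_div_iff₀ (by positivity)]
    exact (min_le_right _ _).trans (min_le_left _ _)
  have hr3 : r * (2 * (C + 1)) ≤ η := by
    rw [← le_div_iff₀ (by positivity)]
    exact (min_le_right _ _).trans ((min_le_right _ _).trans (min_le_left _ _))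
  have hr4 : r * (2 * (C + 1)) ≤ c₀ := by
    rw [← le_div_iff₀ (by positivity)]
    exact (min_le_right _ _).trans ((min_le_right _ _).trans (min_le_right _ _))
  filter_upwards [ht.eventually hb, ht.eventually (Metric.ball_mem_nhds 0 hr0)] with v hv hvr hvg
  set t := v.1.re with htdef
  set z := v.2 with hz
  have hnr : ‖(t, z)‖ < r := by simpa using hvr
  have e1 : (-Complex.I * (v.1 - 2 * Complex.I * quadPart A z)).re =
      v.1.im - 2 * (quadPart A z).re := by
    simp [Complex.mul_re, Complex.mul_im]
  rw [e1]
  have htn : |t| ≤ ‖(t, z)‖ := norm_fst_le (t, z)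
  have hl : |t * ℓ (t, z)| ≤ η / 2 * |t| := by
    rw [abs_mul]
    have a2 : |ℓ (t, z)| ≤ ‖ℓ‖ * ‖(t, z)‖ := ℓ.le_opNorm _
    have a3 : ‖ℓ‖ * ‖(t, z)‖ ≤ η / 2 := by nlinarith [norm_nonneg ℓ]
    nlinarith [abs_nonneg t]
  have hcube : C * ‖(t, z)‖ ^ 3 ≤ η / 2 * |t| + c₀ / 2 * ‖z‖ ^ 2 := by
    have b1 : ‖(t, z)‖ ^ 2 ≤ |t| + ‖z‖ ^ 2 := by
      rw [Prod.norm_mk, Real.norm_eq_abs]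
      have : |t| ≤ 1 := by linarith
      rcases le_total |t| ‖z‖ with h1 | h1
      · rw [max_eq_right h1]; linarith [abs_nonneg t]
      · rw [max_eq_left h1]; nlinarith [abs_nonneg t, sq_nonneg ‖z‖]
    have b2 : C * r ≤ η / 2 := by nlinarith
    have b3 : C * r ≤ c₀ / 2 := by nlinarith
    calc C * ‖(t, z)‖ ^ 3 = C * (‖(t, z)‖ * ‖(t, z)‖ ^ 2) := by ring
      _ ≤ C * (r * (|t| + ‖z‖ ^ 2)) := by gcongr
      _ = C * r * |t| + C * r * ‖z‖ ^ 2 := by ring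
      _ ≤ _ := by gcongr
  have h1 := (abs_le.mp hv).1
  have h2 := (abs_le.mp hl).1
  have h3 := hL z
  linarith

/-- Near the boundary point, `-i` times the Levi polynomial maps the closure of the domain, without
the point itself, to the slit plane. -/
theorem AdaptedExpansion.mem_slitPlane (h : AdaptedExpansion g ℓ A B) {c₀ : ℝ} (hc₀ : 0 < c₀)
    (hL : ∀ z, c₀ * ‖z‖ ^ 2 ≤ hermPart B z) :
    ∀ᶠ v in 𝓝 (0 : Cmodel n), g (v.1.re, v.2) ≤ v.1.im → v ≠ 0 →
      -Complex.I * (v.1 - 2 * Complex.I * quadPart A v.2) ∈ Complex.slitPlane := by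
  obtain ⟨K, hK, hA⟩ := exists_norm_quadPart_le A
  -- on the cut, `|Re z₀|` is at most `2 K ‖z‖ ^ 2`; with this `η` the lower bound absorbs it
  have hη : 0 < c₀ / (8 * (K + 1)) := by positivity
  filter_upwards [h.re_lower_bound hc₀ hL hη] with v hv hvg hv0
  by_contra hns
  rw [Complex.mem_slitPlane_iff, not_or, not_lt, not_not] at hns
  obtain ⟨hre, him⟩ := hns
  have hv' := hv hvg
  have him' : v.1.re = - (2 * (quadPart A v.2).im) := by
    simp [Complex.mul_re, Complex.mul_im] at him
    linarith
  have hre' : v.1.im ≤ 2 * (quadPart A v.2).re := by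
    simp [Complex.mul_re, Complex.mul_im] at hre
    linarith
  have ht : |v.1.re| ≤ 2 * (K * ‖v.2‖ ^ 2) := by
    rw [him', abs_neg, abs_mul, abs_two]
    have := (Complex.abs_im_le_norm _).trans (hA v.2)
    linarith
  have hz : ‖v.2‖ ^ 2 = 0 := by
    have h1 : c₀ / (8 * (K + 1)) * |v.1.re| ≤ c₀ / (8 * (K + 1)) * (2 * (K * ‖v.2‖ ^ 2)) := by
      gcongr
    have h2 : c₀ / (8 * (K + 1)) * (2 * (K * ‖v.2‖ ^ 2)) ≤ c₀ / 4 * ‖v.2‖ ^ 2 := by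
      have : c₀ / (8 * (K + 1)) * (2 * (K * ‖v.2‖ ^ 2)) =
        c₀ / 4 * ‖v.2‖ ^ 2 * (K / (K + 1)) := by field_simp; ring
      rw [this]
      refine mul_le_of_le_one_right (by positivity) ?_
      rw [div_le_one (by positivity)]
      linarith
    have h3 : c₀ / 4 * ‖v.2‖ ^ 2 ≤ 0 := by linarith
    nlinarith [sq_nonneg ‖v.2‖]
  have hz0 : v.2 = 0 := by simpa using hz
  rw [hz0, quadPart_zero] at him' hre'
  simp only [Complex.zero_im, mul_zero, neg_zero, Complex.zero_re] at him' hre'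
  have hg0 := h.map_zero
  rw [him', hz0, Prod.mk_zero_zero, hg0] at hvg
  apply hv0
  exact Prod.ext (Complex.ext him' (le_antisymm hre' hvg)) hz0

end Adapted

/-! ### The Levi form in adapted coordinates -/

section

variable {n : ℕ}

/-- The Levi form is invariant under holomorphic changes of coordinates: the second derivative of
the change of coordinates is complex bilinear, so its contributions in the directions `w` and
`i w` cancel. -/
theorem leviForm_comp {r : Cmodel n → ℝ} {Φ : Cmodel n → Cmodel n} {a : Cmodel n}
    (hr : ContDiffAt ℝ ∞ r (Φ a)) (hΦ : ContDiffAt ℂ ∞ Φ a) (w : Cmodel n) :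
    leviForm (r ∘ Φ) a w = leviForm r (Φ a) (fderiv ℂ Φ a w) := by
  have hΦR : ContDiffAt ℝ ∞ Φ a := hΦ.restrict_scalars ℝ
  have hΦe : ∀ᶠ x in 𝓝 a, DifferentiableAt ℂ Φ x :=
    ((hΦ.of_le (m := 1) (by norm_cast)).eventually (by simp)).mono
      fun x hx => hx.differentiableAt (by simp)
  have hre : ∀ᶠ x in 𝓝 a, DifferentiableAt ℝ r (Φ x) :=
    hΦR.continuousAt.eventually (((hr.of_le (m := 1) (by norm_cast)).eventually (by simp)).mono
      fun x hx => hx.differentiableAt (by simp))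
  have hR : ContDiffAt ℝ ∞ (r ∘ Φ) a := hr.comp a hΦR
  have hR2 : DifferentiableAt ℝ (fderiv ℝ (r ∘ Φ)) a :=
    (hR.fderiv_right (m := 1) (by norm_cast)).differentiableAt (by simp)
  have hr2 : DifferentiableAt ℝ (fderiv ℝ r) (Φ a) :=
    (hr.fderiv_right (m := 1) (by norm_cast)).differentiableAt (by simp)
  have hΦ2 : DifferentiableAt ℂ (fderiv ℂ Φ) a :=
    (hΦ.fderiv_right (m := 1) (by norm_cast)).differentiableAt (by simp)
  have hΦ1 : DifferentiableAt ℂ Φ a := hΦe.self_of_nhds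
  have key : ∀ v, fderiv ℝ (fderiv ℝ (r ∘ Φ)) a v v =
      fderiv ℝ r (Φ a) (fderiv ℂ (fderiv ℂ Φ) a v v) +
        fderiv ℝ (fderiv ℝ r) (Φ a) (fderiv ℂ Φ a v) (fderiv ℂ Φ a v) := by
    intro v
    have h1 : HasFDerivAt (fun x => fderiv ℝ (r ∘ Φ) x v)
        ((fderiv ℝ (fderiv ℝ (r ∘ Φ)) a).flip v) a := by
      have := hR2.hasFDerivAt.clm_apply (hasFDerivAt_const v a)
      simpa using this
    have h2 : (fun x => fderiv ℝ (r ∘ Φ) x v) =ᶠ[𝓝 a]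
        fun x => fderiv ℝ r (Φ x) (fderiv ℂ Φ x v) := by
      filter_upwards [hΦe, hre] with x hx hrx
      rw [fderiv_comp x hrx (hx.restrictScalars ℝ), hx.fderiv_restrictScalars ℝ]
      rfl
    have hc : HasFDerivAt (fun x => fderiv ℝ r (Φ x))
        ((fderiv ℝ (fderiv ℝ r) (Φ a)).comp ((fderiv ℂ Φ a).restrictScalars ℝ)) a :=
      hr2.hasFDerivAt.comp a (hΦ1.hasFDerivAt.restrictScalars ℝ)
    have hu : HasFDerivAt (fun x => fderiv ℂ Φ x v)
        (((fderiv ℂ (fderiv ℂ Φ) a).flip v).restrictScalars ℝ) a := by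
      have := hΦ2.hasFDerivAt.clm_apply (hasFDerivAt_const v a)
      have h3 : HasFDerivAt (fun x => fderiv ℂ Φ x v) ((fderiv ℂ (fderiv ℂ Φ) a).flip v) a := by
        simpa using this
      exact h3.restrictScalars ℝ
    have h4 := (hc.clm_apply hu).congr_of_eventuallyEq h2
    have h5 := congrArg (fun T => T v) (h1.unique h4)
    simpa using h5
  have hI : fderiv ℂ (fderiv ℂ Φ) a (Complex.I • w) (Complex.I • w) =
      -(fderiv ℂ (fderiv ℂ Φ) a w w) := by
    simp only [map_smul, smul_apply, smul_smul, Complex.I_mul_I, neg_one_smul]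
  rw [leviForm, leviForm, key, key, hI, map_neg, (fderiv ℂ Φ a).map_smul]
  ring

variable {g : ℝ × (Fin n → ℂ) → ℝ} {ℓ : ℝ × (Fin n → ℂ) →L[ℝ] ℝ}
  {A B : Matrix (Fin n) (Fin n) ℂ} {R : Cmodel n → ℝ}

/-- The differential of a defining function annihilates the directions `(a, ζ)` with `a` real. -/
theorem AdaptedExpansion.fderiv_eq_zero (h : AdaptedExpansion g ℓ A B)
    (hR : DifferentiableAt ℝ R 0)
    (hM : ∀ᶠ v in 𝓝 (0 : Cmodel n), g (v.1.re, v.2) < v.1.im ↔ R v < 0)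
    {w : Cmodel n} (hw : w.1.im = 0) : fderiv ℝ R 0 w = 0 := by
  obtain ⟨C, hC, hb⟩ := h.exists_abs_le
  -- the curve `s w + s² K i ∂/∂z₀` stays in the domain for `s ≠ 0`, so that `R` has a local maximum
  -- on it at `s = 0`
  set K : ℝ := C * ‖(w.1.re, w.2)‖ ^ 2 + 1 with hK
  set κ : ℝ → Cmodel n := fun s => s • w + (s ^ 2) • ((K : ℂ) * Complex.I, 0) with hκ
  have hκ0 : κ 0 = 0 := by simp [hκ]
  have hκd : HasDerivAt κ w 0 := by
    have h1 : HasDerivAt (fun s : ℝ => s • w) ((1 : ℝ) • w) 0 := (hasDerivAt_id 0).smul_const w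
    have h2 : HasDerivAt (fun s : ℝ => (s ^ 2) • (((K : ℂ) * Complex.I, 0) : Cmodel n))
        ((2 * (0 : ℝ) ^ (2 - 1) * 1) • (((K : ℂ) * Complex.I, 0) : Cmodel n)) 0 :=
      ((hasDerivAt_id (0 : ℝ)).pow 2).smul_const _
    exact (h1.add h2).congr_deriv (by simp)
  have hcomp : HasDerivAt (fun s => R (κ s)) (fderiv ℝ R 0 w) 0 := by
    have hR' : HasFDerivAt R (fderiv ℝ R 0) (κ 0) := by rw [hκ0]; exact hR.hasFDerivAt
    exact hR'.comp_hasDerivAt 0 hκd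
  have hκt : Tendsto κ (𝓝 0) (𝓝 0) := by
    have := hκd.continuousAt.tendsto
    rwa [hκ0] at this
  have hpt : Tendsto (fun s => ((κ s).1.re, (κ s).2)) (𝓝 0) (𝓝 0) := by
    have h1 : Continuous fun v : Cmodel n => (v.1.re, v.2) := by fun_prop
    exact (h1.tendsto' 0 0 (by simp)).comp hκt
  have hmax : IsLocalMax (fun s => R (κ s)) 0 := by
    have h0 : 0 ≤ R 0 := by
      have := hM.self_of_nhds
      rw [← not_lt, ← this]
      simp only [Prod.fst_zero, Prod.snd_zero, Complex.zero_re, Complex.zero_im]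
      rw [Prod.mk_zero_zero, h.map_zero]
      exact lt_irrefl 0
    filter_upwards [hκt.eventually hM, hpt.eventually hb] with s hs hbs
    simp only [hκ0]
    by_cases hs0 : s = 0
    · rw [hs0, hκ0]
    refine le_trans (le_of_lt (hs.mp ?_)) h0
    have e1 : ((κ s).1.re, (κ s).2) = s • (w.1.re, w.2) := by
      have h1 : ((s : ℂ) ^ 2).im = 0 := by rw [← Complex.ofReal_pow, Complex.ofReal_im]
      simp [hκ, h1]
    have e2 : (κ s).1.im = s ^ 2 * K := by
      simp [hκ, hw]
      left
      rw [← Complex.ofReal_pow, Complex.ofReal_re]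
    rw [e1, norm_smul, mul_pow, Real.norm_eq_abs, sq_abs] at hbs
    rw [e1, e2]
    have := (abs_le.mp hbs).2
    have hs2 : 0 < s ^ 2 := by positivity
    rw [hK]
    nlinarith
  exact hmax.hasDerivAt_eq_zero hcomp

/-- If the form `L` is nonpositive on `ζ`, the second order part of a defining function along the
holomorphic curve `s ↦ (2 i P(ζ) s², s ζ)` is nonpositive: after a correction of third order the
curve stays in the domain. -/
theorem AdaptedExpansion.second_order_nonpos (h : AdaptedExpansion g ℓ A B)
    (hR : ContDiffAt ℝ ∞ R 0)
    (hM : ∀ᶠ v in 𝓝 (0 : Cmodel n), g (v.1.re, v.2) < v.1.im ↔ R v < 0)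
    {ζ : Fin n → ℂ} (hζ : hermPart B ζ ≤ 0) :
    fderiv ℝ R 0 (2 * Complex.I * quadPart A ζ, 0) +
      1 / 2 * fderiv ℝ (fderiv ℝ R) 0 (0, ζ) (0, ζ) ≤ 0 := by
  obtain ⟨C, hC, hb⟩ := h.exists_bound
  set Q := quadPart A ζ with hQ
  set N : ℝ := max |(2 * Complex.I * Q).re| ‖ζ‖ with hN
  have hN0 : 0 ≤ N := le_trans (norm_nonneg ζ) (le_max_right _ _)
  -- `K s³` exceeds the sum of the terms of third order in the expansion of `g` along the curve
  set K : ℝ := |(2 * Complex.I * Q).re| * (‖ℓ‖ * N) + C * N ^ 3 + 1 with hK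
  -- the curve divided by its parameter
  set κ' : ℝ → Cmodel n := fun s => (s * (2 * Complex.I * Q + s * K * Complex.I), ζ) with hκ'
  set κ : ℝ → Cmodel n := fun s => s • κ' s with hκ
  have hκ't : Tendsto κ' (𝓝[>] 0) (𝓝 (0, ζ)) := by
    have : Continuous κ' := by fun_prop
    exact (this.tendsto' 0 (0, ζ) (by simp [hκ'])).mono_left nhdsWithin_le_nhds
  have hκt : Tendsto κ (𝓝[>] 0) (𝓝 0) := by
    have : Continuous κ := by fun_prop
    exact (this.tendsto' 0 0 (by simp [hκ])).mono_left nhdsWithin_le_nhds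
  have hpt : Tendsto (fun s => ((κ s).1.re, (κ s).2)) (𝓝[>] 0) (𝓝 0) := by
    have h1 : Continuous fun v : Cmodel n => (v.1.re, v.2) := by fun_prop
    exact (h1.tendsto' 0 0 (by simp)).comp hκt
  have h0 : 0 ≤ R 0 := by
    have := hM.self_of_nhds
    rw [← not_lt, ← this]
    simp only [Prod.fst_zero, Prod.snd_zero, Complex.zero_re, Complex.zero_im]
    rw [Prod.mk_zero_zero, h.map_zero]
    exact lt_irrefl 0
  have hsmall : ∀ᶠ s : ℝ in 𝓝[>] 0, s ∈ Ioo (0 : ℝ) 1 := Ioo_mem_nhdsGT one_pos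
  have hneg : ∀ᶠ s in 𝓝[>] (0 : ℝ), R (κ s) < 0 := by
    filter_upwards [hκt.eventually hM, hpt.eventually hb, hsmall] with s hs hbs hs01
    refine hs.mp ?_
    have hs0 : 0 < s := hs01.1
    have e1 : (κ s).1.re = s ^ 2 * (2 * Complex.I * Q).re := by
      simp [hκ, hκ']
      ring
    have e2 : (κ s).2 = (s : ℂ) • ζ := by
      simp [hκ, hκ']
    have e3 : (κ s).1.im = s ^ 2 * (2 * Q.re) + s ^ 3 * K := by
      simp [hκ, hκ']
      ring
    have e4 : quadPart A (κ s).2 = ((s ^ 2 : ℝ) : ℂ) * Q := by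
      rw [e2, quadPart_smul]; push_cast; rfl
    have e5 : hermPart B (κ s).2 ≤ 0 := by
      rw [e2, hermPart_smul]
      exact mul_nonpos_of_nonneg_of_nonpos (by positivity) hζ
    have e6 : ‖((κ s).1.re, (κ s).2)‖ ≤ s * N := by
      rw [Prod.norm_mk, e1, e2, norm_smul, Complex.norm_real, Real.norm_eq_abs, Real.norm_eq_abs,
        abs_of_pos hs0, abs_mul, abs_of_pos (by positivity : 0 < s ^ 2)]
      refine max_le ?_ ?_
      · have : |(2 * Complex.I * Q).re| ≤ N := le_max_left _ _
        have h2 : s ^ 2 ≤ s := by nlinarith [hs01.2]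
        exact mul_le_mul h2 this (abs_nonneg _) hs0.le
      · exact mul_le_mul_of_nonneg_left (le_max_right _ _) hs0.le
    have e7 : |(κ s).1.re * ℓ ((κ s).1.re, (κ s).2)| ≤
        s ^ 3 * (|(2 * Complex.I * Q).re| * (‖ℓ‖ * N)) := by
      rw [abs_mul, e1, abs_mul, abs_of_pos (by positivity : 0 < s ^ 2)]
      have a1 : |ℓ (s ^ 2 * (2 * Complex.I * Q).re, (κ s).2)| ≤ ‖ℓ‖ * (s * N) := by
        rw [← e1]
        exact (ℓ.le_opNorm _).trans (by gcongr)
      calc _ ≤ s ^ 2 * |(2 * Complex.I * Q).re| * (‖ℓ‖ * (s * N)) := by gcongr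
        _ = _ := by ring
    have e8 : C * ‖((κ s).1.re, (κ s).2)‖ ^ 3 ≤ s ^ 3 * (C * N ^ 3) := by
      calc _ ≤ C * (s * N) ^ 3 := by gcongr
        _ = _ := by ring
    have h1 := (abs_le.mp hbs).2
    have h2 := (abs_le.mp e7).2
    simp only [e4, Complex.re_ofReal_mul] at h1
    rw [e3, hK]
    have : 0 < s ^ 3 := by positivity
    nlinarith
  have hT := (hR.of_le (m := 2) (by norm_cast)).taylor_two
  set D := fderiv ℝ (fderiv ℝ R) 0 with hD
  have hrem : Tendsto (fun s => (s ^ 2)⁻¹ * (R (0 + κ s) - R 0 - fderiv ℝ R 0 (κ s)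
      - (1 / 2 : ℝ) • D (κ s) (κ s))) (𝓝[>] 0) (𝓝 0) := by
    have hO : (fun s => ‖κ s‖ ^ 2) =O[𝓝[>] 0] fun s : ℝ => s ^ 2 := by
      have h1 : ∀ᶠ s in 𝓝[>] (0 : ℝ), ‖κ' s‖ ^ 2 ≤ ‖((0, ζ) : Cmodel n)‖ ^ 2 + 1 :=
        ((hκ't.norm.pow 2).eventually_lt_const (by linarith)).mono fun s hs => hs.le
      refine Asymptotics.IsBigO.of_bound (‖((0, ζ) : Cmodel n)‖ ^ 2 + 1) ?_
      filter_upwards [h1] with s hs1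
      simp only [hκ]
      rw [norm_pow, norm_norm, norm_smul, mul_pow, norm_pow, mul_comm]
      gcongr
    exact ((hT.comp_tendsto hκt).trans_isBigO hO).tendsto_inv_smul_nhds_zero
  have hlin : Tendsto (fun s : ℝ => fderiv ℝ R 0 (2 * Complex.I * Q + s * K * Complex.I, 0))
      (𝓝[>] 0) (𝓝 (fderiv ℝ R 0 (2 * Complex.I * Q, 0))) := by
    have : Continuous fun s : ℝ =>
        fderiv ℝ R 0 ((2 * Complex.I * Q + s * K * Complex.I, 0) : Cmodel n) := by
      fun_prop
    exact (this.tendsto' 0 _ (by simp)).mono_left nhdsWithin_le_nhds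
  have hquad : Tendsto (fun s => 1 / 2 * D (κ' s) (κ' s)) (𝓝[>] 0)
      (𝓝 (1 / 2 * D (0, ζ) (0, ζ))) := by
    have hc : Continuous fun w : Cmodel n => 1 / 2 * D w w :=
      continuous_const.mul (D.continuous.clm_apply continuous_id)
    exact (hc.tendsto _).comp hκ't
  have hw0 : fderiv ℝ R 0 ((0, ζ) : Cmodel n) = 0 :=
    h.fderiv_eq_zero (hR.differentiableAt (by simp)) hM (by simp)
  have hsum := hrem.add (hlin.add hquad)
  rw [zero_add] at hsum
  refine le_of_tendsto hsum ?_
  filter_upwards [hneg, self_mem_nhdsWithin] with s hs hs0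
  have hs0' : (0 : ℝ) < s := hs0
  have e1 : fderiv ℝ R 0 (κ s) =
      s ^ 2 * fderiv ℝ R 0 (2 * Complex.I * Q + s * K * Complex.I, 0) := by
    have : κ s = s • ((0, ζ) : Cmodel n) +
        (s ^ 2) • ((2 * Complex.I * Q + s * K * Complex.I, 0) : Cmodel n) := by
      simp [hκ, hκ', Prod.ext_iff]
      ring
    rw [this, map_add, map_smul, map_smul, hw0, smul_zero, zero_add, smul_eq_mul]
  have e2 : D (κ s) (κ s) = s ^ 2 * D (κ' s) (κ' s) := by
    simp only [hκ, map_smul, smul_apply, smul_eq_mul]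
    ring
  rw [e1, e2, zero_add, smul_eq_mul]
  have h3 : (s ^ 2)⁻¹ * (R (κ s) - R 0 -
      s ^ 2 * fderiv ℝ R 0 (2 * Complex.I * Q + s * K * Complex.I, 0) -
      1 / 2 * (s ^ 2 * D (κ' s) (κ' s))) + (fderiv ℝ R 0 (2 * Complex.I * Q + s * K * Complex.I, 0)
      + 1 / 2 * D (κ' s) (κ' s)) = (s ^ 2)⁻¹ * (R (κ s) - R 0) := by
    field_simp
    ring
  rw [h3]
  exact mul_nonpos_of_nonneg_of_nonpos (by positivity) (by linarith)

/-- In adapted coordinates, strong pseudoconvexity means that the Hermitian form in the expansion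
of the graphing function is positive definite. -/
theorem AdaptedExpansion.hermPart_pos (h : AdaptedExpansion g ℓ A B)
    (hR : ContDiffAt ℝ ∞ R 0)
    (hM : ∀ᶠ v in 𝓝 (0 : Cmodel n), g (v.1.re, v.2) < v.1.im ↔ R v < 0)
    (hlevi : ∀ w : Cmodel n, w ≠ 0 → fderiv ℝ R 0 w = 0 → fderiv ℝ R 0 (Complex.I • w) = 0 →
      0 < leviForm R 0 w) (ζ : Fin n → ℂ) (hζ : ζ ≠ 0) : 0 < hermPart B ζ := by
  -- the inequalities for `ζ` and `i ζ` are added: since `P(i ζ) = -P(ζ)`, the terms of first order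
  -- cancel and the Levi form remains
  by_contra hneg
  rw [not_lt] at hneg
  have hRd : DifferentiableAt ℝ R 0 := hR.differentiableAt (by simp)
  have h1 := h.second_order_nonpos hR hM hneg
  have hI : hermPart B (Complex.I • ζ) ≤ 0 := by
    rw [hermPart_smul]
    simpa using hneg
  have h2 := h.second_order_nonpos hR hM hI
  have hw : ((0, ζ) : Cmodel n) ≠ 0 := by
    intro h0
    exact hζ (congrArg Prod.snd h0)
  have h3 := hlevi (0, ζ) hw (h.fderiv_eq_zero hRd hM (by simp))
    (h.fderiv_eq_zero hRd hM (by simp))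
  have e1 : ((0, Complex.I • ζ) : Cmodel n) = Complex.I • ((0, ζ) : Cmodel n) := by
    simp [Prod.smul_mk]
  have e2 : ((2 * Complex.I * quadPart A (Complex.I • ζ), 0) : Cmodel n) =
      -(2 * Complex.I * quadPart A ζ, 0) := by
    rw [quadPart_smul, Complex.I_sq]
    simp
  rw [e1, e2, map_neg] at h2
  rw [leviForm] at h3
  linarith

end

/-! ### The underlying real manifold and the complex tangent space -/

section

theorem eventually_coord_iff {n : ℕ} {X : Type*} [TopologicalSpace X] {x : X}
    {e : OpenPartialHomeomorph X (Cmodel n)} (hx : x ∈ e.source) (hex : e x = 0) {P : X → Prop}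
    (hP : ∀ᶠ z in 𝓝 x, P z) : ∀ᶠ v in 𝓝 (0 : Cmodel n), v ∈ e.target ∧ P (e.symm v) := by
  have h1 : e.symm (0 : Cmodel n) = x := by rw [← hex, e.left_inv hx]
  have ht : (0 : Cmodel n) ∈ e.target := by rw [← hex]; exact e.map_source hx
  have h2 : Tendsto e.symm (𝓝 (0 : Cmodel n)) (𝓝 x) := by
    have := (e.continuousAt_symm ht).tendsto
    rwa [h1] at this
  exact Filter.Eventually.and (e.open_target.mem_nhds ht) (h2.eventually hP)

variable {n : ℕ} {X : Type*} [TopologicalSpace X] [ChartedSpace (Cmodel n) X]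

theorem mem_contDiffGroupoid_real {f : OpenPartialHomeomorph (Cmodel n) (Cmodel n)}
    (hf : f ∈ contDiffGroupoid ω 𝓘(ℂ, Cmodel n)) : f ∈ contDiffGroupoid ∞ 𝓘(ℝ, Cmodel n) := by
  rw [contDiffGroupoid, mem_groupoid_of_pregroupoid] at hf ⊢
  exact ⟨(hf.1.restrict_scalars ℝ).of_le le_top, (hf.2.restrict_scalars ℝ).of_le le_top⟩

/-- A complex manifold is a smooth real manifold. -/
theorem isManifold_real [IsManifold 𝓘(ℂ, Cmodel n) ω X] : IsManifold 𝓘(ℝ, Cmodel n) ∞ X where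
  compatible he he' := mem_contDiffGroupoid_real
    (HasGroupoid.compatible (G := contDiffGroupoid ω 𝓘(ℂ, Cmodel n)) he he')

theorem mem_maximalAtlas_real {e : OpenPartialHomeomorph X (Cmodel n)}
    (he : e ∈ IsManifold.maximalAtlas 𝓘(ℂ, Cmodel n) ω X) :
    e ∈ IsManifold.maximalAtlas 𝓘(ℝ, Cmodel n) ∞ X := by
  intro e' he'
  have := he e' he'
  exact ⟨mem_contDiffGroupoid_real this.1, mem_contDiffGroupoid_real this.2⟩

theorem HasMFDerivAt.restrictScalars_real {f : X → Cmodel n} {x : X}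
    {L : Cmodel n →L[ℂ] Cmodel n}
    (hf : HasMFDerivAt 𝓘(ℂ, Cmodel n) 𝓘(ℂ, Cmodel n) f x L) :
    HasMFDerivAt 𝓘(ℝ, Cmodel n) 𝓘(ℝ, Cmodel n) f x
      (L.restrictScalars ℝ : Cmodel n →L[ℝ] Cmodel n) :=
  ⟨hf.1, HasFDerivWithinAt.restrictScalars ℝ
    (show HasFDerivWithinAt (writtenInExtChartAt 𝓘(ℂ, Cmodel n) 𝓘(ℂ, Cmodel n) x f) L _ _
      from hf.2)⟩

/-- The real differential of a holomorphic map commutes with the complex structures. -/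
theorem mfderiv_tangentMulI {f : X → Cmodel n} {x : X}
    (hf : MDifferentiableAt 𝓘(ℂ, Cmodel n) 𝓘(ℂ, Cmodel n) f x)
    (w : TangentSpace 𝓘(ℝ, Cmodel n) x) :
    mfderiv 𝓘(ℝ, Cmodel n) 𝓘(ℝ, Cmodel n) f x (tangentMulI x w) =
      tangentMulI (f x) (mfderiv 𝓘(ℝ, Cmodel n) 𝓘(ℝ, Cmodel n) f x w) := by
  obtain ⟨L, hL⟩ : ∃ L : Cmodel n →L[ℂ] Cmodel n,
      HasMFDerivAt 𝓘(ℂ, Cmodel n) 𝓘(ℂ, Cmodel n) f x L := ⟨_, hf.hasMFDerivAt⟩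
  have h1 := hL.restrictScalars_real.mfderiv
  rw [h1]
  exact L.map_smul Complex.I w

section

variable {M : Set X} {x : X}
  {e : OpenPartialHomeomorph X (Cmodel n)} {g : ℝ × (Fin n → ℂ) → ℝ}
  {ℓ : ℝ × (Fin n → ℂ) →L[ℝ] ℝ} {A B : Matrix (Fin n) (Fin n) ℂ}

theorem contMDiffAt_chart_real (he : e ∈ IsManifold.maximalAtlas 𝓘(ℂ, Cmodel n) ω X)
    (hx : x ∈ e.source) : ContMDiffAt 𝓘(ℝ, Cmodel n) 𝓘(ℝ, Cmodel n) ∞ e x :=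
  contMDiffAt_of_mem_maximalAtlas (mem_maximalAtlas_real he) hx

theorem contMDiffAt_chart_symm_real (he : e ∈ IsManifold.maximalAtlas 𝓘(ℂ, Cmodel n) ω X)
    {v : Cmodel n} (hv : v ∈ e.target) :
    ContMDiffAt 𝓘(ℝ, Cmodel n) 𝓘(ℝ, Cmodel n) ∞ e.symm v :=
  contMDiffAt_symm_of_mem_maximalAtlas (mem_maximalAtlas_real he) hv

theorem contDiffAt_transition {e' : OpenPartialHomeomorph X (Cmodel n)}
    (he : e ∈ IsManifold.maximalAtlas 𝓘(ℂ, Cmodel n) ω X)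
    (he' : e' ∈ IsManifold.maximalAtlas 𝓘(ℂ, Cmodel n) ω X) (hx : x ∈ e.source)
    (hx' : x ∈ e'.source) : ContDiffAt ℂ ω (e' ∘ e.symm) (e x) := by
  rw [← contMDiffAt_iff_contDiffAt]
  have h1 := contMDiffAt_symm_of_mem_maximalAtlas he (e.map_source hx)
  have h2 : ContMDiffAt 𝓘(ℂ, Cmodel n) 𝓘(ℂ, Cmodel n) ω e' (e.symm (e x)) := by
    rw [e.left_inv hx]
    exact contMDiffAt_of_mem_maximalAtlas he' hx'
  exact h2.comp _ h1

/-- The graphing function of the boundary gives a local defining function. -/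
theorem isLocalDefiningFunction_graph (he : e ∈ IsManifold.maximalAtlas 𝓘(ℂ, Cmodel n) ω X)
    (hx : x ∈ e.source) (hex : e x = 0) (hgs : ∀ᶠ v in 𝓝 0, ContDiffAt ℝ ∞ g v)
    (hg : AdaptedExpansion g ℓ A B)
    (hM : ∀ᶠ z in 𝓝 x, z ∈ M ↔ g ((e z).1.re, (e z).2) < (e z).1.im) :
    IsLocalDefiningFunction (n := n) M x
      (fun z => g ((e z).1.re, (e z).2) - (e z).1.im) ∧
    ∀ w : TangentSpace 𝓘(ℝ, Cmodel n) x,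
      mfderiv 𝓘(ℝ, Cmodel n) 𝓘(ℝ, ℝ) (fun z => g ((e z).1.re, (e z).2) - (e z).1.im) x w =
        -(mfderiv 𝓘(ℝ, Cmodel n) 𝓘(ℝ, Cmodel n) e x w : Cmodel n).1.im := by
  set π : Cmodel n → ℝ × (Fin n → ℂ) := fun v => (v.1.re, v.2) with hπ
  have hπc : ContDiff ℝ ∞ π := by
    refine ContDiff.prodMk ?_ contDiff_snd
    exact Complex.reCLM.contDiff.comp contDiff_fst
  have hπ0 : π 0 = 0 := by simp [hπ]
  set r : Cmodel n → ℝ := fun v => g (π v) - v.1.im with hr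
  have hrs : ∀ v, ContDiffAt ℝ ∞ g (π v) → ContDiffAt ℝ ∞ r v := by
    intro v hv
    refine (hv.comp v hπc.contDiffAt).sub ?_
    exact (Complex.imCLM.contDiff.comp contDiff_fst).contDiffAt
  have hrd : HasFDerivAt r (-(Complex.imCLM.comp (ContinuousLinearMap.fst ℝ ℂ (Fin n → ℂ)))) 0 := by
    have h1 : HasFDerivAt (fun v => g (π v)) (0 : Cmodel n →L[ℝ] ℝ) 0 := by
      have h2 : HasFDerivAt g (0 : ℝ × (Fin n → ℂ) →L[ℝ] ℝ) (π 0) := by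
        rw [hπ0]; exact hg.hasFDerivAt
      have := h2.comp (0 : Cmodel n) (hπc.contDiffAt.differentiableAt (by simp)).hasFDerivAt
      rwa [ContinuousLinearMap.zero_comp] at this
    have h3 : HasFDerivAt (fun v : Cmodel n => v.1.im)
        (Complex.imCLM.comp (ContinuousLinearMap.fst ℝ ℂ (Fin n → ℂ))) 0 :=
      (Complex.imCLM.comp (ContinuousLinearMap.fst ℝ ℂ (Fin n → ℂ))).hasFDerivAt
    have := h1.sub h3
    rw [zero_sub] at this
    exact this
  have hed : MDifferentiableAt 𝓘(ℝ, Cmodel n) 𝓘(ℝ, Cmodel n) e x :=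
    (contMDiffAt_chart_real he hx).mdifferentiableAt (by simp)
  have hder : HasMFDerivAt 𝓘(ℝ, Cmodel n) 𝓘(ℝ, ℝ) (fun z => g ((e z).1.re, (e z).2) - (e z).1.im) x
      ((-(Complex.imCLM.comp (ContinuousLinearMap.fst ℝ ℂ (Fin n → ℂ))) : Cmodel n →L[ℝ] ℝ).comp
        (show Cmodel n →L[ℝ] Cmodel n from mfderiv 𝓘(ℝ, Cmodel n) 𝓘(ℝ, Cmodel n) e x)) := by
    have h1 : HasMFDerivAt 𝓘(ℝ, Cmodel n) 𝓘(ℝ, ℝ) r (e x)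
        (-(Complex.imCLM.comp (ContinuousLinearMap.fst ℝ ℂ (Fin n → ℂ))) : Cmodel n →L[ℝ] ℝ) := by
      rw [hex]
      exact hrd.hasMFDerivAt
    exact HasMFDerivAt.comp x h1 hed.hasMFDerivAt
  have hform : ∀ w : TangentSpace 𝓘(ℝ, Cmodel n) x,
      mfderiv 𝓘(ℝ, Cmodel n) 𝓘(ℝ, ℝ) (fun z => g ((e z).1.re, (e z).2) - (e z).1.im) x w =
        -(mfderiv 𝓘(ℝ, Cmodel n) 𝓘(ℝ, Cmodel n) e x w : Cmodel n).1.im := by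
    intro w
    rw [hder.mfderiv]
    rfl
  refine ⟨⟨?_, ?_⟩, hform⟩
  · have hcont : Tendsto (fun z => π (e z)) (𝓝 x) (𝓝 0) := by
      have h1 : Tendsto e (𝓝 x) (𝓝 0) := by
        have := (e.continuousAt hx).tendsto
        rwa [hex] at this
      exact (hπc.continuous.tendsto' 0 0 hπ0).comp h1
    obtain ⟨V, hV, hVo, hxV⟩ := eventually_nhds_iff.mp
      ((hM.and (hcont.eventually hgs)).and (e.open_source.mem_nhds hx))
    refine ⟨V, hVo, hxV, ?_, ?_⟩
    · intro z hz
      obtain ⟨⟨-, h2⟩, h3⟩ := hV z hz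
      have h4 : ContMDiffAt 𝓘(ℝ, Cmodel n) 𝓘(ℝ, ℝ) ∞ r (e z) := (hrs _ h2).contMDiffAt
      exact (h4.comp z (contMDiffAt_chart_real he h3)).contMDiffWithinAt
    · ext z
      constructor
      · rintro ⟨hzM, hzV⟩
        exact ⟨hzV, sub_neg.mpr ((hV z hzV).1.1.mp hzM)⟩
      · rintro ⟨hzV, hz⟩
        exact ⟨(hV z hzV).1.1.mpr (sub_neg.mp hz), hzV⟩
  · -- the direction `i ∂/∂z₀` is transversal to the boundary
    intro h0
    have hs : MDifferentiableAt 𝓘(ℝ, Cmodel n) 𝓘(ℝ, Cmodel n) e.symm (e x) :=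
      (contMDiffAt_chart_symm_real he (e.map_source hx)).mdifferentiableAt (by simp)
    have hed' : MDifferentiableAt 𝓘(ℝ, Cmodel n) 𝓘(ℝ, Cmodel n) e (e.symm (e x)) := by
      rw [e.left_inv hx]; exact hed
    have hc := mfderiv_comp (e x) hed' hs
    have hid : (e ∘ e.symm) =ᶠ[𝓝 (e x)] id := by
      filter_upwards [e.open_target.mem_nhds (e.map_source hx)] with v hv
      exact e.right_inv hv
    rw [hid.mfderiv_eq, mfderiv_id, e.left_inv hx] at hc
    have h1 := hform (mfderiv 𝓘(ℝ, Cmodel n) 𝓘(ℝ, Cmodel n) e.symm (e x)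
      (show TangentSpace 𝓘(ℝ, Cmodel n) (e x) from ((Complex.I, 0) : Cmodel n)))
    rw [h0] at h1
    have h2 := congrArg (fun T => (T ((Complex.I, 0) : Cmodel n) : Cmodel n)) hc
    have h3 : (mfderiv 𝓘(ℝ, Cmodel n) 𝓘(ℝ, Cmodel n) e x
      (mfderiv 𝓘(ℝ, Cmodel n) 𝓘(ℝ, Cmodel n) e.symm (e x)
      (show TangentSpace 𝓘(ℝ, Cmodel n) (e x) from ((Complex.I, 0) : Cmodel n))) : Cmodel n) =
        (Complex.I, 0) := h2.symm
    rw [h3] at h1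
    have h4 : (0 : ℝ) = -Complex.I.im := h1
    norm_num at h4

/-- In adapted coordinates, complex tangent vectors of the boundary have no `z₀` component. -/
theorem fst_mfderiv_eq_zero_of_mem_complexTangentSpace
    (he : e ∈ IsManifold.maximalAtlas 𝓘(ℂ, Cmodel n) ω X)
    (hx : x ∈ e.source) (hex : e x = 0) (hgs : ∀ᶠ v in 𝓝 0, ContDiffAt ℝ ∞ g v)
    (hg : AdaptedExpansion g ℓ A B)
    (hM : ∀ᶠ z in 𝓝 x, z ∈ M ↔ g ((e z).1.re, (e z).2) < (e z).1.im)
    {w : TangentSpace 𝓘(ℝ, Cmodel n) x} (hw : w ∈ complexTangentSpace M x) :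
    (mfderiv 𝓘(ℝ, Cmodel n) 𝓘(ℝ, Cmodel n) e x w : Cmodel n).1 = 0 := by
  obtain ⟨hdef, hform⟩ := isLocalDefiningFunction_graph he hx hex hgs hg hM
  have h1 := hw.1 _ hdef
  have h2 := hw.2 _ hdef
  rw [hform] at h1 h2
  have hed : MDifferentiableAt 𝓘(ℂ, Cmodel n) 𝓘(ℂ, Cmodel n) e x :=
    (contMDiffAt_of_mem_maximalAtlas he hx).mdifferentiableAt (by simp)
  rw [mfderiv_tangentMulI hed] at h2
  refine Complex.ext ?_ (neg_eq_zero.mp h1)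
  have h3 := neg_eq_zero.mp h2
  change (Complex.I * (mfderiv 𝓘(ℝ, Cmodel n) 𝓘(ℝ, Cmodel n) e x w : Cmodel n).1).im = 0 at h3
  rw [Complex.I_mul_im] at h3
  exact h3

variable [IsManifold 𝓘(ℂ, Cmodel n) ω X]

/-- At a strongly pseudoconvex point, the Hermitian form in adapted coordinates is positive
definite. -/
theorem hermPart_pos_of_isStronglyPseudoconvexAt
    (he : e ∈ IsManifold.maximalAtlas 𝓘(ℂ, Cmodel n) ω X)
    (hx : x ∈ e.source) (hex : e x = 0) (hg : AdaptedExpansion g ℓ A B)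
    (hM : ∀ᶠ z in 𝓝 x, z ∈ M ↔ g ((e z).1.re, (e z).2) < (e z).1.im)
    (hpsc : IsStronglyPseudoconvexAt (n := n) M x) (ζ : Fin n → ℂ) (hζ : ζ ≠ 0) :
    0 < hermPart B ζ := by
  obtain ⟨ρ, ⟨⟨V, hVo, hxV, hρ, hMV⟩, -⟩, hlevi⟩ := hpsc
  set c := chartAt (Cmodel n) x with hc
  have hcm : c ∈ IsManifold.maximalAtlas 𝓘(ℂ, Cmodel n) ω X :=
    IsManifold.chart_mem_maximalAtlas x
  have hxc : x ∈ c.source := mem_chart_source _ x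
  have hρx : ContMDiffAt 𝓘(ℝ, Cmodel n) 𝓘(ℝ, ℝ) ∞ ρ x := hρ.contMDiffAt (hVo.mem_nhds hxV)
  have hcoord : ∀ e' : OpenPartialHomeomorph X (Cmodel n),
      e' ∈ IsManifold.maximalAtlas 𝓘(ℂ, Cmodel n) ω X → x ∈ e'.source →
      ContDiffAt ℝ ∞ (ρ ∘ e'.symm) (e' x) := by
    intro e' he' hx'
    rw [← contMDiffAt_iff_contDiffAt]
    have h1 : ContMDiffAt 𝓘(ℝ, Cmodel n) 𝓘(ℝ, ℝ) ∞ ρ (e'.symm (e' x)) := by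
      rw [e'.left_inv hx']; exact hρx
    exact h1.comp _ (contMDiffAt_chart_symm_real he' (e'.map_source hx'))
  set R := ρ ∘ e.symm with hR
  set r := ρ ∘ c.symm with hr
  set Φ := c ∘ e.symm with hΦ
  have hes : e.symm (0 : Cmodel n) = x := by rw [← hex, e.left_inv hx]
  have hΦ0 : Φ 0 = c x := by simp only [hΦ, Function.comp, hes]
  have hRs : ContDiffAt ℝ ∞ R 0 := by
    have := hcoord e he hx
    rwa [hex] at this
  have hrs : ContDiffAt ℝ ∞ r (Φ 0) := by
    rw [hΦ0]
    exact hcoord c hcm hxc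
  have hΦs : ContDiffAt ℂ ∞ Φ 0 := by
    have := contDiffAt_transition he hcm hx hxc
    rw [hex] at this
    exact this.of_le le_top
  have hΨs : ContDiffAt ℂ ∞ (e ∘ c.symm) (Φ 0) := by
    rw [hΦ0]
    exact (contDiffAt_transition hcm he hxc hx).of_le le_top
  have hnear := eventually_coord_iff hx hex (c.open_source.mem_nhds hxc)
  have hRr : R =ᶠ[𝓝 0] r ∘ Φ := by
    filter_upwards [hnear] with v hv
    simp only [hR, hr, hΦ, Function.comp]
    rw [c.left_inv hv.2]
  have hid : (e ∘ c.symm) ∘ Φ =ᶠ[𝓝 0] id := by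
    filter_upwards [hnear] with v hv
    simp only [hΦ, Function.comp, id]
    rw [c.left_inv hv.2, e.right_inv hv.1]
  have hinj : ∀ w, fderiv ℂ Φ 0 w = 0 → w = 0 := by
    intro w hw
    have h1 := fderiv_comp (0 : Cmodel n) (hΨs.differentiableAt (by simp))
      (hΦs.differentiableAt (by simp))
    rw [hid.fderiv_eq, fderiv_id] at h1
    have h2 := congrArg (fun T => T w) h1
    simpa [hw] using h2
  have hdR : ∀ w, fderiv ℝ R 0 w = fderiv ℝ r (c x) (fderiv ℂ Φ 0 w) := by
    intro w
    have h1 : DifferentiableAt ℂ Φ 0 := hΦs.differentiableAt (by simp)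
    rw [hRr.fderiv_eq, fderiv_comp (0 : Cmodel n) (hrs.differentiableAt (by simp))
      (h1.restrictScalars ℝ), h1.fderiv_restrictScalars ℝ, hΦ0]
    rfl
  have hlR : ∀ w, leviForm R 0 w = leviForm r (c x) (fderiv ℂ Φ 0 w) := by
    intro w
    rw [← hΦ0, ← leviForm_comp hrs hΦs w, leviForm, leviForm,
      (hRr.fderiv (𝕜 := ℝ)).fderiv_eq (𝕜 := ℝ)]
  refine hg.hermPart_pos hRs ?_ ?_ ζ hζ
  · filter_upwards [eventually_coord_iff hx hex (hM.and (hVo.mem_nhds hxV))] with v hv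
    obtain ⟨hvt, hvM, hvV⟩ := hv
    rw [e.right_inv hvt] at hvM
    rw [← hvM]
    constructor
    · intro h
      have : e.symm v ∈ M ∩ V := ⟨h, hvV⟩
      rw [hMV] at this
      exact this.2
    · intro h
      have : e.symm v ∈ {z | z ∈ V ∧ ρ z < 0} := ⟨hvV, h⟩
      rw [← hMV] at this
      exact this.1
  · intro w hw h1 h2
    rw [hdR] at h1 h2
    rw [hlR]
    refine hlevi _ (fun h0 => hw (hinj w h0)) h1 ?_
    rwa [map_smul] at h2

end

end

/-! ### Orbits of free actions -/

section

variable {n d : ℕ} {X : Type*} [TopologicalSpace X] [ChartedSpace (Cmodel n) X]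
  {G : Type*} [TopologicalSpace G] [ChartedSpace (EuclideanSpace ℝ (Fin d)) G] [Group G]
  [MulAction G X]

theorem contMDiff_orbit
    (hs : ContMDiff ((𝓡 d).prod 𝓘(ℝ, Cmodel n)) 𝓘(ℝ, Cmodel n) ∞ (fun q : G × X => q.1 • q.2))
    (p : X) : ContMDiff (𝓡 d) 𝓘(ℝ, Cmodel n) ∞ (fun t : G => t • p) :=
  hs.comp (contMDiff_id.prodMk contMDiff_const)

theorem contMDiff_const_smul
    (hs : ContMDiff ((𝓡 d).prod 𝓘(ℝ, Cmodel n)) 𝓘(ℝ, Cmodel n) ∞ (fun q : G × X => q.1 • q.2))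
    (t : G) : ContMDiff 𝓘(ℝ, Cmodel n) 𝓘(ℝ, Cmodel n) ∞ (fun z : X => t • z) :=
  hs.comp (contMDiff_const.prodMk contMDiff_id)

/-- If a left invariant vector field is in the kernel of the differential of the orbit map at the
identity, it is in the kernel everywhere, by equivariance of the orbit map. -/
theorem mfderiv_orbit_mulInvariantVectorField [LieGroup (𝓡 d) ∞ G]
    (hs : ContMDiff ((𝓡 d).prod 𝓘(ℝ, Cmodel n)) 𝓘(ℝ, Cmodel n) ∞ (fun q : G × X => q.1 • q.2))
    (p : X) (v : GroupLieAlgebra (𝓡 d) G) (t : G)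
    (hv : mfderiv (𝓡 d) 𝓘(ℝ, Cmodel n) (fun t : G => t • p) 1 v = 0) :
    mfderiv (𝓡 d) 𝓘(ℝ, Cmodel n) (fun t : G => t • p) t (mulInvariantVectorField v t) = 0 := by
  have ho := contMDiff_orbit hs p
  have h1 : MDifferentiableAt (𝓡 d) 𝓘(ℝ, Cmodel n) (fun t : G => t • p) (t * 1) :=
    (ho _).mdifferentiableAt (by simp)
  have h2 : MDifferentiableAt (𝓡 d) (𝓡 d) (fun u : G => t * u) 1 :=
    ((contMDiff_mul_left (I := 𝓡 d) (n := ∞) (a := t)) 1).mdifferentiableAt (by simp)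
  have h3 := mfderiv_comp (1 : G) h1 h2
  have h4 : MDifferentiableAt 𝓘(ℝ, Cmodel n) 𝓘(ℝ, Cmodel n) (fun z : X => t • z) ((1 : G) • p) :=
    (contMDiff_const_smul hs t _).mdifferentiableAt (by simp)
  have h5 := mfderiv_comp (1 : G) h4 ((ho 1).mdifferentiableAt (by simp))
  have h6 : (fun t : G => t • p) ∘ (fun u : G => t * u) =
      (fun z : X => t • z) ∘ (fun t : G => t • p) := by
    funext u
    simp [mul_smul]
  rw [h6, h5] at h3
  have h7 := congrArg (fun T => T v) h3
  have hbase : ∀ s : G, s = t → ∀ w : EuclideanSpace ℝ (Fin d),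
      (mfderiv (𝓡 d) 𝓘(ℝ, Cmodel n) (fun t : G => t • p) s w : Cmodel n) =
        mfderiv (𝓡 d) 𝓘(ℝ, Cmodel n) (fun t : G => t • p) t w := by
    rintro _ rfl w
    rfl
  have h8 : mfderiv (𝓡 d) 𝓘(ℝ, Cmodel n) (fun t : G => t • p) t (mulInvariantVectorField v t) =
      mfderiv 𝓘(ℝ, Cmodel n) 𝓘(ℝ, Cmodel n) (fun z : X => t • z) ((1 : G) • p)
        (mfderiv (𝓡 d) 𝓘(ℝ, Cmodel n) (fun t : G => t • p) 1 v) :=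
    (hbase (t * 1) (mul_one t) _).symm.trans h7.symm
  rw [h8, hv]
  exact map_zero _

/-- The orbit map of a free action is an immersion at the identity: along the one-parameter
subgroup generated by a vector in the kernel of its differential it is constant. -/
theorem eq_zero_of_mfderiv_orbit_eq_zero [T2Space X] [LieGroup (𝓡 d) ∞ G]
    [IsManifold 𝓘(ℝ, Cmodel n) ∞ X]
    (hs : ContMDiff ((𝓡 d).prod 𝓘(ℝ, Cmodel n)) 𝓘(ℝ, Cmodel n) ∞ (fun q : G × X => q.1 • q.2))
    {p : X} (hfree : ∀ g : G, g • p = p → g = 1) (v : GroupLieAlgebra (𝓡 d) G)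
    (hv : mfderiv (𝓡 d) 𝓘(ℝ, Cmodel n) (fun t : G => t • p) 1 v = 0) : v = 0 := by
  have : LieGroup (𝓡 d) (minSmoothness ℝ 3) G := by
    rw [minSmoothness_of_isRCLikeNormedField]
    exact LieGroup.of_le (n := ∞) (by norm_cast)
  have : IsManifold (𝓡 d) 1 G := IsManifold.of_le (n := ∞) (by norm_cast)
  have hinv : ContMDiffAt (𝓡 d) (𝓡 d).tangent 1
      (fun g : G => (mulInvariantVectorField v g : TangentBundle (𝓡 d) G)) 1 := by
    have := contMDiffAt_mulInvariantVectorField v (g := (1 : G))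
    exact this.of_le (by rw [minSmoothness_of_isRCLikeNormedField]; norm_num)
  obtain ⟨γ, hγ0, hγ⟩ := exists_isMIntegralCurveAt_of_contMDiffAt_boundaryless (t₀ := 0) hinv
  have ho := contMDiff_orbit hs p
  have hγc : ContinuousAt γ 0 := hγ.self_of_nhds.continuousAt
  set c := chartAt (Cmodel n) p with hc
  have hpc : p ∈ c.source := mem_chart_source _ p
  have hsrc : ∀ᶠ s in 𝓝 (0 : ℝ), γ s • p ∈ c.source := by
    have h1 : ContinuousAt (fun s => γ s • p) 0 :=
      ContinuousAt.comp (g := fun t : G => t • p) (ho.continuous.continuousAt) hγc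
    refine h1.eventually_mem (c.open_source.mem_nhds ?_)
    simpa [hγ0] using hpc
  obtain ⟨ε, hε, hball⟩ := Metric.eventually_nhds_iff_ball.mp (hγ.and hsrc)
  have hder : ∀ s ∈ Metric.ball (0 : ℝ) ε,
      HasFDerivAt (fun s => c (γ s • p)) (0 : ℝ →L[ℝ] Cmodel n) s := by
    intro s hsb
    obtain ⟨h1, h2⟩ := hball s hsb
    have h3 : HasMFDerivAt 𝓘(ℝ, ℝ) 𝓘(ℝ, Cmodel n) (fun s => γ s • p) s
        (0 : ℝ →L[ℝ] Cmodel n) := by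
      have h4 := HasMFDerivAt.comp s
        ((ho (γ s)).mdifferentiableAt (by simp)).hasMFDerivAt h1
      refine h4.congr_mfderiv ?_
      refine ContinuousLinearMap.ext fun r => ?_
      have h5 := mfderiv_orbit_mulInvariantVectorField hs p v (γ s) hv
      have h6 : (mfderiv (𝓡 d) 𝓘(ℝ, Cmodel n) (fun t : G => t • p) (γ s))
          ((show ℝ from r) • mulInvariantVectorField v (γ s)) = 0 := by
        rw [map_smul, h5, smul_zero]
      exact h6
    have h7 : HasMFDerivAt 𝓘(ℝ, Cmodel n) 𝓘(ℝ, Cmodel n) c (γ s • p) _ :=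
      ((contMDiffAt_of_mem_maximalAtlas (n := ∞) (I := 𝓘(ℝ, Cmodel n))
        (IsManifold.chart_mem_maximalAtlas p) h2).mdifferentiableAt (by simp)).hasMFDerivAt
    have h8 := HasMFDerivAt.comp s h7 h3
    have h9 := h8.hasFDerivAt
    refine h9.congr_fderiv ?_
    refine ContinuousLinearMap.ext fun r => ?_
    exact ContinuousLinearMap.map_zero (mfderiv 𝓘(ℝ, Cmodel n) 𝓘(ℝ, Cmodel n) c (γ s • p))
  have hconst : ∀ s ∈ Metric.ball (0 : ℝ) ε, γ s = 1 := by
    intro s hsb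
    have h0 : (0 : ℝ) ∈ Metric.ball (0 : ℝ) ε := Metric.mem_ball_self hε
    have h1 : c (γ s • p) = c (γ 0 • p) :=
      (convex_ball (0 : ℝ) ε).is_const_of_fderivWithin_eq_zero (𝕜 := ℝ)
        (fun x hx => (hder x hx).differentiableAt.differentiableWithinAt)
        (fun x hx => by
          rw [fderivWithin_of_isOpen Metric.isOpen_ball hx]
          exact (hder x hx).fderiv) hsb h0
    have h2 := c.injOn (hball s hsb).2 (hball 0 h0).2 h1
    rw [hγ0, one_smul] at h2
    exact hfree _ h2
  have h1 : HasMFDerivAt 𝓘(ℝ, ℝ) (𝓡 d) γ 0 (0 : ℝ →L[ℝ] EuclideanSpace ℝ (Fin d)) := by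
    have h2 : HasMFDerivAt 𝓘(ℝ, ℝ) (𝓡 d) (fun _ : ℝ => (1 : G)) 0
        (0 : ℝ →L[ℝ] EuclideanSpace ℝ (Fin d)) := hasMFDerivAt_const _ _
    refine h2.congr_of_eventuallyEq ?_
    filter_upwards [Metric.ball_mem_nhds (0 : ℝ) hε] with s hsb using hconst s hsb
  have h2 := hasMFDerivAt_unique hγ.self_of_nhds h1
  have h3 := congrArg (fun T => T (1 : ℝ)) h2
  have h4 : (1 : ℝ) • (mulInvariantVectorField v (γ 0) : EuclideanSpace ℝ (Fin d)) = 0 := h3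
  rw [one_smul, hγ0] at h4
  have h5 : mfderiv (𝓡 d) (𝓡 d) (fun u : G => 1 * u) 1 v = 0 := h4
  have h6 : HasMFDerivAt (𝓡 d) (𝓡 d) (fun u : G => 1 * u) 1
      (ContinuousLinearMap.id ℝ (EuclideanSpace ℝ (Fin d))) :=
    (hasMFDerivAt_id (1 : G)).congr_of_eventuallyEq (Eventually.of_forall fun u => one_mul u)
  rw [h6.mfderiv] at h5
  exact h5

end

/-! ### The density of Haar measure in a chart -/

section

variable (d : ℕ) (G : Type*) [TopologicalSpace G] [ChartedSpace (EuclideanSpace ℝ (Fin d)) G]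
  [Group G]

/-- The preferred chart at the identity, translated so that the identity corresponds to `0`. -/
def identityChart : OpenPartialHomeomorph G (EuclideanSpace ℝ (Fin d)) :=
  (chartAt (EuclideanSpace ℝ (Fin d)) (1 : G)).transHomeomorph
    (Homeomorph.addRight (-(chartAt (EuclideanSpace ℝ (Fin d)) (1 : G) 1)))

theorem one_mem_identityChart_source : (1 : G) ∈ (identityChart d G).source :=
  mem_chart_source _ _

theorem identityChart_one : identityChart d G 1 = 0 :=
  add_neg_cancel (chartAt (EuclideanSpace ℝ (Fin d)) (1 : G) 1)

theorem identityChart_symm_zero : (identityChart d G).symm 0 = 1 := by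
  rw [← identityChart_one d G, (identityChart d G).left_inv (one_mem_identityChart_source d G)]

theorem zero_mem_identityChart_target :
    (0 : EuclideanSpace ℝ (Fin d)) ∈ (identityChart d G).target := by
  rw [← identityChart_one d G]
  exact (identityChart d G).map_source (one_mem_identityChart_source d G)

theorem contMDiffAt_identityChart [IsManifold (𝓡 d) ∞ G] {t : G}
    (ht : t ∈ (identityChart d G).source) :
    ContMDiffAt (𝓡 d) (𝓡 d) ∞ (identityChart d G) t := by
  have h1 : ContMDiffAt (𝓡 d) (𝓡 d) ∞ (chartAt (EuclideanSpace ℝ (Fin d)) (1 : G)) t :=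
    contMDiffAt_of_mem_maximalAtlas (IsManifold.chart_mem_maximalAtlas 1) ht
  exact h1.add contMDiffAt_const

theorem contMDiffAt_identityChart_symm [IsManifold (𝓡 d) ∞ G] {y : EuclideanSpace ℝ (Fin d)}
    (hy : y ∈ (identityChart d G).target) :
    ContMDiffAt (𝓡 d) (𝓡 d) ∞ (identityChart d G).symm y := by
  set c := chartAt (EuclideanSpace ℝ (Fin d)) (1 : G) with hc
  have hy' : y + -(-(c 1)) ∈ c.target := hy
  have h1 : ContMDiffAt (𝓡 d) (𝓡 d) ∞ c.symm (y + -(-(c 1))) :=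
    contMDiffAt_symm_of_mem_maximalAtlas (IsManifold.chart_mem_maximalAtlas 1) hy'
  have h2 : ContMDiffAt (𝓡 d) (𝓡 d) ∞ (fun y : EuclideanSpace ℝ (Fin d) => y + -(-(c 1))) y :=
    contMDiffAt_id.add contMDiffAt_const
  exact ContMDiffAt.comp (g := c.symm) y h1 h2

end

section

variable {d : ℕ} {G : Type*} [TopologicalSpace G] [ChartedSpace (EuclideanSpace ℝ (Fin d)) G]
  [Group G]

/-- The coordinate expression of the left translation by `t⁻¹`, in a chart of the group. -/
def coordTranslation (κ : OpenPartialHomeomorph G (EuclideanSpace ℝ (Fin d))) (t : G)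
    (w : EuclideanSpace ℝ (Fin d)) : EuclideanSpace ℝ (Fin d) :=
  κ (t⁻¹ * κ.symm w)

variable [LieGroup (𝓡 d) ∞ G]
  {κ : OpenPartialHomeomorph G (EuclideanSpace ℝ (Fin d))}

theorem contMDiffAt_coordTranslation (hκ : ∀ t ∈ κ.source, ContMDiffAt (𝓡 d) (𝓡 d) ∞ κ t)
    (hκ' : ∀ y ∈ κ.target, ContMDiffAt (𝓡 d) (𝓡 d) ∞ κ.symm y)
    {w : EuclideanSpace ℝ (Fin d)} {t : G} (hw : w ∈ κ.target)
    (ht : t⁻¹ * κ.symm w ∈ κ.source) {N : Type*} [TopologicalSpace N]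
    {F H : Type*} [NormedAddCommGroup F] [NormedSpace ℝ F] [TopologicalSpace H]
    {J : ModelWithCorners ℝ F H} [ChartedSpace H N] {a : N → G}
    {b : N → EuclideanSpace ℝ (Fin d)} {x : N} (hax : a x = t) (hbx : b x = w)
    (ha : ContMDiffAt J (𝓡 d) ∞ a x) (hb : ContMDiffAt J (𝓡 d) ∞ b x) :
    ContMDiffAt J (𝓡 d) ∞ (fun y => coordTranslation κ (a y) (b y)) x := by
  subst hax hbx
  have h1 : ContMDiffAt J (𝓡 d) ∞ (fun y => (a y)⁻¹ * κ.symm (b y)) x :=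
    (ha.inv).mul ((hκ' _ hw).comp x hb)
  exact ContMDiffAt.comp (g := κ) x (hκ _ ht) h1

theorem continuousAt_fderiv_coordTranslation
    (hκ : ∀ t ∈ κ.source, ContMDiffAt (𝓡 d) (𝓡 d) ∞ κ t)
    (hκ' : ∀ y ∈ κ.target, ContMDiffAt (𝓡 d) (𝓡 d) ∞ κ.symm y)
    {q : EuclideanSpace ℝ (Fin d) × G} (hw : q.1 ∈ κ.target)
    (ht : q.2⁻¹ * κ.symm q.1 ∈ κ.source) :
    ContinuousAt (fun q : EuclideanSpace ℝ (Fin d) × G =>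
      fderiv ℝ (coordTranslation κ q.2) q.1) q := by
  have : IsManifold (𝓡 d) 1 G := IsManifold.of_le (n := ∞) (by norm_cast)
  have h1 : ContMDiffAt (((𝓡 d).prod (𝓡 d)).prod (𝓡 d)) (𝓡 d) ∞
      (Function.uncurry fun (q : EuclideanSpace ℝ (Fin d) × G) v => coordTranslation κ q.2 v)
      (q, q.1) :=
    contMDiffAt_coordTranslation hκ hκ' hw ht (x := (q, q.1))
      (a := fun r : (EuclideanSpace ℝ (Fin d) × G) × EuclideanSpace ℝ (Fin d) => r.1.2)
      (b := fun r => r.2) rfl rfl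
      (contMDiffAt_snd.comp _ contMDiffAt_fst) contMDiffAt_snd
  have h2 := ContMDiffAt.mfderiv (m := 0) (n := ∞) (x₀ := q)
    (fun (q : EuclideanSpace ℝ (Fin d) × G) v => coordTranslation κ q.2 v) (fun q => q.1) h1
    contMDiffAt_fst (by norm_num)
  have h3 := inTangentCoordinates_model_space (I := 𝓡 d) (I' := 𝓡 d)
    (fun q : EuclideanSpace ℝ (Fin d) × G => q.1) (fun q => coordTranslation κ q.2 q.1)
    (fun q => fderiv ℝ (coordTranslation κ q.2) q.1) q
  have h4 : ContMDiffAt ((𝓡 d).prod (𝓡 d))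
      𝓘(ℝ, EuclideanSpace ℝ (Fin d) →L[ℝ] EuclideanSpace ℝ (Fin d)) 0
      (inTangentCoordinates (𝓡 d) (𝓡 d) (fun q : EuclideanSpace ℝ (Fin d) × G => q.1)
        (fun q => coordTranslation κ q.2 q.1)
        (fun q => fderiv ℝ (coordTranslation κ q.2) q.1) q) q := by
    simp only [mfderiv_eq_fderiv] at h2
    exact h2
  exact (h3 ▸ h4).continuousAt

/-- A right invariant measure on a Lie group has a continuous density with respect to Lebesgue
measure in a chart around the identity, and this density is positive at the identity. It is
found by averaging over `t` the integrals of `φ (t * θ x)` against a bump function of `x`, where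
`θ` is the inverse of the chart, and substituting `w` for the coordinates of `t * θ x`. -/
theorem exists_density_of_isMulRightInvariant [T2Space G] [SecondCountableTopology G]
    [MeasurableSpace G] [BorelSpace G]
    (hκ : ∀ t ∈ κ.source, ContMDiffAt (𝓡 d) (𝓡 d) ∞ κ t)
    (hκ' : ∀ y ∈ κ.target, ContMDiffAt (𝓡 d) (𝓡 d) ∞ κ.symm y)
    (h1 : 1 ∈ κ.source) (h0 : κ 1 = 0)
    (ν : Measure G) [ν.IsMulRightInvariant] [IsFiniteMeasureOnCompacts ν] [SFinite ν]
    [ν.IsOpenPosMeasure] :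
    ∃ δ > 0, Metric.ball 0 δ ⊆ κ.target ∧ ∃ D : EuclideanSpace ℝ (Fin d) → ℝ,
      ContinuousOn D (Metric.ball 0 δ) ∧ (∀ w, 0 ≤ D w) ∧ 0 < D 0 ∧
      ∀ φ : G → ENNReal, Measurable φ → ∫⁻ t in κ.symm '' Metric.ball 0 δ, φ t ∂ν =
        ∫⁻ w in Metric.ball 0 δ, ENNReal.ofReal (D w) * φ (κ.symm w) := by
  classical
  have : IsTopologicalGroup G := topologicalGroup_of_lieGroup (𝓡 d) ∞
  have ht0 : (0 : EuclideanSpace ℝ (Fin d)) ∈ κ.target := by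
    rw [← h0]; exact κ.map_source h1
  have hs0 : κ.symm 0 = 1 := by rw [← h0, κ.left_inv h1]
  obtain ⟨δ, hδ, hball⟩ := Metric.isOpen_iff.mp κ.open_target 0 ht0
  set b : Set (EuclideanSpace ℝ (Fin d)) := Metric.ball 0 δ with hb
  have hbo : IsOpen b := Metric.isOpen_ball
  have h0b : (0 : EuclideanSpace ℝ (Fin d)) ∈ b := Metric.mem_ball_self hδ
  set S : Set G := κ.symm '' b with hS
  have hSo : IsOpen S := κ.isOpen_image_symm_of_subset_target hbo hball
  have hSs : S ⊆ κ.source := by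
    rintro _ ⟨w, hw, rfl⟩
    exact κ.map_target (hball hw)
  have hSb : ∀ s ∈ S, κ s ∈ b := by
    rintro _ ⟨w, hw, rfl⟩
    rwa [κ.right_inv (hball hw)]
  have hθc : ContinuousOn κ.symm b := κ.continuousOn_symm.mono hball
  -- the bump function
  set ψ : EuclideanSpace ℝ (Fin d) → ℝ := fun x => max 0 (δ / 2 - ‖x‖) with hψ
  have hψc : Continuous ψ := by fun_prop
  have hψ0 : ∀ x, 0 ≤ ψ x := fun x => le_max_left _ _
  have hψs : ∀ x, ψ x ≠ 0 → x ∈ Metric.closedBall (0 : EuclideanSpace ℝ (Fin d)) (δ / 2) := by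
    intro x hx
    rw [mem_closedBall_zero_iff]
    by_contra! h
    exact hx (max_eq_left (by linarith))
  have hψ00 : 0 < ψ 0 := by
    simp only [hψ, norm_zero, sub_zero]
    exact lt_max_of_lt_right (by positivity)
  have hcbb : Metric.closedBall (0 : EuclideanSpace ℝ (Fin d)) (δ / 2) ⊆ b :=
    Metric.closedBall_subset_ball (by linarith)
  have hψcs : HasCompactSupport ψ :=
    HasCompactSupport.intro (isCompact_closedBall 0 (δ / 2)) fun x hx => by
      by_contra h
      exact hx (hψs x h)
  have hψi : Integrable ψ := hψc.integrable_of_hasCompactSupport hψcs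
  set C : ℝ := ∫ x, ψ x with hC
  have hCpos : 0 < C :=
    hψc.integral_pos_of_hasCompactSupport_nonneg_nonzero hψcs hψ0 hψ00.ne'
  have hClint : ∫⁻ x in b, ENNReal.ofReal (ψ x) = ENNReal.ofReal C := by
    rw [hC, ofReal_integral_eq_lintegral_ofReal hψi (Eventually.of_forall hψ0),
      ← lintegral_indicator hbo.measurableSet]
    refine lintegral_congr fun x => ?_
    by_cases hx : x ∈ b
    · rw [indicator_of_mem hx]
    · rw [indicator_of_notMem hx]
      have : ψ x = 0 := by
        by_contra h
        exact hx (hcbb (hψs x h))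
      rw [this, ENNReal.ofReal_zero]
  -- the integrand of the density: the bump function of the substitution times its Jacobian, where
  -- `t⁻¹ * θ w` lies in the domain of the chart
  set Ω : Set (EuclideanSpace ℝ (Fin d) × G) := {q | q.1 ∈ b ∧ q.2⁻¹ * κ.symm q.1 ∈ S} with hΩ
  have htrans : ContinuousOn (fun q : EuclideanSpace ℝ (Fin d) × G => q.2⁻¹ * κ.symm q.1)
      (b ×ˢ univ) := by
    refine ContinuousOn.mul continuous_snd.inv.continuousOn ?_
    exact hθc.comp continuous_fst.continuousOn fun q hq => hq.1
  have hΩo : IsOpen Ω := by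
    have h2 := htrans.isOpen_inter_preimage (hbo.prod isOpen_univ) hSo
    convert h2 using 1
    ext q
    simp [hΩ]
  set J₀ : EuclideanSpace ℝ (Fin d) × G → ℝ := fun q =>
    |(fderiv ℝ (coordTranslation κ q.2) q.1).det| * ψ (coordTranslation κ q.2 q.1) with hJ₀
  have hJ₀c : ContinuousOn J₀ Ω := by
    intro q hq
    refine ContinuousAt.continuousWithinAt ?_
    have h2 := continuousAt_fderiv_coordTranslation hκ hκ' (hball hq.1) (hSs hq.2)
    have h3 : ContinuousAt (fun q : EuclideanSpace ℝ (Fin d) × G =>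
        coordTranslation κ q.2 q.1) q :=
      (contMDiffAt_coordTranslation hκ hκ' (hball hq.1) (hSs hq.2)
        (J := (𝓡 d).prod (𝓡 d)) (a := fun r : EuclideanSpace ℝ (Fin d) × G => r.2)
        (b := fun r => r.1) rfl rfl contMDiffAt_snd contMDiffAt_fst).continuousAt
    exact ((ContinuousLinearMap.continuous_det.continuousAt.comp h2).abs).mul
      (hψc.continuousAt.comp h3)
  set J : EuclideanSpace ℝ (Fin d) × G → ℝ := Ω.piecewise J₀ (fun _ => 0) with hJ
  have hJm : Measurable J := hJ₀c.measurable_piecewise continuousOn_const hΩo.measurableSet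
  have hJ0 : ∀ q, 0 ≤ J q := by
    intro q
    by_cases hq : q ∈ Ω
    · rw [hJ, piecewise_eq_of_mem _ _ _ hq]
      exact mul_nonneg (abs_nonneg _) (hψ0 _)
    · rw [hJ, piecewise_eq_of_notMem _ _ _ hq]
  set Kc : Set G := κ.symm '' Metric.closedBall 0 (δ / 2) with hKc
  have hKcc : IsCompact Kc := (isCompact_closedBall 0 (δ / 2)).image_of_continuousOn
    (hθc.mono hcbb)
  have hJsupp : ∀ q, J q ≠ 0 → q ∈ Ω ∧ q.2⁻¹ * κ.symm q.1 ∈ Kc := by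
    intro q hq
    have hqΩ : q ∈ Ω := by
      by_contra h
      exact hq (by rw [hJ, piecewise_eq_of_notMem _ _ _ h])
    refine ⟨hqΩ, ?_⟩
    rw [hJ, piecewise_eq_of_mem _ _ _ hqΩ] at hq
    refine ⟨κ (q.2⁻¹ * κ.symm q.1), hψs _ (right_ne_zero_of_mul hq), ?_⟩
    exact κ.left_inv (hSs hqΩ.2)
  have hJc : ContinuousOn J (b ×ˢ univ) := by
    intro q hq
    by_cases hqΩ : q ∈ Ω
    · refine ContinuousAt.continuousWithinAt ?_
      refine (hJ₀c.continuousAt (hΩo.mem_nhds hqΩ)).congr ?_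
      filter_upwards [hΩo.mem_nhds hqΩ] with r hr
      rw [hJ, piecewise_eq_of_mem _ _ _ hr]
    · have hJq : J q = 0 := by rw [hJ, piecewise_eq_of_notMem _ _ _ hqΩ]
      have hKS : Kc ⊆ S := image_mono hcbb
      have h2 : q.2⁻¹ * κ.symm q.1 ∉ Kc := fun h => hqΩ ⟨hq.1, hKS h⟩
      have h3 : ∀ᶠ r in 𝓝[b ×ˢ univ] q, r.2⁻¹ * κ.symm r.1 ∈ Kcᶜ :=
        (htrans q hq).eventually_mem (hKcc.isClosed.isOpen_compl.mem_nhds h2)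
      refine ContinuousWithinAt.congr_of_eventuallyEq
        (continuousWithinAt_const (b := (0 : ℝ))) ?_ hJq
      filter_upwards [h3] with r hr
      by_contra h
      exact hr (hJsupp r h).2
  set I : EuclideanSpace ℝ (Fin d) → ℝ := fun w => ∫ t, J (w, t) ∂ν with hI
  have hcs : ∀ w ∈ b, ∀ t ∉ (fun s => κ.symm w * s⁻¹) '' Kc, J (w, t) = 0 := by
    intro w hw t ht
    by_contra h
    refine ht ⟨_, (hJsupp _ h).2, ?_⟩
    simp
  have hslice : ∀ w ∈ b, Continuous fun t => J (w, t) := by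
    intro w hw
    rw [← continuousOn_univ]
    exact hJc.comp (by fun_prop) fun t _ => ⟨hw, mem_univ _⟩
  have hslicecs : ∀ w ∈ b, HasCompactSupport fun t => J (w, t) := fun w hw =>
    HasCompactSupport.intro (hKcc.image (by fun_prop)) (hcs w hw)
  refine ⟨δ, hδ, hball, fun w => C⁻¹ * I w, ?_, ?_, ?_, ?_⟩
  · refine continuousOn_const.mul ?_
    rw [hbo.continuousOn_iff]
    intro w hw
    obtain ⟨r, hr, hrb⟩ : ∃ r > 0, Metric.closedBall w r ⊆ b :=
      Metric.nhds_basis_closedBall.mem_iff.mp (hbo.mem_nhds hw)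
    have hcomp : IsCompact ((fun q : G × G => q.1 * q.2⁻¹) ''
        ((κ.symm '' Metric.closedBall w r) ×ˢ Kc)) :=
      (((isCompact_closedBall w r).image_of_continuousOn (hθc.mono hrb)).prod hKcc).image
        (by fun_prop)
    have hcont : ContinuousOn I (Metric.closedBall w r) := by
      refine continuousOn_integral_of_compact_support hcomp ?_ ?_
      · exact hJc.mono (prod_mono hrb le_rfl)
      · intro v t hv ht
        by_contra h
        refine ht ⟨(κ.symm v, t⁻¹ * κ.symm v), ⟨mem_image_of_mem _ hv, (hJsupp _ h).2⟩, ?_⟩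
        simp
    exact hcont.continuousAt (Metric.closedBall_mem_nhds w hr)
  · exact fun w => mul_nonneg (inv_nonneg.mpr hCpos.le) (integral_nonneg fun t => hJ0 _)
  · refine mul_pos (inv_pos.mpr hCpos) ?_
    refine (hslice 0 h0b).integral_pos_of_hasCompactSupport_nonneg_nonzero (x := 1)
      (hslicecs 0 h0b) (fun t => hJ0 _) ?_
    have hmem : ((0, 1) : EuclideanSpace ℝ (Fin d) × G) ∈ Ω := by
      refine ⟨h0b, 0, h0b, ?_⟩
      simp
    rw [hJ, piecewise_eq_of_mem _ _ _ hmem]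
    have hid : coordTranslation κ (1 : G) =ᶠ[𝓝 0] id := by
      filter_upwards [hbo.mem_nhds h0b] with v hv
      simp [coordTranslation, κ.right_inv (hball hv)]
    simp only [hJ₀]
    rw [hid.fderiv_eq, fderiv_id, hid.eq_of_nhds]
    have hdet : (ContinuousLinearMap.id ℝ (EuclideanSpace ℝ (Fin d))).det = 1 := LinearMap.det_id
    simpa [hdet] using hψ00.ne'
  · intro φ hφ
    -- a measurable extension of the inverse of the chart
    set θ : EuclideanSpace ℝ (Fin d) → G := b.piecewise κ.symm (fun _ => 1) with hθ
    have hθm : Measurable θ :=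
      hθc.measurable_piecewise continuousOn_const hbo.measurableSet
    have hθb : ∀ w ∈ b, θ w = κ.symm w := fun w hw => piecewise_eq_of_mem _ _ _ hw
    set φ₀ : G → ENNReal := S.indicator φ with hφ₀
    have hφ₀m : Measurable φ₀ := hφ.indicator hSo.measurableSet
    have hinner : ∀ t : G, ∫⁻ x in b, ENNReal.ofReal (ψ x) * φ₀ (t * θ x) =
        ∫⁻ w in b, ENNReal.ofReal (J (w, t)) * φ (θ w) := by
      intro t
      set W : Set (EuclideanSpace ℝ (Fin d)) := {w | (w, t) ∈ Ω} with hW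
      have hWo : IsOpen W := hΩo.preimage (by fun_prop)
      have hWb : W ⊆ b := fun w hw => hw.1
      have hmem : ∀ w ∈ W, coordTranslation κ t w ∈ b := fun w hw => hSb _ hw.2
      have hback : ∀ w ∈ W, t * κ.symm (coordTranslation κ t w) = κ.symm w := by
        intro w hw
        rw [coordTranslation, κ.left_inv (hSs hw.2), mul_inv_cancel_left]
      have himage : ∀ x ∈ b, t * κ.symm x ∈ S → x ∈ coordTranslation κ t '' W := by
        intro x hx hxS
        have h2 : κ.symm (κ (t * κ.symm x)) = t * κ.symm x := κ.left_inv (hSs hxS)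
        refine ⟨κ (t * κ.symm x), ⟨hSb _ hxS, ?_⟩, ?_⟩
        · rw [h2, inv_mul_cancel_left]
          exact ⟨x, hx, rfl⟩
        · rw [coordTranslation, h2, inv_mul_cancel_left, κ.right_inv (hball hx)]
      have hinj : InjOn (coordTranslation κ t) W := by
        intro w hw w' hw' h
        have h2 := hback w hw
        rw [h, hback w' hw'] at h2
        exact (κ.symm.injOn (hball hw'.1) (hball hw.1) h2).symm
      have hdiff : ∀ w ∈ W, HasFDerivWithinAt (coordTranslation κ t)
          (fderiv ℝ (coordTranslation κ t) w) W w := by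
        intro w hw
        have h2 : ContMDiffAt (𝓡 d) (𝓡 d) ∞ (coordTranslation κ t) w :=
          contMDiffAt_coordTranslation hκ hκ' (hball hw.1) (hSs hw.2)
            (J := 𝓡 d) (a := fun _ => t) (b := fun r => r) rfl rfl contMDiffAt_const contMDiffAt_id
        exact (h2.contDiffAt.differentiableAt (by simp)).hasFDerivAt.hasFDerivWithinAt
      have hop : IsOpen (b ∩ (fun x => t * κ.symm x) ⁻¹' S) :=
        (continuousOn_const.mul hθc).isOpen_inter_preimage hbo hSo
      have hAeq : coordTranslation κ t '' W = b ∩ (fun x => t * κ.symm x) ⁻¹' S := by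
        ext x
        constructor
        · rintro ⟨w, hw, rfl⟩
          refine ⟨hmem w hw, ?_⟩
          rw [mem_preimage, hback w hw]
          exact ⟨w, hw.1, rfl⟩
        · rintro ⟨hx, hxS⟩
          exact himage x hx hxS
      -- the substitution `x = κ (t⁻¹ * θ w)` for fixed `t`
      have hcv := lintegral_image_eq_lintegral_abs_det_fderiv_mul volume hWo.measurableSet
        hdiff hinj (fun x => ENNReal.ofReal (ψ x) * φ₀ (t * θ x))
      have hl : ∫⁻ x in b, ENNReal.ofReal (ψ x) * φ₀ (t * θ x) =
          ∫⁻ x in coordTranslation κ t '' W, ENNReal.ofReal (ψ x) * φ₀ (t * θ x) := by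
        rw [hAeq, ← lintegral_indicator hbo.measurableSet, ← lintegral_indicator hop.measurableSet]
        refine lintegral_congr fun x => ?_
        by_cases hx : x ∈ b
        · by_cases hxS : t * κ.symm x ∈ S
          · rw [indicator_of_mem hx, indicator_of_mem (show x ∈ b ∩ _ from ⟨hx, hxS⟩)]
          · rw [indicator_of_mem hx, indicator_of_notMem (fun h => hxS h.2), hθb x hx, hφ₀,
              indicator_of_notMem hxS, mul_zero]
        · rw [indicator_of_notMem hx, indicator_of_notMem (fun h => hx h.1)]
      have hr : ∫⁻ w in b, ENNReal.ofReal (J (w, t)) * φ (θ w) =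
          ∫⁻ w in W, ENNReal.ofReal (J (w, t)) * φ (θ w) := by
        rw [← lintegral_indicator hbo.measurableSet, ← lintegral_indicator hWo.measurableSet]
        refine lintegral_congr fun x => ?_
        by_cases hx : x ∈ W
        · rw [indicator_of_mem (hWb hx), indicator_of_mem hx]
        · rw [indicator_of_notMem hx]
          have : J (x, t) = 0 := piecewise_eq_of_notMem _ _ _ hx
          by_cases hxb : x ∈ b
          · rw [indicator_of_mem hxb, this, ENNReal.ofReal_zero, zero_mul]
          · rw [indicator_of_notMem hxb]
      rw [hl, hcv, hr]
      refine setLIntegral_congr_fun hWo.measurableSet fun w hw => ?_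
      have hJw : J (w, t) = J₀ (w, t) := piecewise_eq_of_mem _ _ _ hw
      simp only [hJw, hJ₀]
      rw [hθb _ (hmem w hw), hback w hw, hθb w hw.1, hφ₀,
        indicator_of_mem (show κ.symm w ∈ S from ⟨w, hw.1, rfl⟩), ← mul_assoc,
        ENNReal.ofReal_mul (abs_nonneg _)]
    have hmeas1 : Measurable (Function.uncurry fun (x : EuclideanSpace ℝ (Fin d)) (t : G) =>
        ENNReal.ofReal (ψ x) * φ₀ (t * θ x)) := by
      refine ((hψc.measurable.comp measurable_fst).ennreal_ofReal).mul ?_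
      exact hφ₀m.comp (measurable_snd.mul (hθm.comp measurable_fst))
    have hmeas2 : Measurable (Function.uncurry fun (t : G) (w : EuclideanSpace ℝ (Fin d)) =>
        ENNReal.ofReal (J (w, t)) * φ (θ w)) := by
      refine ((hJm.comp measurable_swap).ennreal_ofReal).mul ?_
      exact hφ.comp (hθm.comp measurable_snd)
    have hkey : ENNReal.ofReal C * ∫⁻ t in S, φ t ∂ν =
        ∫⁻ w in b, ENNReal.ofReal (I w) * φ (κ.symm w) := by
      calc ENNReal.ofReal C * ∫⁻ t in S, φ t ∂ν
          = ∫⁻ x in b, ENNReal.ofReal (ψ x) * ∫⁻ t, φ₀ t ∂ν := by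
            rw [lintegral_mul_const _ hψc.measurable.ennreal_ofReal, hClint, hφ₀,
              lintegral_indicator hSo.measurableSet]
        _ = ∫⁻ x in b, ∫⁻ t, ENNReal.ofReal (ψ x) * φ₀ (t * θ x) ∂ν := by
            refine lintegral_congr fun x => ?_
            have h2 : Measurable fun t : G => φ₀ (t * θ x) :=
              hφ₀m.comp (measurable_mul_const (θ x))
            rw [lintegral_const_mul _ h2, lintegral_mul_right_eq_self φ₀ (θ x)]
        _ = ∫⁻ t, (∫⁻ x in b, ENNReal.ofReal (ψ x) * φ₀ (t * θ x)) ∂ν :=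
            lintegral_lintegral_swap hmeas1.aemeasurable
        _ = ∫⁻ t, (∫⁻ w in b, ENNReal.ofReal (J (w, t)) * φ (θ w)) ∂ν := lintegral_congr hinner
        _ = ∫⁻ w in b, ∫⁻ t, ENNReal.ofReal (J (w, t)) * φ (θ w) ∂ν :=
            lintegral_lintegral_swap hmeas2.aemeasurable
        _ = ∫⁻ w in b, ENNReal.ofReal (I w) * φ (κ.symm w) := by
            refine setLIntegral_congr_fun hbo.measurableSet fun w hw => ?_
            have h2 : Measurable fun t : G => ENNReal.ofReal (J (w, t)) :=
              (hJm.comp (by fun_prop : Measurable fun t : G => (w, t))).ennreal_ofReal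
            have h3 : ENNReal.ofReal (I w) = ∫⁻ t, ENNReal.ofReal (J (w, t)) ∂ν :=
              ofReal_integral_eq_lintegral_ofReal
                ((hslice w hw).integrable_of_hasCompactSupport (hslicecs w hw))
                (Eventually.of_forall fun t => hJ0 _)
            rw [h3, ← hθb w hw]
            exact lintegral_mul_const _ h2
    have hC0 : ENNReal.ofReal C ≠ 0 := by simpa using hCpos
    calc ∫⁻ t in S, φ t ∂ν
        = (ENNReal.ofReal C)⁻¹ * (ENNReal.ofReal C * ∫⁻ t in S, φ t ∂ν) := by
          rw [← mul_assoc, ENNReal.inv_mul_cancel hC0 ENNReal.ofReal_ne_top, one_mul]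
      _ = ∫⁻ w in b, (ENNReal.ofReal C)⁻¹ * (ENNReal.ofReal (I w) * φ (κ.symm w)) := by
          rw [hkey, lintegral_const_mul' _ _ (ENNReal.inv_ne_top.mpr hC0)]
      _ = ∫⁻ w in b, ENNReal.ofReal (C⁻¹ * I w) * φ (κ.symm w) := by
          refine lintegral_congr fun w => ?_
          rw [ENNReal.ofReal_mul (inv_nonneg.mpr hCpos.le), ENNReal.ofReal_inv_of_pos hCpos,
            mul_assoc]

end

section

variable {d : ℕ} {G : Type*} [TopologicalSpace G]
  {κ : OpenPartialHomeomorph G (EuclideanSpace ℝ (Fin d))} [MeasurableSpace G] [BorelSpace G]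
  {ν : Measure G} {δ : ℝ}
  {D : EuclideanSpace ℝ (Fin d) → ℝ}

theorem aemeasurable_chart_symm (hball : Metric.ball 0 δ ⊆ κ.target) {δ' : ℝ} (hδ' : δ' ≤ δ) :
    AEMeasurable κ.symm (volume.restrict (Metric.ball 0 δ')) :=
  (κ.continuousOn_symm.mono ((Metric.ball_subset_ball hδ').trans hball)).aemeasurable
    Metric.isOpen_ball.measurableSet

theorem aemeasurable_ofReal_density (hD : ContinuousOn D (Metric.ball 0 δ)) {δ' : ℝ}
    (hδ' : δ' ≤ δ) :
    AEMeasurable (fun w => ENNReal.ofReal (D w)) (volume.restrict (Metric.ball 0 δ')) :=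
  ((hD.mono (Metric.ball_subset_ball hδ')).aemeasurable
    Metric.isOpen_ball.measurableSet).ennreal_ofReal

/-- In a chart, a right invariant measure is the image of a measure with continuous density. -/
theorem restrict_eq_map_withDensity (hball : Metric.ball 0 δ ⊆ κ.target)
    (hD : ContinuousOn D (Metric.ball 0 δ))
    (hν : ∀ φ : G → ENNReal, Measurable φ → ∫⁻ t in κ.symm '' Metric.ball 0 δ, φ t ∂ν =
        ∫⁻ w in Metric.ball 0 δ, ENNReal.ofReal (D w) * φ (κ.symm w))
    {δ' : ℝ} (hδ' : δ' ≤ δ) :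
    ν.restrict (κ.symm '' Metric.ball 0 δ') =
      ((volume.restrict (Metric.ball 0 δ')).withDensity
        fun w => ENNReal.ofReal (D w)).map κ.symm := by
  have hsub : Metric.ball (0 : EuclideanSpace ℝ (Fin d)) δ' ⊆ Metric.ball 0 δ :=
    Metric.ball_subset_ball hδ'
  have hθ := aemeasurable_chart_symm hball hδ'
  have hSo : MeasurableSet (κ.symm '' Metric.ball 0 δ') :=
    (κ.isOpen_image_symm_of_subset_target Metric.isOpen_ball (hsub.trans hball)).measurableSet
  refine Measure.ext_of_lintegral _ fun φ hφ => ?_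
  have h1 := hν _ (hφ.indicator hSo)
  rw [lintegral_map' hφ.aemeasurable (hθ.mono_ac (withDensity_absolutelyContinuous _ _)),
    lintegral_withDensity_eq_lintegral_mul₀ (aemeasurable_ofReal_density hD hδ')
      (show AEMeasurable (fun w => φ (κ.symm w)) _ from hφ.comp_aemeasurable hθ)]
  rw [lintegral_indicator hSo, Measure.restrict_restrict hSo,
    inter_eq_left.mpr (image_mono hsub)] at h1
  rw [h1, ← lintegral_indicator Metric.isOpen_ball.measurableSet,
    ← lintegral_indicator Metric.isOpen_ball.measurableSet]
  refine lintegral_congr fun w => ?_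
  by_cases hw : w ∈ Metric.ball (0 : EuclideanSpace ℝ (Fin d)) δ'
  · rw [indicator_of_mem hw, indicator_of_mem (hsub hw),
      indicator_of_mem (mem_image_of_mem _ hw)]
    rfl
  · rw [indicator_of_notMem hw]
    by_cases hw' : w ∈ Metric.ball (0 : EuclideanSpace ℝ (Fin d)) δ
    · rw [indicator_of_mem hw', indicator_of_notMem, mul_zero]
      rintro ⟨v, hv, hvw⟩
      rw [κ.symm.injOn (hball (hsub hv)) (hball hw') hvw] at hv
      exact hw hv
    · rw [indicator_of_notMem hw']

theorem setIntegral_chart_image (hball : Metric.ball 0 δ ⊆ κ.target)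
    (hD : ContinuousOn D (Metric.ball 0 δ)) (hD0 : ∀ w, 0 ≤ D w)
    (hν : ∀ φ : G → ENNReal, Measurable φ → ∫⁻ t in κ.symm '' Metric.ball 0 δ, φ t ∂ν =
        ∫⁻ w in Metric.ball 0 δ, ENNReal.ofReal (D w) * φ (κ.symm w))
    {δ' : ℝ} (hδ' : δ' ≤ δ) {F : G → ℂ} (hF : Measurable F) :
    ∫ t in κ.symm '' Metric.ball 0 δ', F t ∂ν =
      ∫ w in Metric.ball 0 δ', (D w : ℂ) * F (κ.symm w) := by
  have hθ := aemeasurable_chart_symm hball hδ'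
  rw [restrict_eq_map_withDensity hball hD hν hδ',
    integral_map (hθ.mono_ac (withDensity_absolutelyContinuous _ _)) hF.aestronglyMeasurable,
    integral_withDensity_eq_integral_toReal_smul₀ (aemeasurable_ofReal_density hD hδ')
      (Eventually.of_forall fun w => ENNReal.ofReal_lt_top)]
  refine integral_congr_ae (Eventually.of_forall fun w => ?_)
  simp only [ENNReal.toReal_ofReal (hD0 w), Complex.real_smul]

theorem integrableOn_chart_image_iff (hball : Metric.ball 0 δ ⊆ κ.target)
    (hD : ContinuousOn D (Metric.ball 0 δ)) (hD0 : ∀ w, 0 ≤ D w)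
    (hν : ∀ φ : G → ENNReal, Measurable φ → ∫⁻ t in κ.symm '' Metric.ball 0 δ, φ t ∂ν =
        ∫⁻ w in Metric.ball 0 δ, ENNReal.ofReal (D w) * φ (κ.symm w))
    {δ' : ℝ} (hδ' : δ' ≤ δ) {F : G → ℂ} (hF : Measurable F) :
    IntegrableOn F (κ.symm '' Metric.ball 0 δ') ν ↔
      IntegrableOn (fun w => (D w : ℂ) * F (κ.symm w)) (Metric.ball 0 δ') := by
  have hθ := aemeasurable_chart_symm hball hδ'
  rw [IntegrableOn, restrict_eq_map_withDensity hball hD hν hδ',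
    integrable_map_measure hF.aestronglyMeasurable
      (hθ.mono_ac (withDensity_absolutelyContinuous _ _)),
    integrable_withDensity_iff_integrable_smul₀' (aemeasurable_ofReal_density hD hδ')
      (Eventually.of_forall fun w => ENNReal.ofReal_lt_top)]
  simp only [ENNReal.toReal_ofReal (hD0 _), Complex.real_smul, Function.comp, IntegrableOn]

end

/-! ### Square integrability -/

/-- The Levi polynomial in adapted coordinates, normalized by the factor `-i`. -/
def leviPoly {n : ℕ} (A : Matrix (Fin n) (Fin n) ℂ) (v : Cmodel n) : ℂ :=
  -Complex.I * (v.1 - 2 * Complex.I * quadPart A v.2)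

section

variable {n : ℕ} (A : Matrix (Fin n) (Fin n) ℂ)

theorem contDiff_leviPoly : ContDiff ℂ ω (leviPoly A) := by
  unfold leviPoly quadPart
  fun_prop

theorem norm_leviPoly (v : Cmodel n) :
    ‖leviPoly A v‖ = ‖v.1 - 2 * Complex.I * quadPart A v.2‖ := by
  rw [leviPoly, norm_mul, norm_neg, Complex.norm_I, one_mul]

/-- A bound that does not depend on the location `a` of the singularity. -/
theorem setLIntegral_norm_sub_rpow_le {α : ℝ} (hα0 : 0 ≤ α) (a : ℂ) (R : ℝ) :
    ∫⁻ w in Metric.ball (0 : ℂ) R, ENNReal.ofReal (‖w - a‖ ^ (-α)) ≤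
      (∫⁻ w in Metric.ball (0 : ℂ) 1, ENNReal.ofReal (‖w‖ ^ (-α))) +
        volume (Metric.ball (0 : ℂ) R) := by
  set h : ℂ → ENNReal := (Metric.ball (0 : ℂ) 1).indicator
    fun w => ENNReal.ofReal (‖w‖ ^ (-α)) with hh
  have hm : Measurable h := by
    refine Measurable.indicator ?_ Metric.isOpen_ball.measurableSet
    exact (measurable_norm.pow_const _).ennreal_ofReal
  have hle : ∀ w : ℂ, ENNReal.ofReal (‖w - a‖ ^ (-α)) ≤ h (w - a) + 1 := by
    intro w
    by_cases hw : w - a ∈ Metric.ball (0 : ℂ) 1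
    · rw [hh, indicator_of_mem hw]
      exact le_self_add
    · refine le_add_left ?_
      rw [← ENNReal.ofReal_one]
      refine ENNReal.ofReal_le_ofReal ?_
      rw [mem_ball_zero_iff, not_lt] at hw
      exact Real.rpow_le_one_of_one_le_of_nonpos hw (by linarith)
  calc ∫⁻ w in Metric.ball (0 : ℂ) R, ENNReal.ofReal (‖w - a‖ ^ (-α))
      ≤ ∫⁻ w in Metric.ball (0 : ℂ) R, (h (w - a) + 1) := lintegral_mono fun w => hle w
    _ = (∫⁻ w in Metric.ball (0 : ℂ) R, h (w - a)) + volume (Metric.ball (0 : ℂ) R) := by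
        rw [lintegral_add_right _ measurable_const]
        simp
    _ ≤ (∫⁻ w, h (w - a)) + volume (Metric.ball (0 : ℂ) R) := by
        exact add_le_add (setLIntegral_le_lintegral _ _) le_rfl
    _ = _ := by
        rw [lintegral_sub_right_eq_self h a, hh,
          lintegral_indicator Metric.isOpen_ball.measurableSet]

/-- Negative powers of the Levi polynomial are locally integrable: for fixed `z` it is a translate
of the coordinate `z₀`. -/
theorem setLIntegral_norm_leviPoly_rpow_lt_top {α : ℝ} (hα0 : 0 ≤ α) (hα : α < 2) (R : ℝ) :
    ∫⁻ v in Metric.ball (0 : Cmodel n) R, ENNReal.ofReal (‖leviPoly A v‖ ^ (-α)) < ⊤ := by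
  have hfin : ∫⁻ w in Metric.ball (0 : ℂ) 1, ENNReal.ofReal (‖w‖ ^ (-α)) < ⊤ := by
    have h1 : IntegrableOn (fun w : ℂ => ‖w‖ ^ (-α)) (Metric.ball 0 1) := by
      refine integrableOn_ball_of_norm_le_rpow (C := 1) (α := α) ?_ ?_ ?_ ?_
      · rw [Complex.finrank_real_complex]; norm_num
      · rw [Complex.finrank_real_complex]; exact_mod_cast hα
      · refine Eventually.of_forall fun w => ?_
        rw [Real.norm_of_nonneg (by positivity), one_mul]
      · exact (measurable_norm.pow_const _).aestronglyMeasurable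
    exact (hasFiniteIntegral_iff_ofReal (Eventually.of_forall fun w => by positivity)).mp h1.2
  have hmeas : Measurable fun v : Cmodel n => ENNReal.ofReal (‖leviPoly A v‖ ^ (-α)) :=
    (((contDiff_leviPoly A).continuous.measurable.norm).pow_const _).ennreal_ofReal
  have hball : Metric.ball (0 : Cmodel n) R =
      Metric.ball (0 : ℂ) R ×ˢ Metric.ball (0 : Fin n → ℂ) R := (ball_prod_same _ _ _).symm
  rw [hball, Measure.volume_eq_prod, ← Measure.prod_restrict,
    lintegral_prod_symm _ hmeas.aemeasurable]
  simp only [norm_leviPoly]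
  calc ∫⁻ z in Metric.ball (0 : Fin n → ℂ) R, ∫⁻ w in Metric.ball (0 : ℂ) R,
        ENNReal.ofReal (‖w - 2 * Complex.I * quadPart A z‖ ^ (-α))
      ≤ ∫⁻ z in Metric.ball (0 : Fin n → ℂ) R,
          ((∫⁻ w in Metric.ball (0 : ℂ) 1, ENNReal.ofReal (‖w‖ ^ (-α))) +
            volume (Metric.ball (0 : ℂ) R)) :=
        lintegral_mono fun z => setLIntegral_norm_sub_rpow_le hα0 _ R
    _ < ⊤ := by
        rw [setLIntegral_const]
        exact ENNReal.mul_lt_top (ENNReal.add_lt_top.mpr ⟨hfin, measure_ball_lt_top⟩)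
          measure_ball_lt_top

end

/-- Local integrability is invariant under local diffeomorphisms. -/
theorem exists_setLIntegral_comp_lt_top {E : Type*} [NormedAddCommGroup E] [NormedSpace ℝ E]
    [FiniteDimensional ℝ E] [MeasurableSpace E] [BorelSpace E] (μ : Measure E) [μ.IsAddHaarMeasure]
    {Φ : E → E} {a : E} (hΦ : ContDiffAt ℝ ∞ Φ a) (hdet : (fderiv ℝ Φ a).det ≠ 0)
    {s : Set E} (hs : s ∈ 𝓝 a) (hinj : InjOn Φ s) {F : E → ENNReal} {t : Set E}
    (ht : t ∈ 𝓝 (Φ a)) (hF : ∫⁻ v in t, F v ∂μ < ⊤) :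
    ∃ ε > 0, ∫⁻ v in Metric.ball a ε, F (Φ v) ∂μ < ⊤ := by
  obtain ⟨c, hc0, hc⟩ := exists_between (abs_pos.mpr hdet)
  have hd1 : ∀ᶠ v in 𝓝 a, DifferentiableAt ℝ Φ v := by
    filter_upwards [(hΦ.of_le (m := 1) (by norm_cast)).eventually (by simp)] with v hv
    exact hv.differentiableAt (by simp)
  have hfc : ContinuousAt (fun v => |(fderiv ℝ Φ v).det|) a := by
    have h1 : ContinuousAt (fderiv ℝ Φ) a :=
      (hΦ.fderiv_right (m := 0) (by simp)).continuousAt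
    exact (ContinuousLinearMap.continuous_det.continuousAt.comp h1).abs
  have hev := (hd1.and (hfc.eventually (lt_mem_nhds hc))).and
    (Filter.Eventually.and hs (hΦ.continuousAt.eventually_mem ht))
  obtain ⟨ε, hε, hball⟩ := Metric.eventually_nhds_iff_ball.mp hev
  refine ⟨ε, hε, ?_⟩
  have hcv := lintegral_image_eq_lintegral_abs_det_fderiv_mul μ
    (measurableSet_ball (x := a) (ε := ε))
    (fun v hv => (hball v hv).1.1.hasFDerivAt.hasFDerivWithinAt)
    (hinj.mono fun v hv => (hball v hv).2.1) F
  have h1 : ENNReal.ofReal c * ∫⁻ v in Metric.ball a ε, F (Φ v) ∂μ < ⊤ := by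
    rw [← lintegral_const_mul' _ _ ENNReal.ofReal_ne_top]
    calc ∫⁻ v in Metric.ball a ε, ENNReal.ofReal c * F (Φ v) ∂μ
        ≤ ∫⁻ v in Metric.ball a ε, ENNReal.ofReal |(fderiv ℝ Φ v).det| * F (Φ v) ∂μ := by
          refine setLIntegral_mono' Metric.isOpen_ball.measurableSet fun v hv => ?_
          gcongr
          exact (hball v hv).1.2.le
      _ = ∫⁻ v in Φ '' Metric.ball a ε, F v ∂μ := hcv.symm
      _ ≤ ∫⁻ v in t, F v ∂μ := by
          refine lintegral_mono_set ?_
          rintro _ ⟨v, hv, rfl⟩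
          exact (hball v hv).2.2
      _ < ⊤ := hF
  exact (ENNReal.mul_lt_top_iff.mp h1).elim (fun h => h.2)
    (fun h => h.elim (fun h => absurd h (by simpa using hc0))
      fun h => by rw [h]; exact ENNReal.zero_lt_top)

section

variable {n : ℕ} {X : Type*} [TopologicalSpace X] [ChartedSpace (Cmodel n) X]
  [IsManifold 𝓘(ℂ, Cmodel n) ω X] [MeasurableSpace X] [BorelSpace X]

/-- Functions that are integrable near the origin in some holomorphic chart are locally integrable
for every measure with smooth density. -/
theorem exists_setLIntegral_chart_lt_top {μ : Measure X} (hμ : IsSmoothMeasure (n := n) μ) {p : X}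
    {e : OpenPartialHomeomorph X (Cmodel n)}
    (he : e ∈ IsManifold.maximalAtlas 𝓘(ℂ, Cmodel n) ω X) (hp : p ∈ e.source)
    {F : Cmodel n → ENNReal} (hFm : Measurable F) {t : Set (Cmodel n)} (ht : t ∈ 𝓝 (e p))
    (hF : ∫⁻ v in t, F v < ⊤) : ∃ U ∈ 𝓝 p, ∫⁻ z in U, F (e z) ∂μ < ⊤ := by
  obtain ⟨w, hw, -, hmap⟩ := hμ p
  set c := chartAt (Cmodel n) p with hc
  have hcm : c ∈ IsManifold.maximalAtlas 𝓘(ℂ, Cmodel n) ω X := IsManifold.chart_mem_maximalAtlas p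
  have hpc : p ∈ c.source := mem_chart_source _ p
  set Φ : Cmodel n → Cmodel n := e ∘ c.symm with hΦ
  have hΦp : Φ (c p) = e p := by simp only [hΦ, Function.comp, c.left_inv hpc]
  have hΦs : ContDiffAt ℝ ∞ Φ (c p) :=
    ((contDiffAt_transition hcm he hpc hp).restrict_scalars ℝ).of_le le_top
  have hΨs : ContDiffAt ℝ ∞ (c ∘ e.symm) (Φ (c p)) := by
    rw [hΦp]
    exact ((contDiffAt_transition he hcm hp hpc).restrict_scalars ℝ).of_le le_top
  set s : Set (Cmodel n) := c.target ∩ c.symm ⁻¹' e.source with hs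
  have hso : IsOpen s := c.symm.isOpen_inter_preimage e.open_source
  have hps : c p ∈ s := ⟨c.map_source hpc, by rw [mem_preimage, c.left_inv hpc]; exact hp⟩
  have hinv : ∀ v ∈ s, (c ∘ e.symm) (Φ v) = v := by
    intro v hv
    simp only [hΦ, Function.comp]
    rw [e.left_inv hv.2, c.right_inv hv.1]
  have hinj : InjOn Φ s := by
    intro v hv v' hv' h
    rw [← hinv v hv, h, hinv v' hv']
  have hdet : (fderiv ℝ Φ (c p)).det ≠ 0 := by
    have hid : (c ∘ e.symm) ∘ Φ =ᶠ[𝓝 (c p)] id := by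
      filter_upwards [hso.mem_nhds hps] with v hv using hinv v hv
    have h1 := fderiv_comp (c p) (hΨs.differentiableAt (by simp)) (hΦs.differentiableAt (by simp))
    rw [hid.fderiv_eq, fderiv_id] at h1
    have h2 : (ContinuousLinearMap.id ℝ (Cmodel n)).det =
        (fderiv ℝ (c ∘ e.symm) (Φ (c p))).det * (fderiv ℝ Φ (c p)).det := by
      rw [h1]
      exact LinearMap.det_comp _ _
    intro h0
    rw [h0, mul_zero] at h2
    exact one_ne_zero ((LinearMap.det_id (A := ℝ) (M := Cmodel n)).symm.trans h2)
  have : (volume : Measure (Cmodel n)).IsAddHaarMeasure :=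
    Measure.prod.instIsAddHaarMeasure _ _
  obtain ⟨ε₁, hε₁, hint⟩ := exists_setLIntegral_comp_lt_top volume hΦs hdet (hso.mem_nhds hps)
    hinj (hΦp ▸ ht) hF
  have hwc : ContinuousAt w (c p) :=
    hw.continuousOn.continuousAt (c.open_target.mem_nhds (c.map_source hpc))
  have hev := (hwc.eventually (gt_mem_nhds (lt_add_one (w (c p))))).and (hso.mem_nhds hps)
  obtain ⟨ε₂, hε₂, hball⟩ := Metric.eventually_nhds_iff_ball.mp hev
  set ε := min ε₁ ε₂ with hε
  set b : Set (Cmodel n) := Metric.ball (c p) ε with hb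
  have hbo : IsOpen b := Metric.isOpen_ball
  have hb1 : b ⊆ Metric.ball (c p) ε₁ := Metric.ball_subset_ball (min_le_left _ _)
  have hb2 : b ⊆ Metric.ball (c p) ε₂ := Metric.ball_subset_ball (min_le_right _ _)
  have hbs : b ⊆ s := fun v hv => (hball v (hb2 hv)).2
  refine ⟨c.source ∩ c ⁻¹' b, c.continuousOn.isOpen_inter_preimage c.open_source hbo |>.mem_nhds
    ⟨hpc, Metric.mem_ball_self (lt_min hε₁ hε₂)⟩, ?_⟩
  have hUo : IsOpen (c.source ∩ c ⁻¹' b) := c.continuousOn.isOpen_inter_preimage c.open_source hbo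
  -- a measurable extension of the change of coordinates
  classical
  have hΦc : ContinuousOn Φ b := by
    refine e.continuousOn.comp (c.continuousOn_symm.mono fun v hv => (hbs hv).1) ?_
    exact fun v hv => (hbs hv).2
  have hΦm : Measurable (b.piecewise Φ fun _ => 0) :=
    hΦc.measurable_piecewise continuousOn_const hbo.measurableSet
  set H : Cmodel n → ENNReal := b.indicator fun v => F (b.piecewise Φ (fun _ => 0) v) with hH
  have hHm : Measurable H := (hFm.comp hΦm).indicator hbo.measurableSet
  have hHb : ∀ v ∈ b, H v = F (Φ v) := by
    intro v hv
    rw [hH, indicator_of_mem hv, piecewise_eq_of_mem _ _ _ hv]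
  have hcm' : AEMeasurable c (μ.restrict c.source) :=
    c.continuousOn.aemeasurable c.open_source.measurableSet
  have hwm : AEMeasurable (fun y => ENNReal.ofReal (w y)) (volume.restrict c.target) :=
    (hw.continuousOn.aemeasurable c.open_target.measurableSet).ennreal_ofReal
  calc ∫⁻ z in c.source ∩ c ⁻¹' b, F (e z) ∂μ
      = ∫⁻ z in c.source, H (c z) ∂μ := by
        rw [← lintegral_indicator hUo.measurableSet,
          ← lintegral_indicator c.open_source.measurableSet]
        refine lintegral_congr fun z => ?_
        by_cases hz : z ∈ c.source
        · rw [indicator_of_mem hz]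
          by_cases hzb : c z ∈ b
          · rw [indicator_of_mem (show z ∈ c.source ∩ c ⁻¹' b from ⟨hz, hzb⟩), hHb _ hzb]
            simp only [hΦ, Function.comp, c.left_inv hz]
          · rw [indicator_of_notMem fun h => hzb h.2, hH, indicator_of_notMem hzb]
        · rw [indicator_of_notMem hz, indicator_of_notMem fun h => hz h.1]
    _ = ∫⁻ v, H v ∂((μ.restrict c.source).map c) := (lintegral_map' hHm.aemeasurable hcm').symm
    _ = ∫⁻ v in c.target, ENNReal.ofReal (w v) * H v := by
        rw [hmap, lintegral_withDensity_eq_lintegral_mul₀ hwm hHm.aemeasurable]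
        rfl
    _ ≤ ∫⁻ v, b.indicator (fun v => ENNReal.ofReal (w (c p) + 1) * F (Φ v)) v := by
        refine (setLIntegral_le_lintegral _ _).trans (lintegral_mono fun v => ?_)
        by_cases hv : v ∈ b
        · rw [indicator_of_mem hv, hHb v hv]
          gcongr
          exact (hball v (hb2 hv)).1.le
        · rw [hH, indicator_of_notMem hv, indicator_of_notMem hv, mul_zero]
    _ = ENNReal.ofReal (w (c p) + 1) * ∫⁻ v in b, F (Φ v) := by
        rw [lintegral_indicator hbo.measurableSet, lintegral_const_mul' _ _ ENNReal.ofReal_ne_top]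
    _ < ⊤ := ENNReal.mul_lt_top ENNReal.ofReal_lt_top
        ((lintegral_mono_set hb1).trans_lt hint)

end

section

variable {n : ℕ} {X : Type*} [TopologicalSpace X] {e : OpenPartialHomeomorph X (Cmodel n)}
  {A : Matrix (Fin n) (Fin n) ℂ} {V : Set X} {χ : X → ℝ} {f : X → ℂ} {τ : ℝ}

theorem cutoffPower_eq_zero {z : X} (hz : z ∉ tsupport χ) : cutoffPower χ f τ z = 0 := by
  rw [cutoffPower, image_eq_zero_of_notMem_tsupport hz, Complex.ofReal_zero, zero_mul]

theorem measurable_cutoffPower [MeasurableSpace X] [BorelSpace X] (hVo : IsOpen V)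
    (hVe : V ⊆ e.source) (hf : ∀ z ∈ V, -Complex.I * f z = leviPoly A (e z))
    (hχ : Continuous χ) (hχV : tsupport χ ⊆ V) : Measurable (cutoffPower χ f τ) := by
  classical
  have h1 : ContinuousOn (fun z => leviPoly A (e z)) V :=
    (contDiff_leviPoly A).continuous.comp_continuousOn (e.continuousOn.mono hVe)
  have h2 : Measurable (V.piecewise (fun z => leviPoly A (e z)) fun _ => 0) :=
    h1.measurable_piecewise continuousOn_const hVo.measurableSet
  have h3 : cutoffPower χ f τ = fun z =>
      (χ z : ℂ) * (V.piecewise (fun z => leviPoly A (e z)) (fun _ => 0) z) ^ (-(τ : ℂ)) := by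
    funext z
    by_cases hz : z ∈ V
    · rw [piecewise_eq_of_mem _ _ _ hz, cutoffPower, hf z hz]
    · rw [cutoffPower_eq_zero fun h => hz (hχV h),
        image_eq_zero_of_notMem_tsupport fun h => hz (hχV h), Complex.ofReal_zero, zero_mul]
  rw [h3]
  exact (Complex.measurable_ofReal.comp hχ.measurable).mul (h2.pow_const _)

/-- The first condition of amenability: `χ f ^ (-τ)` is square integrable for `τ < 1`. -/
theorem exists_memLp_cutoffPower [ChartedSpace (Cmodel n) X] [IsManifold 𝓘(ℂ, Cmodel n) ω X]
    [MeasurableSpace X] [BorelSpace X] {μ : Measure X} (hμ : IsSmoothMeasure (n := n) μ) {p : X}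
    (he : e ∈ IsManifold.maximalAtlas 𝓘(ℂ, Cmodel n) ω X)
    (hpV : p ∈ V) (hep : e p = 0) (hVo : IsOpen V) (hVe : V ⊆ e.source)
    (hf : ∀ z ∈ V, -Complex.I * f z = leviPoly A (e z)) (hτ0 : 0 ≤ τ) (hτ1 : τ < 1) :
    ∃ U ∈ 𝓝 p, ∀ χ : X → ℝ,
      Continuous χ → HasCompactSupport χ → tsupport χ ⊆ U → tsupport χ ⊆ V →
      MemLp (cutoffPower χ f τ) 2 μ := by
  have hFm : Measurable fun v : Cmodel n => ENNReal.ofReal (‖leviPoly A v‖ ^ (-(2 * τ))) :=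
    (((contDiff_leviPoly A).continuous.measurable.norm).pow_const _).ennreal_ofReal
  obtain ⟨U, hU, hUint⟩ := exists_setLIntegral_chart_lt_top hμ he (hVe hpV) hFm
    (t := Metric.ball 0 1) (by rw [hep]; exact Metric.ball_mem_nhds _ one_pos)
    (setLIntegral_norm_leviPoly_rpow_lt_top A (by linarith) (by linarith) 1)
  refine ⟨U, hU, fun χ hχ hχc hχU hχV => ?_⟩
  have hm := measurable_cutoffPower (τ := τ) hVo hVe hf hχ hχV
  obtain ⟨C, hC⟩ := hχ.bounded_above_of_compact_support hχc
  rw [memLp_two_iff_integrable_sq_norm hm.aestronglyMeasurable]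
  refine ⟨(hm.norm.pow_const 2).aestronglyMeasurable, ?_⟩
  rw [hasFiniteIntegral_iff_ofReal (Eventually.of_forall fun z => by positivity)]
  have hsupp : ∀ z, ENNReal.ofReal (‖cutoffPower χ f τ z‖ ^ 2) ≤ (tsupport χ).indicator
      (fun z => ENNReal.ofReal (C ^ 2) * ENNReal.ofReal (‖leviPoly A (e z)‖ ^ (-(2 * τ)))) z := by
    intro z
    by_cases hz : z ∈ tsupport χ
    · rw [indicator_of_mem hz, ← ENNReal.ofReal_mul (sq_nonneg C)]
      refine ENNReal.ofReal_le_ofReal ?_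
      have h1 : ‖(leviPoly A (e z)) ^ (-(τ : ℂ))‖ = ‖leviPoly A (e z)‖ ^ (-τ) := by
        rw [← Complex.ofReal_neg, Complex.norm_cpow_real]
      rw [cutoffPower, hf z (hχV hz), norm_mul, h1, mul_pow, Complex.norm_real]
      have h2 : (‖leviPoly A (e z)‖ ^ (-τ)) ^ 2 = ‖leviPoly A (e z)‖ ^ (-(2 * τ)) := by
        rw [← Real.rpow_natCast, ← Real.rpow_mul (norm_nonneg _)]
        congr 1
        push_cast
        ring
      rw [h2]
      have := hC z
      gcongr
    · rw [cutoffPower_eq_zero hz]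
      simp
  calc ∫⁻ z, ENNReal.ofReal (‖cutoffPower χ f τ z‖ ^ 2) ∂μ
      ≤ ∫⁻ z in tsupport χ, ENNReal.ofReal (C ^ 2) *
          ENNReal.ofReal (‖leviPoly A (e z)‖ ^ (-(2 * τ))) ∂μ := by
        rw [← lintegral_indicator (isClosed_tsupport χ).measurableSet]
        exact lintegral_mono hsupp
    _ ≤ ∫⁻ z in U, ENNReal.ofReal (C ^ 2) *
          ENNReal.ofReal (‖leviPoly A (e z)‖ ^ (-(2 * τ))) ∂μ := lintegral_mono_set hχU
    _ < ⊤ := by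
        rw [lintegral_const_mul' _ _ ENNReal.ofReal_ne_top]
        exact ENNReal.mul_lt_top ENNReal.ofReal_lt_top hUint

end

/-! ### Adapted neighbourhoods -/

/-- A map whose differential at the origin is injective with values in `{z₀ = 0}` stays
quadratically close to this hyperplane, while its component in the hyperplane grows linearly. -/
theorem exists_bounds_of_fderiv_fst_eq_zero {n : ℕ} {E : Type*} [NormedAddCommGroup E]
    [NormedSpace ℝ E] [FiniteDimensional ℝ E] {φ : E → Cmodel n} (hφ : ContDiffAt ℝ ∞ φ 0)
    (h0 : φ 0 = 0) (hinj : ∀ y, fderiv ℝ φ 0 y = 0 → y = 0)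
    (hfst : ∀ y, (fderiv ℝ φ 0 y).1 = 0) :
    ∃ c > 0, ∃ K ≥ 0, ∀ᶠ y in 𝓝 (0 : E), c * ‖y‖ ≤ ‖(φ y).2‖ ∧ ‖(φ y).1‖ ≤ K * ‖y‖ ^ 2 := by
  set L := fderiv ℝ φ 0 with hL
  obtain ⟨κ, hκ, hanti⟩ := LinearMap.exists_antilipschitzWith (L : E →ₗ[ℝ] Cmodel n)
    (LinearMap.ker_eq_bot'.mpr hinj)
  have hκ' : (0 : ℝ) < κ := hκ
  have hLlow : ∀ y, (κ : ℝ)⁻¹ * ‖y‖ ≤ ‖(L y).2‖ := by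
    intro y
    have h1 : ‖y‖ ≤ κ * ‖L y‖ :=
      ZeroHomClass.bound_of_antilipschitz (L : E →ₗ[ℝ] Cmodel n) hanti y
    have h2 : ‖L y‖ = ‖(L y).2‖ := by
      rw [Prod.norm_def, hfst y, norm_zero, max_eq_right (norm_nonneg _)]
    rw [← h2, inv_mul_le_iff₀ hκ']
    exact h1
  have hlin : (fun y => φ y - L y) =o[𝓝 0] fun y => y := by
    have := (hφ.differentiableAt (by simp)).hasFDerivAt.isLittleO
    simpa [h0, ← hL] using this
  have ht := (hφ.of_le (m := 2) (by norm_cast)).taylor_two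
  have h1 := hlin.def (c := (κ : ℝ)⁻¹ / 2) (by positivity)
  have h2 := ht.def (c := 1) one_pos
  refine ⟨(κ : ℝ)⁻¹ / 2, by positivity, 1 + 1 / 2 * ‖fderiv ℝ (fderiv ℝ φ) 0‖, by positivity, ?_⟩
  filter_upwards [h1, h2] with y hy1 hy2
  constructor
  · have h3 : ‖(φ y).2 - (L y).2‖ ≤ ‖φ y - L y‖ := norm_snd_le (φ y - L y)
    have h4 := norm_sub_norm_le (L y).2 (φ y).2
    rw [norm_sub_rev] at h4
    have h5 := hLlow y
    nlinarith
  · have h3 : ‖(φ (0 + y) - φ 0 - L y - (1 / 2 : ℝ) • fderiv ℝ (fderiv ℝ φ) 0 y y).1‖ ≤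
        ‖y‖ ^ 2 := by
      refine (norm_fst_le _).trans (hy2.trans ?_)
      simp
    have h4 : ‖(fderiv ℝ (fderiv ℝ φ) 0 y y).1‖ ≤ ‖fderiv ℝ (fderiv ℝ φ) 0‖ * ‖y‖ ^ 2 := by
      refine (norm_fst_le _).trans ?_
      refine (ContinuousLinearMap.le_opNorm₂ _ y y).trans (le_of_eq (by ring))
    have h5 : (φ (0 + y) - φ 0 - L y - (1 / 2 : ℝ) • fderiv ℝ (fderiv ℝ φ) 0 y y).1 =
        (φ y).1 - (1 / 2 : ℝ) • (fderiv ℝ (fderiv ℝ φ) 0 y y).1 := by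
      rw [zero_add, h0, sub_zero, Prod.fst_sub, Prod.fst_sub, hfst, sub_zero, Prod.smul_fst]
    rw [h5] at h3
    have h6 := norm_sub_norm_le (φ y).1 ((1 / 2 : ℝ) • (fderiv ℝ (fderiv ℝ φ) 0 y y).1)
    rw [norm_smul, Real.norm_of_nonneg (by norm_num)] at h6
    nlinarith

section

variable {n : ℕ} {X : Type*} [TopologicalSpace X] [ChartedSpace (Cmodel n) X]

/-- A neighbourhood `V` of the boundary point `p` with adapted holomorphic coordinates `e`, in
which the normalized Levi polynomial `-i f` is `leviPoly A`. The remaining fields record the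
geometry of a strongly pseudoconvex boundary: on `closure M` the Levi polynomial avoids the cut of
the principal branch, its real part is bounded from below by the tangential coordinates up to
small multiples of `|Re z₀|`, the inner normal `{z₀ ∈ iℝ₊, z = 0}` points into `M`, and
complex tangent vectors have no `z₀` component. -/
structure IsAdaptedNhd (M : Set X) (p : X) (f : X → ℂ) (e : OpenPartialHomeomorph X (Cmodel n))
    (A : Matrix (Fin n) (Fin n) ℂ) (V : Set X) : Prop where
  mem_atlas : e ∈ IsManifold.maximalAtlas 𝓘(ℂ, Cmodel n) ω X
  isOpen : IsOpen V
  mem : p ∈ V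
  subset : V ⊆ e.source
  map_point : e p = 0
  eq_leviPoly : ∀ z ∈ V, -Complex.I * f z = leviPoly A (e z)
  mem_slitPlane : ∀ z ∈ V, z ∈ closure M → z ≠ p → leviPoly A (e z) ∈ Complex.slitPlane
  re_lower_bound : ∃ c : ℝ, 0 < c ∧ ∀ η : ℝ, 0 < η → ∀ᶠ z in 𝓝 p, z ∈ closure M →
    c * ‖(e z).2‖ ^ 2 - η * |(e z).1.re| ≤ (leviPoly A (e z)).re
  normal_mem : ∀ᶠ s : ℝ in 𝓝[>] (0 : ℝ), e.symm (Complex.I * s, 0) ∈ M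
  fst_mfderiv : ∀ w ∈ complexTangentSpace M p,
    (mfderiv 𝓘(ℝ, Cmodel n) 𝓘(ℝ, Cmodel n) e p w : Cmodel n).1 = 0

/-- Every Levi polynomial at a strongly pseudoconvex point comes with an adapted neighbourhood. -/
theorem exists_isAdaptedNhd [IsManifold 𝓘(ℂ, Cmodel n) ω X] {M : Set X} {p : X} {f : X → ℂ}
    (hpsc : IsStronglyPseudoconvexAt (n := n) M p) (hf : IsLeviPolynomial (n := n) M p f) :
    ∃ e A V, IsAdaptedNhd (n := n) M p f e A V := by
  obtain ⟨e, he, hp, hep, g, ℓ, A, B, hgs, -, hg, hM, hfe⟩ := hf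
  replace hg : AdaptedExpansion g ℓ A B := hg
  obtain ⟨c₀, hc₀, hB⟩ := exists_hermPart_lower_bound B
    (hermPart_pos_of_isStronglyPseudoconvexAt he hp hep hg hM hpsc)
  have het : Tendsto e (𝓝 p) (𝓝 0) := by
    have := (e.continuousAt hp).tendsto
    rwa [hep] at this
  have hπ : Continuous fun v : Cmodel n => (v.1.re, v.2) := by fun_prop
  have hπe : Tendsto (fun z => ((e z).1.re, (e z).2)) (𝓝 p) (𝓝 0) :=
    (hπ.tendsto' 0 0 (by simp)).comp het
  -- on the closure of `M` the inequality for the graphing function becomes weak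
  have hcl : ∀ᶠ z in 𝓝 p, z ∈ closure M → g ((e z).1.re, (e z).2) ≤ (e z).1.im := by
    have h1 := hM.eventually_nhds.and ((hπe.eventually hgs).and (e.open_source.mem_nhds hp))
    filter_upwards [h1] with z hz hzM
    obtain ⟨hz1, hz2, hz3⟩ := hz
    have hc1 : ContinuousAt (fun z => g ((e z).1.re, (e z).2)) z :=
      ContinuousAt.comp (g := g) hz2.continuousAt
        (hπ.continuousAt.comp (e.continuousAt hz3))
    have hc2 : ContinuousAt (fun z => (e z).1.im) z :=
      (Complex.continuous_im.comp continuous_fst).continuousAt.comp (e.continuousAt hz3)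
    have : (𝓝[M] z).NeBot := mem_closure_iff_nhdsWithin_neBot.mp hzM
    refine le_of_tendsto_of_tendsto (b := 𝓝[M] z) (hc1.tendsto.mono_left nhdsWithin_le_nhds)
      (hc2.tendsto.mono_left nhdsWithin_le_nhds) ?_
    filter_upwards [self_mem_nhdsWithin, nhdsWithin_le_nhds hz1] with y hyM hy
    exact (hy.mp hyM).le
  have hsl := het.eventually (hg.mem_slitPlane hc₀ hB)
  have hev := (hfe.and hcl).and (hsl.and (e.open_source.mem_nhds hp))
  obtain ⟨V, hV, hVo, hpV⟩ := eventually_nhds_iff.mp hev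
  refine ⟨e, A, V, he, hVo, hpV, fun z hz => (hV z hz).2.2, hep, ?_, ?_, ?_, ?_, ?_⟩
  · intro z hz
    rw [(hV z hz).1.1]
    rfl
  · intro z hz hzM hzp
    refine (hV z hz).2.1 ((hV z hz).1.2 hzM) fun h0 => hzp ?_
    exact e.injOn (hV z hz).2.2 hp (h0.trans hep.symm)
  · refine ⟨c₀ / 2, by positivity, fun η hη => ?_⟩
    filter_upwards [het.eventually (hg.re_lower_bound hc₀ hB hη), hcl] with z h1 h2 hzM
    exact h1 (h2 hzM)
  · have h1 : Tendsto (fun s : ℝ => ((Complex.I * s, 0) : Cmodel n)) (𝓝[>] 0) (𝓝 0) := by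
      refine Tendsto.mono_left ?_ nhdsWithin_le_nhds
      have : Continuous fun s : ℝ => ((Complex.I * s, 0) : Cmodel n) := by fun_prop
      exact this.tendsto' 0 0 (by simp)
    filter_upwards [h1.eventually (eventually_coord_iff hp hep hM), self_mem_nhdsWithin]
      with s hs hs0
    rw [hs.2, e.right_inv hs.1]
    have h2 : (Complex.I * (s : ℂ)).re = 0 := by simp
    have h3 : (Complex.I * (s : ℂ)).im = s := by simp
    rw [h2, h3]
    have h4 : g (0, 0) = 0 := hg.map_zero
    rw [h4]
    exact hs0
  · exact fun w hw => fst_mfderiv_eq_zero_of_mem_complexTangentSpace he hp hep hgs hg hM hw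

end

section

variable {n : ℕ} {X : Type*} [TopologicalSpace X] (d : ℕ) (G : Type*) [TopologicalSpace G]
  [ChartedSpace (EuclideanSpace ℝ (Fin d)) G] [Group G] [MulAction G X]

/-- The orbits through the inner normal at `p`: the point `θ(y) • z(s)`, where `θ` is
the inverse of a chart of the group at the identity and `z(s)` has the coordinates `(i s, 0)`. -/
def normalOrbit (e : OpenPartialHomeomorph X (Cmodel n)) (q : ℝ × EuclideanSpace ℝ (Fin d)) : X :=
  (identityChart d G).symm q.2 • e.symm ((Complex.I * q.1, 0) : Cmodel n)

theorem normalOrbit_zero_right (e : OpenPartialHomeomorph X (Cmodel n)) (s : ℝ) :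
    normalOrbit d G e (s, 0) = e.symm ((Complex.I * s, 0) : Cmodel n) := by
  rw [normalOrbit, identityChart_symm_zero, one_smul]

end

section

variable {n d : ℕ} {X : Type*} [TopologicalSpace X] [ChartedSpace (Cmodel n) X]
  {G : Type*} [TopologicalSpace G] [ChartedSpace (EuclideanSpace ℝ (Fin d)) G] [Group G]
  [MulAction G X]

theorem IsFreeProperHolomorphicAction.smul_mem_closure {M : Set X}
    (hG : IsFreeProperHolomorphicAction (n := n) d G M) (t : G) {z : X} (hz : z ∈ closure M) :
    t • z ∈ closure M := by
  have h1 : Continuous fun z : X => t • z := (contMDiff_const_smul hG.smooth t).continuous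
  exact map_mem_closure h1 hz fun y hy => hG.invariant t y hy

variable {M : Set X} {p : X} {f : X → ℂ} {e : OpenPartialHomeomorph X (Cmodel n)}
  {A : Matrix (Fin n) (Fin n) ℂ} {V : Set X}

theorem IsAdaptedNhd.mem_source (h : IsAdaptedNhd M p f e A V) : p ∈ e.source := h.subset h.mem

theorem IsAdaptedNhd.zero_mem_target (h : IsAdaptedNhd M p f e A V) :
    (0 : Cmodel n) ∈ e.target := by
  rw [← h.map_point]; exact e.map_source h.mem_source

theorem IsAdaptedNhd.symm_zero (h : IsAdaptedNhd M p f e A V) : e.symm (0 : Cmodel n) = p := by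
  rw [← h.map_point, e.left_inv h.mem_source]

theorem IsAdaptedNhd.normalOrbit_zero_left (h : IsAdaptedNhd M p f e A V)
    (y : EuclideanSpace ℝ (Fin d)) :
    normalOrbit d G e (0, y) = (identityChart d G).symm y • p := by
  have h1 : ((Complex.I * ((0 : ℝ) : ℂ), 0) : Cmodel n) = 0 := by simp
  rw [normalOrbit, h1, h.symm_zero]

theorem IsAdaptedNhd.normalOrbit_zero (h : IsAdaptedNhd M p f e A V) :
    normalOrbit d G e (0, 0) = p := by
  rw [h.normalOrbit_zero_left, identityChart_symm_zero, one_smul]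

theorem IsAdaptedNhd.contMDiffAt_normalOrbit [IsManifold (𝓡 d) ∞ G]
    (h : IsAdaptedNhd M p f e A V) (hG : IsFreeProperHolomorphicAction (n := n) d G M)
    {q : ℝ × EuclideanSpace ℝ (Fin d)} (hq1 : ((Complex.I * q.1, 0) : Cmodel n) ∈ e.target)
    (hq2 : q.2 ∈ (identityChart d G).target) :
    ContMDiffAt 𝓘(ℝ, ℝ × EuclideanSpace ℝ (Fin d)) 𝓘(ℝ, Cmodel n) ∞ (normalOrbit d G e) q := by
  have h1 : ContMDiffAt 𝓘(ℝ, ℝ × EuclideanSpace ℝ (Fin d)) (𝓡 d) ∞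
      (fun q : ℝ × EuclideanSpace ℝ (Fin d) => (identityChart d G).symm q.2) q :=
    ContMDiffAt.comp (g := (identityChart d G).symm) q (contMDiffAt_identityChart_symm d G hq2)
      contDiff_snd.contMDiff.contMDiffAt
  have h2 : ContDiff ℝ ∞ fun q : ℝ × EuclideanSpace ℝ (Fin d) =>
      ((Complex.I * q.1, 0) : Cmodel n) := by
    refine ContDiff.prodMk ?_ contDiff_const
    exact contDiff_const.mul (Complex.ofRealCLM.contDiff.comp contDiff_fst)
  have h3 : ContMDiffAt 𝓘(ℝ, ℝ × EuclideanSpace ℝ (Fin d)) 𝓘(ℝ, Cmodel n) ∞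
      (fun q : ℝ × EuclideanSpace ℝ (Fin d) => e.symm ((Complex.I * q.1, 0) : Cmodel n)) q :=
    ContMDiffAt.comp (g := e.symm) q (contMDiffAt_chart_symm_real h.mem_atlas hq1)
      h2.contMDiff.contMDiffAt
  exact ContMDiffAt.comp (g := fun r : G × X => r.1 • r.2) q (hG.smooth _) (h1.prodMk h3)

theorem IsAdaptedNhd.contMDiffAt_normalOrbit_zero [IsManifold (𝓡 d) ∞ G]
    (h : IsAdaptedNhd M p f e A V) (hG : IsFreeProperHolomorphicAction (n := n) d G M) :
    ContMDiffAt 𝓘(ℝ, ℝ × EuclideanSpace ℝ (Fin d)) 𝓘(ℝ, Cmodel n) ∞ (normalOrbit d G e) 0 := by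
  refine h.contMDiffAt_normalOrbit hG ?_ (zero_mem_identityChart_target d G)
  have h1 : ((Complex.I * ((0 : ℝ) : ℂ), 0) : Cmodel n) = 0 := by simp
  exact h1 ▸ h.zero_mem_target

variable (d G) in
/-- The normalized Levi polynomial along the orbits through the inner normal. -/
def orbitLevi (e : OpenPartialHomeomorph X (Cmodel n)) (A : Matrix (Fin n) (Fin n) ℂ)
    (q : ℝ × EuclideanSpace ℝ (Fin d)) : ℂ :=
  leviPoly A (e (normalOrbit d G e q))

theorem IsAdaptedNhd.contDiffAt_chart_normalOrbit [IsManifold (𝓡 d) ∞ G]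
    (h : IsAdaptedNhd M p f e A V) (hG : IsFreeProperHolomorphicAction (n := n) d G M) :
    ContDiffAt ℝ ∞ (fun q => e (normalOrbit d G e q)) 0 := by
  rw [← contMDiffAt_iff_contDiffAt]
  have h1 : ContMDiffAt 𝓘(ℝ, Cmodel n) 𝓘(ℝ, Cmodel n) ∞ e (normalOrbit d G e 0) := by
    have : normalOrbit d G e 0 = p := h.normalOrbit_zero
    rw [this]
    exact contMDiffAt_chart_real h.mem_atlas h.mem_source
  exact h1.comp 0 (h.contMDiffAt_normalOrbit_zero hG)

theorem IsAdaptedNhd.contDiffAt_orbitLevi [IsManifold (𝓡 d) ∞ G]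
    (h : IsAdaptedNhd M p f e A V) (hG : IsFreeProperHolomorphicAction (n := n) d G M) :
    ContDiffAt ℝ ∞ (orbitLevi d G e A) 0 :=
  (((contDiff_leviPoly A).restrict_scalars ℝ).of_le le_top).contDiffAt.comp 0
    (h.contDiffAt_chart_normalOrbit hG)

theorem IsAdaptedNhd.orbitLevi_normal (h : IsAdaptedNhd M p f e A V) :
    ∀ᶠ s in 𝓝 (0 : ℝ), orbitLevi d G e A (s, 0) = s := by
  have h1 : Tendsto (fun s : ℝ => ((Complex.I * s, 0) : Cmodel n)) (𝓝 0) (𝓝 0) := by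
    have : Continuous fun s : ℝ => ((Complex.I * s, 0) : Cmodel n) := by fun_prop
    exact this.tendsto' 0 0 (by simp)
  filter_upwards [h1.eventually (e.open_target.mem_nhds h.zero_mem_target)] with s hs
  rw [orbitLevi, normalOrbit_zero_right d G, e.right_inv hs, leviPoly, quadPart_zero]
  linear_combination (-(s : ℂ)) * Complex.I_mul_I

end

/-! ### The Levi polynomial along the orbits -/

section

variable {n d : ℕ} {X : Type*} [TopologicalSpace X] [ChartedSpace (Cmodel n) X]
  {G : Type*} [TopologicalSpace G] [ChartedSpace (EuclideanSpace ℝ (Fin d)) G] [Group G]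
  [MulAction G X] {M : Set X} {p : X} {f : X → ℂ} {e : OpenPartialHomeomorph X (Cmodel n)}
  {A : Matrix (Fin n) (Fin n) ℂ} {V : Set X}

/-- The differential of the orbit map of `p` in coordinates: it is `L ∘ O ∘ T`, where `O` is the
differential of the orbit map at the identity and the injective maps `L` and `T` are the
differentials of the chart at `p` and of the inverse of the chart of the group. -/
theorem IsAdaptedNhd.hasFDerivAt_chart_orbit [IsManifold (𝓡 d) ∞ G]
    (h : IsAdaptedNhd M p f e A V) (hG : IsFreeProperHolomorphicAction (n := n) d G M) :
    ∃ (L : Cmodel n →L[ℝ] Cmodel n) (T : EuclideanSpace ℝ (Fin d) →L[ℝ] EuclideanSpace ℝ (Fin d)),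
      (∀ v, L v = 0 → v = 0) ∧ (∀ y, T y = 0 → y = 0) ∧
      (∀ w, L w = mfderiv 𝓘(ℝ, Cmodel n) 𝓘(ℝ, Cmodel n) e p w) ∧
      HasFDerivAt (fun y => e (normalOrbit d G e (0, y)))
        (L.comp ((show EuclideanSpace ℝ (Fin d) →L[ℝ] Cmodel n from
          mfderiv (𝓡 d) 𝓘(ℝ, Cmodel n) (fun t : G => t • p) 1).comp T)) 0 := by
  set κ := identityChart d G with hκ
  obtain ⟨L, hL⟩ : ∃ L : Cmodel n →L[ℝ] Cmodel n,
      HasMFDerivAt 𝓘(ℝ, Cmodel n) 𝓘(ℝ, Cmodel n) e p L :=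
    ⟨_, ((contMDiffAt_chart_real h.mem_atlas h.mem_source).mdifferentiableAt
      (by simp)).hasMFDerivAt⟩
  obtain ⟨L', hL'⟩ : ∃ L' : Cmodel n →L[ℝ] Cmodel n,
      HasMFDerivAt 𝓘(ℝ, Cmodel n) 𝓘(ℝ, Cmodel n) e.symm (e p) L' :=
    ⟨_, ((contMDiffAt_chart_symm_real h.mem_atlas (e.map_source h.mem_source)).mdifferentiableAt
      (by simp)).hasMFDerivAt⟩
  obtain ⟨T, hT⟩ : ∃ T : EuclideanSpace ℝ (Fin d) →L[ℝ] EuclideanSpace ℝ (Fin d),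
      HasMFDerivAt (𝓡 d) (𝓡 d) κ.symm 0 T :=
    ⟨_, ((contMDiffAt_identityChart_symm d G
      (zero_mem_identityChart_target d G)).mdifferentiableAt (by simp)).hasMFDerivAt⟩
  obtain ⟨T', hT'⟩ : ∃ T' : EuclideanSpace ℝ (Fin d) →L[ℝ] EuclideanSpace ℝ (Fin d),
      HasMFDerivAt (𝓡 d) (𝓡 d) κ (κ.symm 0) T' := by
    refine ⟨_, ((contMDiffAt_identityChart d G ?_).mdifferentiableAt (by simp)).hasMFDerivAt⟩
    exact κ.map_target (zero_mem_identityChart_target d G)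
  obtain ⟨O, hO⟩ : ∃ O : EuclideanSpace ℝ (Fin d) →L[ℝ] Cmodel n,
      HasMFDerivAt (𝓡 d) 𝓘(ℝ, Cmodel n) (fun t : G => t • p) 1 O :=
    ⟨_, ((contMDiff_orbit hG.smooth p 1).mdifferentiableAt (by simp)).hasMFDerivAt⟩
  refine ⟨L, T, ?_, ?_, ?_, ?_⟩
  · intro v hv
    have h1 : HasMFDerivAt 𝓘(ℝ, Cmodel n) 𝓘(ℝ, Cmodel n) (e.symm ∘ e) p (L'.comp L) :=
      HasMFDerivAt.comp p hL' hL
    have h2 : HasMFDerivAt 𝓘(ℝ, Cmodel n) 𝓘(ℝ, Cmodel n) (e.symm ∘ e) p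
        (ContinuousLinearMap.id ℝ (Cmodel n)) := by
      refine (hasMFDerivAt_id p).congr_of_eventuallyEq ?_
      filter_upwards [e.open_source.mem_nhds h.mem_source] with z hz using e.left_inv hz
    have h3 : L'.comp L = ContinuousLinearMap.id ℝ (Cmodel n) := hasMFDerivAt_unique h1 h2
    have h4 := congrArg (fun S => S v) h3
    simpa [hv] using h4.symm
  · intro y hy
    have h1 : HasMFDerivAt (𝓡 d) (𝓡 d) (κ ∘ κ.symm) (0 : EuclideanSpace ℝ (Fin d)) (T'.comp T) :=
      HasMFDerivAt.comp (0 : EuclideanSpace ℝ (Fin d)) hT' hT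
    have h2 : HasMFDerivAt (𝓡 d) (𝓡 d) (κ ∘ κ.symm) (0 : EuclideanSpace ℝ (Fin d))
        (ContinuousLinearMap.id ℝ (EuclideanSpace ℝ (Fin d))) := by
      refine (hasMFDerivAt_id (0 : EuclideanSpace ℝ (Fin d))).congr_of_eventuallyEq ?_
      filter_upwards [κ.open_target.mem_nhds (zero_mem_identityChart_target d G)] with z hz
        using κ.right_inv hz
    have h3 : T'.comp T = ContinuousLinearMap.id ℝ (EuclideanSpace ℝ (Fin d)) :=
      hasMFDerivAt_unique h1 h2
    have h4 := congrArg (fun S => S y) h3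
    simpa [hy] using h4.symm
  · intro w
    rw [hL.mfderiv]
    rfl
  · have h1 : ∀ t : G, t = 1 → HasMFDerivAt (𝓡 d) 𝓘(ℝ, Cmodel n) (fun t : G => t • p) t O := by
      rintro _ rfl
      exact hO
    have h2 : HasMFDerivAt (𝓡 d) 𝓘(ℝ, Cmodel n) (fun y => κ.symm y • p)
        (0 : EuclideanSpace ℝ (Fin d)) (O.comp T) :=
      HasMFDerivAt.comp (0 : EuclideanSpace ℝ (Fin d)) (h1 _ (identityChart_symm_zero d G)) hT
    have h3 : ∀ z : X, z = p → HasMFDerivAt 𝓘(ℝ, Cmodel n) 𝓘(ℝ, Cmodel n) e z L := by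
      rintro _ rfl
      exact hL
    have h4 : HasMFDerivAt (𝓡 d) 𝓘(ℝ, Cmodel n) (fun y => e (κ.symm y • p))
        (0 : EuclideanSpace ℝ (Fin d)) (L.comp (O.comp T)) := by
      refine HasMFDerivAt.comp (0 : EuclideanSpace ℝ (Fin d)) (h3 _ ?_) h2
      rw [hκ, identityChart_symm_zero, one_smul]
    have h5 : HasFDerivAt (fun y => e (κ.symm y • p)) (L.comp (O.comp T)) 0 := h4.hasFDerivAt
    have h6 : (mfderiv (𝓡 d) 𝓘(ℝ, Cmodel n) (fun t : G => t • p) 1) = O := hO.mfderiv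
    have h7 : (fun y => e (normalOrbit d G e (0, y))) = fun y => e (κ.symm y • p) := by
      funext y
      rw [h.normalOrbit_zero_left]
    rw [h7, h6]
    exact h5

theorem IsAdaptedNhd.contDiffAt_chart_orbit [IsManifold (𝓡 d) ∞ G]
    (h : IsAdaptedNhd M p f e A V) (hG : IsFreeProperHolomorphicAction (n := n) d G M) :
    ContDiffAt ℝ ∞ (fun y => e (normalOrbit d G e (0, y))) 0 := by
  have h1 : ContDiff ℝ ∞ fun y : EuclideanSpace ℝ (Fin d) =>
      ((0, y) : ℝ × EuclideanSpace ℝ (Fin d)) :=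
    contDiff_const.prodMk contDiff_id
  exact ContDiffAt.comp (g := fun q => e (normalOrbit d G e q)) 0
    (h.contDiffAt_chart_normalOrbit hG) h1.contDiffAt

theorem IsAdaptedNhd.fst_fderiv_chart_orbit [IsManifold (𝓡 d) ∞ G]
    (h : IsAdaptedNhd M p f e A V) (hG : IsFreeProperHolomorphicAction (n := n) d G M)
    (htan : orbitTangentSpace (n := n) d G p ⊆ complexTangentSpace M p)
    (y : EuclideanSpace ℝ (Fin d)) :
    (fderiv ℝ (fun y => e (normalOrbit d G e (0, y))) 0 y).1 = 0 := by
  obtain ⟨L, T, -, -, hL, hd⟩ := h.hasFDerivAt_chart_orbit hG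
  rw [hd.fderiv]
  simp only [ContinuousLinearMap.comp_apply]
  rw [hL]
  exact h.fst_mfderiv _ (htan ⟨T y, rfl⟩)

/-- The differential of the Levi polynomial along the orbits only sees the normal direction,
because the tangent space of the orbit is complex tangential. -/
theorem IsAdaptedNhd.fderiv_orbitLevi [IsManifold (𝓡 d) ∞ G]
    (h : IsAdaptedNhd M p f e A V) (hG : IsFreeProperHolomorphicAction (n := n) d G M)
    (htan : orbitTangentSpace (n := n) d G p ⊆ complexTangentSpace M p)
    (s : ℝ) (y : EuclideanSpace ℝ (Fin d)) :
    fderiv ℝ (orbitLevi d G e A) 0 (s, y) = (s : ℂ) := by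
  have hdiff : DifferentiableAt ℝ (orbitLevi d G e A) 0 :=
    (h.contDiffAt_orbitLevi hG).differentiableAt (by simp)
  have h1 : fderiv ℝ (orbitLevi d G e A) 0 (s, 0) = (s : ℂ) := by
    have h2 : HasFDerivAt (fun s : ℝ => orbitLevi d G e A (s, 0))
        ((fderiv ℝ (orbitLevi d G e A) 0).comp
          (ContinuousLinearMap.inl ℝ ℝ (EuclideanSpace ℝ (Fin d)))) 0 :=
      HasFDerivAt.comp (g := orbitLevi d G e A)
        (f := ContinuousLinearMap.inl ℝ ℝ (EuclideanSpace ℝ (Fin d))) (0 : ℝ)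
        hdiff.hasFDerivAt (ContinuousLinearMap.inl ℝ ℝ (EuclideanSpace ℝ (Fin d))).hasFDerivAt
    have h3 : HasFDerivAt (fun s : ℝ => orbitLevi d G e A (s, 0)) Complex.ofRealCLM 0 :=
      Complex.ofRealCLM.hasFDerivAt.congr_of_eventuallyEq h.orbitLevi_normal
    have h4 := congrArg (fun S => S s) (h2.unique h3)
    exact h4
  have h2 : fderiv ℝ (orbitLevi d G e A) 0 (0, y) = 0 := by
    have h3 : HasFDerivAt (fun y => orbitLevi d G e A (0, y))
        ((fderiv ℝ (orbitLevi d G e A) 0).comp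
          (ContinuousLinearMap.inr ℝ ℝ (EuclideanSpace ℝ (Fin d)))) 0 :=
      HasFDerivAt.comp (g := orbitLevi d G e A)
        (f := ContinuousLinearMap.inr ℝ ℝ (EuclideanSpace ℝ (Fin d)))
        (0 : EuclideanSpace ℝ (Fin d))
        hdiff.hasFDerivAt (ContinuousLinearMap.inr ℝ ℝ (EuclideanSpace ℝ (Fin d))).hasFDerivAt
    have hE0 : e (normalOrbit d G e (0, 0)) = 0 := by rw [h.normalOrbit_zero, h.map_point]
    have h4 : HasFDerivAt (leviPoly A)
        ((-Complex.I) • ContinuousLinearMap.fst ℝ ℂ (Fin n → ℂ))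
        (e (normalOrbit d G e (0, 0))) := by
      rw [hE0]
      have h5 : HasFDerivAt (fun v : Cmodel n => quadPart A v.2) (0 : Cmodel n →L[ℝ] ℂ) 0 := by
        obtain ⟨K, hK, hq⟩ := exists_norm_quadPart_le A
        refine .of_isLittleO ?_
        refine Asymptotics.IsBigO.trans_isLittleO (g := fun v : Cmodel n => ‖v‖ ^ 2) ?_ ?_
        · refine Asymptotics.IsBigO.of_bound K (Eventually.of_forall fun v => ?_)
          simp only [Prod.snd_zero, quadPart_zero, sub_zero, zero_apply, norm_pow, norm_norm]
          refine (hq v.2).trans ?_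
          gcongr
          exact norm_snd_le v
        · simp only [sub_zero]
          exact Asymptotics.isLittleO_norm_pow_id one_lt_two
      have h6 : HasFDerivAt (fun v : Cmodel n => v.1) (ContinuousLinearMap.fst ℝ ℂ (Fin n → ℂ)) 0 :=
        hasFDerivAt_fst
      have h7 := (h6.sub (h5.const_mul (2 * Complex.I))).const_mul (-Complex.I)
      refine HasFDerivAt.congr_fderiv (show HasFDerivAt (leviPoly A) _ 0 from h7) ?_
      refine ContinuousLinearMap.ext fun v => ?_
      change -Complex.I * (v.1 - 2 * Complex.I * 0) = -Complex.I * v.1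
      rw [mul_zero, sub_zero]
    have h5 : HasFDerivAt (fun y => orbitLevi d G e A (0, y)) _ 0 :=
      h4.comp (0 : EuclideanSpace ℝ (Fin d))
        ((h.contDiffAt_chart_orbit hG).differentiableAt (by simp)).hasFDerivAt
    have h6 := congrArg (fun S => S y) (h3.unique h5)
    have h7 : fderiv ℝ (orbitLevi d G e A) 0 (0, y) =
        (-Complex.I) • (fderiv ℝ (fun y => e (normalOrbit d G e (0, y))) 0 y).1 := h6
    rw [h7, h.fst_fderiv_chart_orbit hG htan, smul_zero]
  have h3 : ((s, y) : ℝ × EuclideanSpace ℝ (Fin d)) = (s, 0) + (0, y) := by simp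
  rw [h3, map_add, h1, h2, add_zero]

/-- Along the orbit of `p`, the real part of the Levi polynomial grows quadratically. -/
theorem IsAdaptedNhd.re_orbitLevi_lower_bound [T2Space X] [LieGroup (𝓡 d) ∞ G]
    [IsManifold 𝓘(ℂ, Cmodel n) ω X]
    (h : IsAdaptedNhd M p f e A V) (hG : IsFreeProperHolomorphicAction (n := n) d G M)
    (hp : p ∈ closure M)
    (htan : orbitTangentSpace (n := n) d G p ⊆ complexTangentSpace M p) :
    ∃ c > 0, ∀ᶠ y in 𝓝 (0 : EuclideanSpace ℝ (Fin d)),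
      c * ‖y‖ ^ 2 ≤ (orbitLevi d G e A (0, y)).re := by
  have : IsManifold 𝓘(ℝ, Cmodel n) ∞ X := isManifold_real
  have hE0 : e (normalOrbit d G e (0, 0)) = 0 := by rw [h.normalOrbit_zero, h.map_point]
  obtain ⟨c₁, hc₁, K, hK, hbd⟩ := exists_bounds_of_fderiv_fst_eq_zero
    (h.contDiffAt_chart_orbit (G := G) hG) hE0 (by
      intro y hy
      obtain ⟨L, T, hLi, hTi, hL, hd⟩ := h.hasFDerivAt_chart_orbit hG
      rw [hd.fderiv] at hy
      exact hTi y (eq_zero_of_mfderiv_orbit_eq_zero hG.smooth (hG.free p hp) (T y) (hLi _ hy)))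
    (h.fst_fderiv_chart_orbit hG htan)
  obtain ⟨c₀, hc₀, hlow⟩ := h.re_lower_bound
  -- with this `η`, the loss `η |Re z₀| ≤ η K ‖y‖ ^ 2` is at most half of the gain
  have hη : 0 < c₀ * c₁ ^ 2 / (2 * (K + 1)) := by positivity
  have htend : Tendsto (fun y => normalOrbit d G e (0, y))
      (𝓝 (0 : EuclideanSpace ℝ (Fin d))) (𝓝 p) := by
    have h1 : ContinuousAt (normalOrbit d G e) 0 := (h.contMDiffAt_normalOrbit_zero hG).continuousAt
    have h2 : Tendsto (fun y : EuclideanSpace ℝ (Fin d) => ((0, y) : ℝ × EuclideanSpace ℝ (Fin d)))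
        (𝓝 0) (𝓝 0) := (Continuous.prodMk_right 0).tendsto' 0 0 rfl
    have h3 := h1.tendsto.comp h2
    rwa [show normalOrbit d G e 0 = p from h.normalOrbit_zero] at h3
  refine ⟨c₀ * c₁ ^ 2 / 2, by positivity, ?_⟩
  filter_upwards [hbd, htend.eventually (hlow _ hη)] with y hy1 hy2
  have hmem : normalOrbit d G e (0, y) ∈ closure M := by
    rw [h.normalOrbit_zero_left]
    exact hG.smul_mem_closure _ hp
  refine le_trans ?_ (hy2 hmem)
  have h1 : c₀ * (c₁ * ‖y‖) ^ 2 ≤ c₀ * ‖(e (normalOrbit d G e (0, y))).2‖ ^ 2 := by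
    gcongr
    exact hy1.1
  have h2 : |(e (normalOrbit d G e (0, y))).1.re| ≤ (K + 1) * ‖y‖ ^ 2 := by
    refine (Complex.abs_re_le_norm _).trans (hy1.2.trans ?_)
    nlinarith [sq_nonneg ‖y‖]
  have h3 : c₀ * c₁ ^ 2 / (2 * (K + 1)) * |(e (normalOrbit d G e (0, y))).1.re| ≤
      c₀ * c₁ ^ 2 / (2 * (K + 1)) * ((K + 1) * ‖y‖ ^ 2) := by gcongr
  have h4 : c₀ * c₁ ^ 2 / (2 * (K + 1)) * ((K + 1) * ‖y‖ ^ 2) = c₀ * c₁ ^ 2 / 2 * ‖y‖ ^ 2 := by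
    field_simp
  nlinarith

end

/-! ### Integrability along the orbits -/

section

variable {n d : ℕ} {X : Type*} [TopologicalSpace X] [ChartedSpace (Cmodel n) X]
  {M : Set X} {p : X} {f : X → ℂ} {e : OpenPartialHomeomorph X (Cmodel n)}
  {A : Matrix (Fin n) (Fin n) ℂ} {V : Set X} {χ : X → ℝ} {τ : ℝ}

/-- On `closure M`, the function `χ f ^ (-τ)` is smooth away from `p`. -/
theorem IsAdaptedNhd.contMDiffAt_cutoffPower (h : IsAdaptedNhd M p f e A V)
    (hχ : ContMDiff 𝓘(ℝ, Cmodel n) 𝓘(ℝ, ℝ) ∞ χ) (hχV : tsupport χ ⊆ V) {z : X}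
    (hz : z ∈ closure M) (hzp : z ≠ p) :
    ContMDiffAt 𝓘(ℝ, Cmodel n) 𝓘(ℝ, ℂ) ∞ (cutoffPower χ f τ) z := by
  by_cases hzV : z ∈ V
  · have h1 : ContDiffAt ℝ ∞ (fun v : Cmodel n => leviPoly A v ^ (-(τ : ℂ))) (e z) := by
      have h2 : ContDiffAt ℂ ∞ (fun w : ℂ => w ^ (-(τ : ℂ))) (leviPoly A (e z)) :=
        (analyticAt_id.cpow analyticAt_const (h.mem_slitPlane z hzV hz hzp)).contDiffAt
      exact (h2.restrict_scalars ℝ).comp (e z)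
        (((contDiff_leviPoly A).restrict_scalars ℝ).of_le le_top).contDiffAt
    have h2 : ContMDiffAt 𝓘(ℝ, Cmodel n) 𝓘(ℝ, ℂ) ∞ (fun z => leviPoly A (e z) ^ (-(τ : ℂ))) z :=
      ContMDiffAt.comp (g := fun v : Cmodel n => leviPoly A v ^ (-(τ : ℂ))) z h1.contMDiffAt
        (contMDiffAt_chart_real h.mem_atlas (h.subset hzV))
    have h3 : ContMDiffAt 𝓘(ℝ, Cmodel n) 𝓘(ℝ, ℂ) ∞ (fun z => (χ z : ℂ)) z :=
      ContMDiffAt.comp (g := Complex.ofRealCLM) z Complex.ofRealCLM.contDiff.contMDiff.contMDiffAt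
        (hχ z)
    have h4 : ContMDiffAt 𝓘(ℝ, Cmodel n) 𝓘(ℝ, ℂ) ∞
        (fun z => (χ z : ℂ) * leviPoly A (e z) ^ (-(τ : ℂ))) z := by
      have hmul : ContDiff ℝ ∞ fun q : ℂ × ℂ => q.1 * q.2 := contDiff_fst.mul contDiff_snd
      exact ContMDiffAt.comp (g := fun q : ℂ × ℂ => q.1 * q.2) z hmul.contMDiff.contMDiffAt
        (h3.prodMk_space h2)
    refine h4.congr_of_eventuallyEq ?_
    filter_upwards [h.isOpen.mem_nhds hzV] with y hy
    rw [cutoffPower, h.eq_leviPoly y hy]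
  · refine (contMDiffAt_const (c := (0 : ℂ))).congr_of_eventuallyEq ?_
    have h1 : (tsupport χ)ᶜ ∈ 𝓝 z :=
      (isClosed_tsupport χ).isOpen_compl.mem_nhds fun h => hzV (hχV h)
    filter_upwards [h1] with y hy using cutoffPower_eq_zero hy

end

section

variable {n d : ℕ} {X : Type*} [TopologicalSpace X] [ChartedSpace (Cmodel n) X]
  {G : Type*} [TopologicalSpace G] [ChartedSpace (EuclideanSpace ℝ (Fin d)) G] [Group G]
  [MulAction G X] {M : Set X}

/-- Properness of the action: only a compact set of group elements moves points of the compact set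
`C` of `closure M` into the compact set `K`. -/
theorem IsFreeProperHolomorphicAction.exists_isCompact
    (hG : IsFreeProperHolomorphicAction (n := n) d G M) {K C : Set X} (hK : IsCompact K)
    (hC : IsCompact C) (hCM : C ⊆ closure M) :
    ∃ K' : Set G, IsCompact K' ∧ ∀ t : G, ∀ z ∈ C, t • z ∈ K → t ∈ K' := by
  refine ⟨_, (hG.proper.isCompact_preimage (hK.prod hC)).image continuous_fst, ?_⟩
  intro t z hz ht
  exact ⟨(t, ⟨z, hCM hz⟩), ⟨ht, hz⟩, rfl⟩

theorem IsFreeProperHolomorphicAction.smul_ne_of_notMem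
    (hG : IsFreeProperHolomorphicAction (n := n) d G M) {q z : X} (hq : q ∉ M) (hz : z ∈ M)
    (t : G) : t • z ≠ q := fun h => hq (h ▸ hG.invariant t z hz)

variable {p : X} {f : X → ℂ} {e : OpenPartialHomeomorph X (Cmodel n)}
  {A : Matrix (Fin n) (Fin n) ℂ} {V : Set X} {χ : X → ℝ} {τ : ℝ}

theorem IsAdaptedNhd.continuousAt_cutoffPower_smul (h : IsAdaptedNhd M p f e A V)
    (hG : IsFreeProperHolomorphicAction (n := n) d G M)
    (hχ : ContMDiff 𝓘(ℝ, Cmodel n) 𝓘(ℝ, ℝ) ∞ χ) (hχV : tsupport χ ⊆ V) {z : X}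
    (hz : z ∈ closure M) {t : G} (ht : t • z ≠ p) :
    ContinuousAt (fun t : G => cutoffPower χ f τ (t • z)) t :=
  ContinuousAt.comp (g := cutoffPower χ f τ)
    (h.contMDiffAt_cutoffPower hχ hχV (hG.smul_mem_closure t hz) ht).continuousAt
    (contMDiff_orbit hG.smooth z).continuous.continuousAt

theorem IsAdaptedNhd.measurable_cutoffPower_smul [MeasurableSpace X] [BorelSpace X]
    [MeasurableSpace G] [BorelSpace G] (h : IsAdaptedNhd M p f e A V)
    (hG : IsFreeProperHolomorphicAction (n := n) d G M)
    (hχ : ContMDiff 𝓘(ℝ, Cmodel n) 𝓘(ℝ, ℝ) ∞ χ) (hχV : tsupport χ ⊆ V) (z : X) :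
    Measurable fun t : G => cutoffPower χ f τ (t • z) :=
  (measurable_cutoffPower h.isOpen h.subset h.eq_leviPoly hχ.continuous hχV).comp
    (contMDiff_orbit hG.smooth z).continuous.measurable

variable [T2Space G] [MeasurableSpace G] [BorelSpace G]
  (ν : Measure G) [IsFiniteMeasureOnCompacts ν]

/-- On orbits that avoid `p`, the function `χ f ^ (-τ)` is continuous with compact support. -/
theorem IsAdaptedNhd.integrable_mul_cutoffPower_of_ne (h : IsAdaptedNhd M p f e A V)
    (hG : IsFreeProperHolomorphicAction (n := n) d G M)
    (hχ : ContMDiff 𝓘(ℝ, Cmodel n) 𝓘(ℝ, ℝ) ∞ χ) (hχc : HasCompactSupport χ)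
    (hχV : tsupport χ ⊆ V) {z : X} (hz : z ∈ closure M) (hzp : ∀ t : G, t • z ≠ p)
    {a : G → ℂ} (ha : Continuous a) :
    Integrable (fun t : G => a t * cutoffPower χ f τ (t • z)) ν := by
  obtain ⟨K, hK, hKz⟩ := hG.exists_isCompact hχc isCompact_singleton (singleton_subset_iff.mpr hz)
  have hc : Continuous fun t : G => a t * cutoffPower χ f τ (t • z) := by
    refine ha.mul (continuous_iff_continuousAt.mpr fun t => ?_)
    exact h.continuousAt_cutoffPower_smul hG hχ hχV hz (hzp t)
  refine hc.integrable_of_hasCompactSupport (HasCompactSupport.intro hK fun t ht => ?_)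
  rw [cutoffPower_eq_zero fun h' => ht (hKz t z rfl h'), mul_zero]

end

section

variable {n d : ℕ} {X : Type*} [TopologicalSpace X] [T2Space X] [ChartedSpace (Cmodel n) X]
  [IsManifold 𝓘(ℂ, Cmodel n) ω X] [MeasurableSpace X] [BorelSpace X]
  {G : Type*} [TopologicalSpace G] [T2Space G] [SecondCountableTopology G]
  [ChartedSpace (EuclideanSpace ℝ (Fin d)) G] [Group G] [LieGroup (𝓡 d) ∞ G]
  [MeasurableSpace G] [BorelSpace G]
  [MulAction G X] {M : Set X}
  {p : X} {f : X → ℂ} {e : OpenPartialHomeomorph X (Cmodel n)}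
  {A : Matrix (Fin n) (Fin n) ℂ} {V : Set X} {χ : X → ℝ} {τ : ℝ}
  (ν : Measure G) [ν.IsMulRightInvariant] [IsFiniteMeasureOnCompacts ν] [SFinite ν]
  [ν.IsOpenPosMeasure]

/-- On the orbit of `p` itself the singularity of `χ f ^ (-τ)` is integrable, because the Levi
polynomial grows quadratically along the orbit. -/
theorem IsAdaptedNhd.integrable_cutoffPower_orbit (h : IsAdaptedNhd M p f e A V)
    (hG : IsFreeProperHolomorphicAction (n := n) d G M) (hp : p ∈ closure M)
    (htan : orbitTangentSpace (n := n) d G p ⊆ complexTangentSpace M p)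
    (hχ : ContMDiff 𝓘(ℝ, Cmodel n) 𝓘(ℝ, ℝ) ∞ χ) (hχc : HasCompactSupport χ)
    (hχV : tsupport χ ⊆ V) (hτ : 0 < τ) (hd : 0 < d) (hτd : 2 * τ < d) :
    Integrable (fun t : G => cutoffPower χ f τ (t • p)) ν := by
  have hFm := h.measurable_cutoffPower_smul (G := G) (τ := τ) hG hχ hχV p
  set κ := identityChart d G with hκ
  obtain ⟨δ, hδ, hball, D, hD, hD0, -, hν⟩ := exists_density_of_isMulRightInvariant (κ := κ)
    (fun t ht => contMDiffAt_identityChart d G ht)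
    (fun y hy => contMDiffAt_identityChart_symm d G hy)
    (one_mem_identityChart_source d G) (identityChart_one d G) ν
  obtain ⟨c, hc, hlow⟩ := h.re_orbitLevi_lower_bound hG hp htan
  have htend : Tendsto (fun y => normalOrbit d G e (0, y))
      (𝓝 (0 : EuclideanSpace ℝ (Fin d))) (𝓝 p) := by
    have h1 : ContinuousAt (normalOrbit d G e) 0 := (h.contMDiffAt_normalOrbit_zero hG).continuousAt
    have h2 : Tendsto (fun y : EuclideanSpace ℝ (Fin d) => ((0, y) : ℝ × EuclideanSpace ℝ (Fin d)))
        (𝓝 0) (𝓝 0) := (Continuous.prodMk_right 0).tendsto' 0 0 rfl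
    have h3 := h1.tendsto.comp h2
    rwa [show normalOrbit d G e 0 = p from h.normalOrbit_zero] at h3
  obtain ⟨ε, hε, hεb⟩ := Metric.eventually_nhds_iff_ball.mp
    (hlow.and (htend.eventually_mem (h.isOpen.mem_nhds h.mem)))
  set r := min (δ / 2) ε with hr
  have hr0 : 0 < r := lt_min (by positivity) hε
  have hrδ : r < δ := lt_of_le_of_lt (min_le_left _ _) (by linarith)
  have hcb : Metric.closedBall (0 : EuclideanSpace ℝ (Fin d)) r ⊆ Metric.ball 0 δ :=
    Metric.closedBall_subset_ball hrδ
  obtain ⟨C₁, hC₁⟩ :=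
    (isCompact_closedBall (0 : EuclideanSpace ℝ (Fin d)) r).exists_bound_of_continuousOn
      (hD.mono hcb)
  obtain ⟨C₂, hC₂⟩ := hχ.continuous.bounded_above_of_compact_support hχc
  have hC₂0 : 0 ≤ C₂ := (norm_nonneg _).trans (hC₂ p)
  have hC₁0 : 0 ≤ C₁ := (norm_nonneg _).trans (hC₁ 0 (Metric.mem_closedBall_self hr0.le))
  set S : Set G := κ.symm '' Metric.ball 0 r with hS
  have hSo : IsOpen S := κ.isOpen_image_symm_of_subset_target Metric.isOpen_ball
    ((Metric.ball_subset_ball hrδ.le).trans hball)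
  have h1S : (1 : G) ∈ S := ⟨0, Metric.mem_ball_self hr0, identityChart_symm_zero d G⟩
  -- the orbit is split into a coordinate ball around the identity, a compact set on which the
  -- function is continuous, and a set on which it vanishes
  have hnear : IntegrableOn (fun t : G => cutoffPower χ f τ (t • p)) S ν := by
    rw [hS, integrableOn_chart_image_iff hball hD hD0 hν hrδ.le hFm]
    refine integrableOn_ball_of_norm_le_rpow (C := C₁ * (C₂ * c ^ (-τ))) (α := 2 * τ)
      ?_ ?_ ?_ ?_ |>.congr_fun
      (f := (Metric.ball 0 r).indicator fun w => (D w : ℂ) * cutoffPower χ f τ (κ.symm w • p))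
      (fun w hw => indicator_of_mem hw _) Metric.isOpen_ball.measurableSet
    · rw [finrank_euclideanSpace_fin]; exact hd
    · rw [finrank_euclideanSpace_fin]; exact hτd
    · refine (ae_restrict_iff' Metric.isOpen_ball.measurableSet).mpr (Eventually.of_forall ?_)
      intro w hw
      rw [indicator_of_mem hw, norm_mul, Complex.norm_real, mul_assoc C₁]
      obtain ⟨hw1, hw2⟩ := hεb w (Metric.ball_subset_ball (min_le_right _ _) hw)
      refine mul_le_mul (hC₁ w (Metric.ball_subset_closedBall hw)) ?_ (norm_nonneg _) hC₁0
      have h3 : cutoffPower χ f τ (κ.symm w • p) =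
          (χ (κ.symm w • p) : ℂ) * orbitLevi d G e A (0, w) ^ (((-τ : ℝ)) : ℂ) := by
        rw [cutoffPower, orbitLevi, ← h.eq_leviPoly _ hw2, h.normalOrbit_zero_left,
          Complex.ofReal_neg]
      rw [h3, norm_mul, Complex.norm_real, Complex.norm_cpow_real, mul_assoc C₂]
      refine mul_le_mul (hC₂ _) ?_ (by positivity) hC₂0
      -- at `w = 0` the power is `0 ^ (-τ) = 0`
      by_cases hw0 : w = 0
      · have : orbitLevi d G e A (0, 0) = 0 := by
          have := h.orbitLevi_normal (d := d) (G := G).self_of_nhds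
          simpa using this
        rw [hw0, this, norm_zero, Real.zero_rpow (neg_ne_zero.mpr hτ.ne')]
        positivity
      · have hwn : 0 < ‖w‖ := norm_pos_iff.mpr hw0
        have h4 : c * ‖w‖ ^ 2 ≤ ‖orbitLevi d G e A (0, w)‖ :=
          hw1.trans ((le_abs_self _).trans (Complex.abs_re_le_norm _))
        calc ‖orbitLevi d G e A (0, w)‖ ^ (-τ) ≤ (c * ‖w‖ ^ 2) ^ (-τ) :=
              Real.rpow_le_rpow_of_nonpos (by positivity) h4 (by linarith)
          _ = c ^ (-τ) * ‖w‖ ^ (-(2 * τ)) := by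
              rw [Real.mul_rpow hc.le (by positivity), ← Real.rpow_natCast ‖w‖ 2,
                ← Real.rpow_mul hwn.le]
              congr 2
              push_cast
              ring
    · have h3 : AEStronglyMeasurable (fun w => (D w : ℂ) * cutoffPower χ f τ (κ.symm w • p))
          (volume.restrict (Metric.ball 0 r)) := by
        refine AEMeasurable.aestronglyMeasurable (AEMeasurable.mul ?_ ?_)
        · exact Complex.measurable_ofReal.comp_aemeasurable
            ((hD.mono (Metric.ball_subset_ball hrδ.le)).aemeasurable
              Metric.isOpen_ball.measurableSet)
        · exact hFm.comp_aemeasurable (aemeasurable_chart_symm hball hrδ.le)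
      exact (aestronglyMeasurable_indicator_iff Metric.isOpen_ball.measurableSet).mpr h3
  obtain ⟨K, hK, hKp⟩ := hG.exists_isCompact hχc isCompact_singleton (singleton_subset_iff.mpr hp)
  have hfar : IntegrableOn (fun t : G => cutoffPower χ f τ (t • p)) (K \ S) ν := by
    refine ContinuousOn.integrableOn_compact (hK.diff hSo) fun t ht => ?_
    refine (h.continuousAt_cutoffPower_smul hG hχ hχV hp fun h' => ht.2 ?_).continuousWithinAt
    rw [hG.free p hp t h']
    exact h1S
  have hout : IntegrableOn (fun t : G => cutoffPower χ f τ (t • p)) Kᶜ ν := by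
    refine (integrableOn_zero (ε' := ℂ)).congr_fun (fun t ht => ?_) hK.measurableSet.compl
    exact (cutoffPower_eq_zero fun h' => ht (hKp t p rfl h')).symm
  rw [← integrableOn_univ]
  refine ((hnear.union hfar).union hout).mono_set fun t _ => ?_
  by_cases htK : t ∈ K
  · by_cases htS : t ∈ S
    · exact Or.inl (Or.inl htS)
    · exact Or.inl (Or.inr ⟨htK, htS⟩)
  · exact Or.inr htK

end

/-! ### The contribution away from the identity -/

theorem fwdDiff_iter_eq_sum_mul (φ : ℝ → ℂ) (s x : ℝ) (k : ℕ) :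
    (fwdDiff s)^[k] φ x = ∑ j ∈ Finset.range (k + 1),
      (((-1 : ℤ) ^ (k - j) * (k.choose j : ℤ) : ℤ) : ℂ) * φ (x + j * s) := by
  rw [fwdDiff_iter_eq_sum_shift]
  refine Finset.sum_congr rfl fun j _ => ?_
  rw [zsmul_eq_mul, nsmul_eq_mul]

theorem fwdDiff_iter_congr {φ ψ : ℝ → ℂ} {s x : ℝ} {k : ℕ}
    (h : ∀ j ≤ k, φ (x + j * s) = ψ (x + j * s)) :
    (fwdDiff s)^[k] φ x = (fwdDiff s)^[k] ψ x := by
  rw [fwdDiff_iter_eq_sum_mul, fwdDiff_iter_eq_sum_mul]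
  refine Finset.sum_congr rfl fun j hj => ?_
  rw [h j (Nat.lt_succ_iff.mp (Finset.mem_range.mp hj))]

/-- Finite differences commute with integration. -/
theorem fwdDiff_iter_integral {α : Type*} [MeasurableSpace α] {ν : Measure α} {Ψ : ℝ → α → ℂ}
    {s x : ℝ} {k : ℕ} (h : ∀ j ≤ k, Integrable (Ψ (x + j * s)) ν) :
    (fwdDiff s)^[k] (fun σ => ∫ t, Ψ σ t ∂ν) x = ∫ t, (fwdDiff s)^[k] (fun σ => Ψ σ t) x ∂ν := by
  simp only [fwdDiff_iter_eq_sum_mul]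
  rw [integral_finsetSum _ fun j hj =>
    (h j (Nat.lt_succ_iff.mp (Finset.mem_range.mp hj))).const_mul _]
  refine Finset.sum_congr rfl fun j _ => ?_
  rw [integral_const_mul]

theorem fwdDiff_iter_const_mul (c : ℂ) (φ : ℝ → ℂ) (s x : ℝ) (k : ℕ) :
    (fwdDiff s)^[k] (fun σ => c * φ σ) x = c * (fwdDiff s)^[k] φ x := by
  simp only [fwdDiff_iter_eq_sum_mul]
  rw [Finset.mul_sum]
  refine Finset.sum_congr rfl fun j _ => ?_
  ring

section

variable {n d : ℕ} {X : Type*} [TopologicalSpace X] [ChartedSpace (Cmodel n) X]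
  {G : Type*} [TopologicalSpace G] [ChartedSpace (EuclideanSpace ℝ (Fin d)) G] [Group G]
  [LieGroup (𝓡 d) ∞ G]
  [MulAction G X] {M : Set X}
  {p : X} {f : X → ℂ} {e : OpenPartialHomeomorph X (Cmodel n)}
  {A : Matrix (Fin n) (Fin n) ℂ} {V : Set X} {χ : X → ℝ} {τ : ℝ}

/-- Away from the identity of the group, `χ f ^ (-τ)` is smooth along the orbits through
the inner normal, uniformly up to the boundary. -/
theorem IsAdaptedNhd.exists_norm_fwdDiff_iter_le (h : IsAdaptedNhd M p f e A V)
    (hG : IsFreeProperHolomorphicAction (n := n) d G M) (hp : p ∈ closure M)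
    (hχ : ContMDiff 𝓘(ℝ, Cmodel n) 𝓘(ℝ, ℝ) ∞ χ) (hχV : tsupport χ ⊆ V) (k : ℕ)
    {K : Set G} (hK : IsCompact K) (h1 : 1 ∉ K) :
    ∃ ε > 0, ∃ B ≥ 0, ∀ t ∈ K, ∀ x s : ℝ, -ε < x → 0 ≤ s → x + k * s < ε →
      ‖(fwdDiff s)^[k] (fun σ : ℝ =>
        cutoffPower χ f τ (t • e.symm ((Complex.I * σ, 0) : Cmodel n))) x‖ ≤ B * s ^ k := by
  have : IsTopologicalGroup G := topologicalGroup_of_lieGroup (𝓡 d) ∞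
  set κ := identityChart d G with hκ
  refine hK.induction_on (p := fun K => ∃ ε > 0, ∃ B ≥ 0, ∀ t ∈ K, ∀ x s : ℝ, -ε < x → 0 ≤ s →
    x + k * s < ε → ‖(fwdDiff s)^[k] (fun σ : ℝ =>
      cutoffPower χ f τ (t • e.symm ((Complex.I * σ, 0) : Cmodel n))) x‖ ≤ B * s ^ k) ?_ ?_ ?_ ?_
  · exact ⟨1, one_pos, 0, le_rfl, by simp⟩
  · rintro K₁ K₂ h12 ⟨ε, hε, B, hB, hb⟩
    exact ⟨ε, hε, B, hB, fun t ht => hb t (h12 ht)⟩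
  · rintro K₁ K₂ ⟨ε₁, hε₁, B₁, hB₁, hb₁⟩ ⟨ε₂, hε₂, B₂, hB₂, hb₂⟩
    refine ⟨min ε₁ ε₂, lt_min hε₁ hε₂, max B₁ B₂, le_max_of_le_left hB₁, ?_⟩
    intro t ht x s hx hs hxs
    have hx1 : -ε₁ < x := lt_of_le_of_lt (neg_le_neg (min_le_left _ _)) hx
    have hx2 : -ε₂ < x := lt_of_le_of_lt (neg_le_neg (min_le_right _ _)) hx
    rcases ht with ht | ht
    · refine (hb₁ t ht x s hx1 hs (hxs.trans_le (min_le_left _ _))).trans ?_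
      gcongr
      exact le_max_left _ _
    · refine (hb₂ t ht x s hx2 hs (hxs.trans_le (min_le_right _ _))).trans ?_
      gcongr
      exact le_max_right _ _
  -- near `t₀`, the group is parametrized by `t = t₀ * θ(w)`, with `θ` the inverse of the chart
  · intro t₀ ht₀
    have hne : t₀ • p ≠ p := fun h' => h1 (hG.free p hp t₀ h' ▸ ht₀)
    have hW : ContDiffAt ℝ ∞ (fun q : ℝ × EuclideanSpace ℝ (Fin d) =>
        cutoffPower χ f τ (t₀ • normalOrbit d G e q)) (0, 0) := by
      rw [← contMDiffAt_iff_contDiffAt]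
      have h2 : ContMDiffAt 𝓘(ℝ, ℝ × EuclideanSpace ℝ (Fin d)) 𝓘(ℝ, Cmodel n) ∞
          (fun q => t₀ • normalOrbit d G e q) (0, 0) :=
        ContMDiffAt.comp (g := fun z : X => t₀ • z) _ (contMDiff_const_smul hG.smooth t₀ _)
          (h.contMDiffAt_normalOrbit_zero hG)
      have h3 : ContMDiffAt 𝓘(ℝ, Cmodel n) 𝓘(ℝ, ℂ) ∞ (cutoffPower χ f τ)
          (t₀ • normalOrbit d G e (0, 0)) := by
        rw [h.normalOrbit_zero]
        exact h.contMDiffAt_cutoffPower hχ hχV (hG.smul_mem_closure t₀ hp) hne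
      exact ContMDiffAt.comp (g := cutoffPower χ f τ) _ h3 h2
    obtain ⟨ε, hε, B, hB, hb⟩ := hW.exists_norm_fwdDiff_iter_le k
    obtain ⟨r, hr, hrt⟩ := Metric.isOpen_iff.mp κ.open_target 0 (zero_mem_identityChart_target d G)
    have hS : IsOpen (κ.symm '' Metric.ball 0 (min ε r)) :=
      κ.isOpen_image_symm_of_subset_target Metric.isOpen_ball
        ((Metric.ball_subset_ball (min_le_right _ _)).trans hrt)
    refine ⟨(fun t => t₀⁻¹ * t) ⁻¹' (κ.symm '' Metric.ball 0 (min ε r)), ?_, ε, hε, B, hB, ?_⟩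
    · refine mem_nhdsWithin_of_mem_nhds ((hS.preimage (by fun_prop)).mem_nhds ?_)
      refine ⟨0, Metric.mem_ball_self (lt_min hε hr), ?_⟩
      rw [hκ, identityChart_symm_zero]
      exact (inv_mul_cancel t₀).symm
    · rintro t ⟨w, hw, hwt⟩ x s hx hs hxs
      have h4 := hb w (Metric.ball_subset_ball (min_le_left _ _) hw) x s hx hs hxs
      have h5 : t = t₀ * κ.symm w := by
        rw [hwt, mul_inv_cancel_left]
      rw [h5]
      simp only [mul_smul]
      exact h4

end

/-! ### Non-smoothness of the averages -/

section

variable {n d : ℕ} {X : Type*} [TopologicalSpace X] [T2Space X] [ChartedSpace (Cmodel n) X]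
  [IsManifold 𝓘(ℂ, Cmodel n) ω X] [MeasurableSpace X] [BorelSpace X]
  {G : Type*} [TopologicalSpace G] [T2Space G] [SecondCountableTopology G]
  [ChartedSpace (EuclideanSpace ℝ (Fin d)) G] [Group G] [LieGroup (𝓡 d) ∞ G]
  [MeasurableSpace G] [BorelSpace G]
  [MulAction G X] {M : Set X}
  {p : X} {f : X → ℂ} {e : OpenPartialHomeomorph X (Cmodel n)}
  {A : Matrix (Fin n) (Fin n) ℂ} {V : Set X} {χ : X → ℝ} {τ : ℝ}
  (ν : Measure G) [ν.IsMulRightInvariant] [IsFiniteMeasureOnCompacts ν] [SFinite ν]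
  [ν.IsOpenPosMeasure]

/-- The contribution of a neighbourhood of the identity: its `d`-th differences with step `s`,
taken at the point `(i s, 0)` of the inner normal, are of the exact order `s ^ (d / 2 - τ)`. Any
order of the differences that exceeds `d / 2 - τ` would do; `d` is the simplest choice. -/
theorem IsAdaptedNhd.exists_tendsto_near (h : IsAdaptedNhd M p f e A V)
    (hG : IsFreeProperHolomorphicAction (n := n) d G M) (hp : p ∈ closure M)
    (htan : orbitTangentSpace (n := n) d G p ⊆ complexTangentSpace M p)
    (hχ : ContMDiff 𝓘(ℝ, Cmodel n) 𝓘(ℝ, ℝ) ∞ χ)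
    (hχV : tsupport χ ⊆ V) (hχ1 : ∀ᶠ z in 𝓝 p, χ z = 1) (hd : 0 < d) (hτ : 0 < τ)
    {a : G → ℂ} (ha : Continuous a) (ha1 : a 1 ≠ 0) :
    ∃ S : Set G, IsOpen S ∧ 1 ∈ S ∧ ∃ L : ℂ, L ≠ 0 ∧
      Tendsto (fun s : ℝ => ((s ^ (τ - d / 2) : ℝ) : ℂ) * ∫ t in S, (fwdDiff s)^[d] (fun σ : ℝ =>
        a t * cutoffPower χ f τ (t • e.symm ((Complex.I * σ, 0) : Cmodel n))) s ∂ν)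
        (𝓝[>] 0) (𝓝 L) := by
  set κ := identityChart d G with hκ
  have hdR : (0 : ℝ) < d := Nat.cast_pos.mpr hd
  have hGs := h.contDiffAt_orbitLevi (d := d) (G := G) hG
  have hG0 : orbitLevi d G e A 0 = 0 := by
    have h1 : orbitLevi d G e A (0, 0) = ((0 : ℝ) : ℂ) := h.orbitLevi_normal.self_of_nhds
    rw [Complex.ofReal_zero] at h1
    exact h1
  have hD1 := h.fderiv_orbitLevi hG htan
  obtain ⟨c, hc, hlow⟩ := h.re_orbitLevi_lower_bound hG hp htan
  have hk : (d / 2 : ℝ) < τ + d := by linarith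
  obtain ⟨ε, hε, hmain⟩ := tendsto_integral_fwdDiff hGs hG0 hD1 hc hlow hτ hk
  have hne := integral_fwdDiff_cpow_ne_zero _ (halfHessian_comm hGs) hc
    (halfHessian_re_lower_bound hGs hG0 hD1 hlow) hτ hk
  obtain ⟨δ₁, hδ₁, hball, D, hD, hD0, hDpos, hν⟩ := exists_density_of_isMulRightInvariant (κ := κ)
    (fun t ht => contMDiffAt_identityChart d G ht)
    (fun y hy => contMDiffAt_identityChart_symm d G hy)
    (one_mem_identityChart_source d G) (identityChart_one d G) ν
  have htend : Tendsto (normalOrbit d G e) (𝓝 0) (𝓝 p) := by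
    have h1 : ContinuousAt (normalOrbit d G e) 0 := (h.contMDiffAt_normalOrbit_zero hG).continuousAt
    have h3 := h1.tendsto
    rwa [show normalOrbit d G e 0 = p from h.normalOrbit_zero] at h3
  obtain ⟨r, hr, hrb⟩ := Metric.eventually_nhds_iff_ball.mp
    (htend.eventually (hχ1.and (h.isOpen.mem_nhds h.mem)))
  set δ := min (min δ₁ ε) r / 2 with hδ
  have hδ0 : 0 < δ := by positivity
  have hδδ₁ : δ < δ₁ :=
    (half_lt_self (by positivity)).trans_le ((min_le_left _ _).trans (min_le_left _ _))
  have hδε : δ < ε :=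
    (half_lt_self (by positivity)).trans_le ((min_le_left _ _).trans (min_le_right _ _))
  have hδr : δ < r := (half_lt_self (by positivity)).trans_le (min_le_right _ _)
  have hcb : Metric.closedBall (0 : EuclideanSpace ℝ (Fin d)) δ ⊆ Metric.ball 0 δ₁ :=
    Metric.closedBall_subset_ball hδδ₁
  set b : EuclideanSpace ℝ (Fin d) → ℂ := fun w => (D w : ℂ) * a (κ.symm w) with hb
  have hbc : ContinuousOn b (Metric.closedBall 0 δ) := by
    refine ContinuousOn.mul ?_ ?_
    · exact Complex.continuous_ofReal.comp_continuousOn (hD.mono hcb)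
    · exact ha.comp_continuousOn (κ.continuousOn_symm.mono (hcb.trans hball))
  have hlim := hmain δ hδ0 hδε b hbc
  refine ⟨κ.symm '' Metric.ball 0 δ, κ.isOpen_image_symm_of_subset_target Metric.isOpen_ball
    ((Metric.ball_subset_ball hδδ₁.le).trans hball),
    ⟨0, Metric.mem_ball_self hδ0, identityChart_symm_zero d G⟩, _, ?_, hlim.congr' ?_⟩
  -- the limit is `b 0` times the constant of the quadratic model
  · refine mul_ne_zero (mul_ne_zero ?_ ?_) hne
    · exact_mod_cast hDpos.ne'
    · rw [hκ, identityChart_symm_zero]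
      exact ha1
  · have hsmall : ∀ᶠ s : ℝ in 𝓝[>] 0, s + d * s < r := by
      have h1 : Tendsto (fun s : ℝ => s + d * s) (𝓝[>] 0) (𝓝 0) := by
        refine Tendsto.mono_left ?_ nhdsWithin_le_nhds
        have : Continuous fun s : ℝ => s + d * s := by fun_prop
        exact this.tendsto' 0 0 (by simp)
      exact h1.eventually (gt_mem_nhds hr)
    filter_upwards [hsmall, self_mem_nhdsWithin] with s hs hs0
    have hs0' : (0 : ℝ) < s := hs0
    congr 1
    have hFm : Measurable fun t : G => (fwdDiff s)^[d] (fun σ : ℝ =>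
        a t * cutoffPower χ f τ (t • e.symm ((Complex.I * σ, 0) : Cmodel n))) s := by
      simp only [fwdDiff_iter_eq_sum_mul]
      refine Finset.measurable_fun_sum _ fun j _ => measurable_const.mul (ha.measurable.mul ?_)
      exact h.measurable_cutoffPower_smul hG hχ hχV _
    rw [setIntegral_chart_image hball hD hD0 hν hδδ₁.le hFm]
    refine setIntegral_congr_fun Metric.isOpen_ball.measurableSet fun w hw => ?_
    simp only [hb]
    rw [fwdDiff_iter_const_mul, mul_assoc]
    congr 2
    refine fwdDiff_iter_congr fun j hj => ?_
    have hj' : (j : ℝ) ≤ d := Nat.cast_le.mpr hj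
    have hmem : ((s + j * s, w) : ℝ × EuclideanSpace ℝ (Fin d)) ∈ Metric.ball 0 r := by
      rw [mem_ball_zero_iff, Prod.norm_def, max_lt_iff]
      constructor
      · rw [Real.norm_of_nonneg (by positivity)]
        have hjs : s + j * s ≤ s + d * s := by gcongr
        exact lt_of_le_of_lt hjs hs
      · exact (mem_ball_zero_iff.mp hw).trans hδr
    obtain ⟨h1, h2⟩ := hrb _ hmem
    have h3 : κ.symm w • e.symm ((Complex.I * ((s + j * s : ℝ) : ℂ), 0) : Cmodel n) =
      normalOrbit d G e (s + j * s, w) := rfl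
    rw [h3, cutoffPower, h1, h.eq_leviPoly _ h2, Complex.ofReal_one, one_mul]
    rfl

/-- The averages of `χ f ^ (-τ)` are not smooth up to the boundary at `p`: their finite
differences along the inner normal are too large. -/
theorem IsAdaptedNhd.not_isSmoothUpToBoundaryAt (h : IsAdaptedNhd M p f e A V)
    (hG : IsFreeProperHolomorphicAction (n := n) d G M) (hp : p ∈ closure M) (hpM : p ∉ M)
    (htan : orbitTangentSpace (n := n) d G p ⊆ complexTangentSpace M p)
    (hχ : ContMDiff 𝓘(ℝ, Cmodel n) 𝓘(ℝ, ℝ) ∞ χ) (hχc : HasCompactSupport χ)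
    (hχV : tsupport χ ⊆ V) (hχ1 : ∀ᶠ z in 𝓝 p, χ z = 1) (hd : 0 < d) (hτ : 0 < τ)
    {a : G → ℂ} (ha : Continuous a) (ha1 : a 1 ≠ 0) :
    ¬ IsSmoothUpToBoundaryAt (n := n) M p
      (fun z => ∫ t, a t * cutoffPower χ f τ (t • z) ∂ν) := by
  rintro ⟨W, hW, H, hH, hHe⟩
  obtain ⟨S, hSo, h1S, L, hL, hlim⟩ := h.exists_tendsto_near ν hG hp htan hχ hχV hχ1 hd hτ ha ha1
  set z : ℝ → X := fun σ => e.symm ((Complex.I * σ, 0) : Cmodel n) with hz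
  -- an interval on which the inner normal is defined and stays in `M ∩ W`
  have hcurve : Continuous fun s : ℝ => ((Complex.I * s, 0) : Cmodel n) := by fun_prop
  have hcurve0 : Tendsto (fun s : ℝ => ((Complex.I * s, 0) : Cmodel n)) (𝓝 0) (𝓝 0) :=
    hcurve.tendsto' 0 0 (by simp)
  have hz0 : z 0 = p := by
    have h1 : ((Complex.I * ((0 : ℝ) : ℂ), 0) : Cmodel n) = 0 := by simp
    simp only [hz]
    rw [h1, h.symm_zero]
  have hev1 : ∀ᶠ s : ℝ in 𝓝 0, ((Complex.I * s, 0) : Cmodel n) ∈ e.target ∧ z s ∈ W :=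
    hcurve0.eventually (eventually_coord_iff h.mem_source h.map_point hW)
  have hev2 : ∀ᶠ s : ℝ in 𝓝 0, 0 < s → z s ∈ M := eventually_nhdsWithin_iff.mp h.normal_mem
  obtain ⟨σ₀, hσ₀, hσb⟩ := Metric.eventually_nhds_iff_ball.mp (hev1.and hev2)
  set σ₁ := σ₀ / 2 with hσ₁
  have hσ₁0 : 0 < σ₁ := by positivity
  have hmemb : ∀ s ∈ Icc 0 σ₁, s ∈ Metric.ball (0 : ℝ) σ₀ := by
    intro s hs
    rw [mem_ball_zero_iff, Real.norm_of_nonneg hs.1]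
    linarith [hs.2]
  have hzM : ∀ s ∈ Ioc 0 σ₁, z s ∈ M := fun s hs => (hσb s (hmemb s ⟨hs.1.le, hs.2⟩)).2 hs.1
  have hzW : ∀ s ∈ Icc 0 σ₁, z s ∈ W := fun s hs => (hσb s (hmemb s hs)).1.2
  have hzcl : ∀ s ∈ Icc 0 σ₁, z s ∈ closure M := by
    intro s hs
    rcases hs.1.eq_or_lt with h0 | h0
    · rw [← h0, hz0]; exact hp
    · exact subset_closure (hzM s ⟨h0, hs.2⟩)
  have hzs : ∀ s ∈ Icc 0 σ₁, ContMDiffAt 𝓘(ℝ, ℝ) 𝓘(ℝ, Cmodel n) ∞ z s := by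
    intro s hs
    refine ContMDiffAt.comp (g := e.symm) s
      (contMDiffAt_chart_symm_real h.mem_atlas (hσb s (hmemb s hs)).1.1) ?_
    have : ContDiff ℝ ∞ fun s : ℝ => ((Complex.I * s, 0) : Cmodel n) :=
      (contDiff_const.mul Complex.ofRealCLM.contDiff).prodMk contDiff_const
    exact this.contMDiff.contMDiffAt
  -- the extension has small differences
  have hHz : ContDiffOn ℝ ∞ (H ∘ z) (Icc 0 σ₁) := by
    rw [← contMDiffOn_iff_contDiffOn]
    exact hH.comp (fun s hs => (hzs s hs).contMDiffWithinAt) fun s hs => ⟨hzcl s hs, hzW s hs⟩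
  obtain ⟨B₁, hB₁⟩ := exists_norm_fwdDiff_iter_le_of_contDiffOn hσ₁0 d _ hHz
  -- the contribution of the complement of a neighbourhood of the identity
  have hzcomp : IsCompact (z '' Icc 0 σ₁) :=
    isCompact_Icc.image_of_continuousOn fun s hs => (hzs s hs).continuousAt.continuousWithinAt
  obtain ⟨K, hK, hKz⟩ := hG.exists_isCompact hχc hzcomp (by rintro _ ⟨s, hs, rfl⟩; exact hzcl s hs)
  obtain ⟨ε, hε, B₂, hB₂, hfar⟩ := h.exists_norm_fwdDiff_iter_le (τ := τ) hG hp hχ hχV d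
    (hK.diff hSo) (fun h' => h'.2 h1S)
  obtain ⟨C, hC⟩ := hK.exists_bound_of_continuousOn ha.continuousOn
  set B₃ : ℝ := C * B₂ * ν.real (K \ S) with hB₃
  set N : ℝ → ℂ := fun s => ∫ t in S, (fwdDiff s)^[d] (fun σ : ℝ =>
    a t * cutoffPower χ f τ (t • z σ)) s ∂ν with hN
  have hbound : ∀ s : ℝ, 0 < s → s + d * s < min σ₁ ε → ‖N s‖ ≤ (B₁ + B₃) * s ^ d := by
    intro s hs0 hs
    have hsσ : ∀ j ≤ d, s + j * s ∈ Ioc 0 σ₁ := by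
      intro j hj
      have hj' : (j : ℝ) ≤ d := Nat.cast_le.mpr hj
      refine ⟨by positivity, le_trans ?_ (hs.trans_le (min_le_left _ _)).le⟩
      gcongr
    have hint : ∀ j ≤ d, Integrable (fun t => a t * cutoffPower χ f τ (t • z (s + j * s))) ν := by
      intro j hj
      have hm := hzM _ (hsσ j hj)
      exact h.integrable_mul_cutoffPower_of_ne ν hG hχ hχc hχV (subset_closure hm)
        (hG.smul_ne_of_notMem hpM hm) ha
    have htot : (fwdDiff s)^[d] (H ∘ z) s = ∫ t, (fwdDiff s)^[d] (fun σ : ℝ =>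
        a t * cutoffPower χ f τ (t • z σ)) s ∂ν := by
      rw [← fwdDiff_iter_integral (Ψ := fun σ t => a t * cutoffPower χ f τ (t • z σ)) hint]
      refine fwdDiff_iter_congr fun j hj => ?_
      have hm := hsσ j hj
      exact hHe ⟨hzM _ hm, hzW _ ⟨hm.1.le, hm.2⟩⟩
    have hintd : Integrable (fun t => (fwdDiff s)^[d] (fun σ : ℝ =>
        a t * cutoffPower χ f τ (t • z σ)) s) ν := by
      simp only [fwdDiff_iter_eq_sum_mul]
      exact integrable_finsetSum _ fun j hj =>
        (hint j (Nat.lt_succ_iff.mp (Finset.mem_range.mp hj))).const_mul _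
    have hsplit := integral_add_compl hSo.measurableSet hintd
    have hfar0 : ∀ t ∈ Sᶜ \ (K \ S), (fwdDiff s)^[d] (fun σ : ℝ =>
        a t * cutoffPower χ f τ (t • z σ)) s = 0 := by
      intro t ht
      have htK : t ∉ K := fun h' => ht.2 ⟨h', ht.1⟩
      rw [fwdDiff_iter_eq_sum_mul]
      refine Finset.sum_eq_zero fun j hj => ?_
      have hm := hsσ j (Nat.lt_succ_iff.mp (Finset.mem_range.mp hj))
      rw [cutoffPower_eq_zero fun h' => htK (hKz t _ (mem_image_of_mem z ⟨hm.1.le, hm.2⟩) h'),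
        mul_zero, mul_zero]
    have hfarle : ‖∫ t in Sᶜ, (fwdDiff s)^[d] (fun σ : ℝ =>
        a t * cutoffPower χ f τ (t • z σ)) s ∂ν‖ ≤ B₃ * s ^ d := by
      rw [setIntegral_eq_of_subset_of_forall_sdiff_eq_zero hSo.measurableSet.compl
        (fun t ht => ht.2 : K \ S ⊆ Sᶜ) hfar0]
      have hle : ∀ t ∈ K \ S, ‖(fwdDiff s)^[d] (fun σ : ℝ =>
          a t * cutoffPower χ f τ (t • z σ)) s‖ ≤ C * (B₂ * s ^ d) := by
        intro t ht
        rw [fwdDiff_iter_const_mul, norm_mul]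
        have hC0 : 0 ≤ C := (norm_nonneg _).trans (hC t ht.1)
        exact mul_le_mul (hC t ht.1) (hfar t ht s s (by linarith) hs0.le
          (hs.trans_le (min_le_right _ _))) (norm_nonneg _) hC0
      refine (norm_setIntegral_le_of_norm_le_const (hK.diff hSo).measure_lt_top hle).trans
        (le_of_eq ?_)
      rw [hB₃]
      ring
    have hNeq : N s = (fwdDiff s)^[d] (H ∘ z) s - ∫ t in Sᶜ, (fwdDiff s)^[d] (fun σ : ℝ =>
        a t * cutoffPower χ f τ (t • z σ)) s ∂ν := by
      rw [htot, ← hsplit, add_sub_cancel_right]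
    have hHle := hB₁ s s hs0.le hs0.le (hs.trans_le (min_le_left _ _)).le
    calc ‖N s‖ ≤ B₁ * s ^ d + B₃ * s ^ d := by
          rw [hNeq]
          exact (norm_sub_le _ _).trans (add_le_add hHle hfarle)
      _ = (B₁ + B₃) * s ^ d := by ring
  -- comparison with the exact order of the near part
  have hzero : Tendsto (fun s : ℝ => ((s ^ (τ - d / 2) : ℝ) : ℂ) * N s) (𝓝[>] 0) (𝓝 0) := by
    have hexp : (0 : ℝ) < τ + d / 2 := by positivity
    have hpow : Tendsto (fun s : ℝ => (B₁ + B₃) * s ^ (τ + d / 2)) (𝓝[>] 0) (𝓝 0) := by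
      have h1 : Tendsto (fun s : ℝ => s ^ (τ + d / 2)) (𝓝[>] 0) (𝓝 0) := by
        have := (Real.continuousAt_rpow_const 0 (τ + d / 2) (Or.inr hexp.le)).tendsto
        rw [Real.zero_rpow hexp.ne'] at this
        exact this.mono_left nhdsWithin_le_nhds
      simpa using h1.const_mul (B₁ + B₃)
    refine squeeze_zero_norm' ?_ hpow
    have hsmall : ∀ᶠ s : ℝ in 𝓝[>] 0, s + d * s < min σ₁ ε := by
      have h1 : Tendsto (fun s : ℝ => s + d * s) (𝓝[>] 0) (𝓝 0) := by
        refine Tendsto.mono_left ?_ nhdsWithin_le_nhds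
        have : Continuous fun s : ℝ => s + d * s := by fun_prop
        exact this.tendsto' 0 0 (by simp)
      exact h1.eventually (gt_mem_nhds (lt_min hσ₁0 hε))
    filter_upwards [hsmall, self_mem_nhdsWithin] with s hs hs0
    have hs0' : (0 : ℝ) < s := hs0
    rw [norm_mul, Complex.norm_real, Real.norm_of_nonneg (by positivity)]
    calc s ^ (τ - d / 2) * ‖N s‖ ≤ s ^ (τ - d / 2) * ((B₁ + B₃) * s ^ d) := by
          gcongr
          exact hbound s hs0' hs
      _ = (B₁ + B₃) * s ^ (τ + d / 2) := by
          rw [show τ + (d : ℝ) / 2 = (τ - d / 2) + d by ring, Real.rpow_add hs0',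
            Real.rpow_natCast]
          ring
  exact hL (tendsto_nhds_unique hlim hzero)

end

/-! ### Averages and translations -/

section

variable {G X : Type*} [Group G] [MulAction G X] [MeasurableSpace G]

/-- In terms of the left action, `R_Δ` is an integral for a right invariant measure. -/
theorem convolutionOp_eq_integral_inv [MeasurableInv G] (ν : Measure G) (Δ : G → ℂ) (u : X → ℂ)
    (z : X) :
    convolutionOp ν Δ u z = ∫ t, Δ t⁻¹ * u (t • z) ∂ν.inv := by
  have h := integral_map_equiv (MeasurableEquiv.inv G) (μ := ν) fun t => Δ t⁻¹ * u (t • z)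
  rw [convolutionOp, Measure.inv]
  refine Eq.trans ?_ h.symm
  simp

/-- Translating the argument of `R_Δ u` amounts to a translation of `Δ`. -/
theorem convolutionOp_smul [MeasurableMul G] (ν : Measure G) [ν.IsMulLeftInvariant] (Δ : G → ℂ)
    (u : X → ℂ) (g : G) (z : X) :
    convolutionOp ν Δ u (g • z) = convolutionOp ν (fun t => Δ (g * t)) u z := by
  rw [convolutionOp, convolutionOp,
    ← integral_mul_left_eq_self (fun t => Δ t * u (t⁻¹ • g • z)) g]
  simp [mul_smul]

theorem integrable_comp_inv_smul_iff [MeasurableInv G] (ν : Measure G) (u : X → ℂ) (z : X) :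
    Integrable (fun t : G => u (t⁻¹ • z)) ν ↔ Integrable (fun t : G => u (t • z)) ν.inv :=
  (integrable_map_equiv (MeasurableEquiv.inv G) fun t => u (t • z)).symm

end

theorem IsSmoothUpToBoundary.isSmoothUpToBoundaryAt {n : ℕ} {X : Type*} [TopologicalSpace X]
    [ChartedSpace (Cmodel n) X] {M : Set X} {h : X → ℂ}
    (hh : IsSmoothUpToBoundary (n := n) M h) (x : X) : IsSmoothUpToBoundaryAt (n := n) M x h := by
  obtain ⟨H, hH, hHe⟩ := hh
  exact ⟨univ, univ_mem, H, hH.mono inter_subset_left, hHe.mono inter_subset_left⟩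

/-- Translates of functions that are smooth up to the boundary are smooth up to the boundary. -/
theorem IsSmoothUpToBoundary.comp_smul {n d : ℕ} {X : Type*} [TopologicalSpace X]
    [ChartedSpace (Cmodel n) X] {G : Type*} [TopologicalSpace G]
    [ChartedSpace (EuclideanSpace ℝ (Fin d)) G] [Group G] [MulAction G X] {M : Set X} {h : X → ℂ}
    (hG : IsFreeProperHolomorphicAction (n := n) d G M)
    (hh : IsSmoothUpToBoundary (n := n) M h) (g : G) :
    IsSmoothUpToBoundary (n := n) M fun z => h (g • z) := by
  obtain ⟨H, hH, hHe⟩ := hh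
  refine ⟨fun z => H (g • z), ?_, fun z hz => hHe (hG.invariant g z hz)⟩
  exact hH.comp (contMDiff_const_smul hG.smooth g).contMDiffOn fun z hz => hG.smul_mem_closure g hz

end

theorem mainTheorem2 (n d : ℕ) (hd : 0 < d)
    {X : Type*} [TopologicalSpace X] [T2Space X] [SecondCountableTopology X]
    [ChartedSpace (Cmodel n) X] [IsManifold 𝓘(ℂ, Cmodel n) ω X]
    [MeasurableSpace X] [BorelSpace X]
    {G : Type*} [TopologicalSpace G] [T2Space G] [SecondCountableTopology G]
    [ChartedSpace (EuclideanSpace ℝ (Fin d)) G] [Group G] [LieGroup (𝓡 d) ∞ G]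
    [MeasurableSpace G] [BorelSpace G] [MulAction G X]
    (μ : Measure X) (hμ : IsSmoothMeasure (n := n) μ)
    (ν : Measure G) [ν.IsHaarMeasure]
    (M : Set X) (hM : IsOpen M) (hbM : HasSmoothBoundary (n := n) M)
    (hG : IsFreeProperHolomorphicAction (n := n) d G M)
    (p : X) (hp : p ∈ frontier M) (hpsc : IsStronglyPseudoconvexAt (n := n) M p)
    (htan : orbitTangentSpace (n := n) d G p ⊆ complexTangentSpace M p) :
    IsAmenableAction (n := n) d μ ν M ∧
    ∃ τ : ℝ, 0 < τ ∧ IsAmenableAt (n := n) d μ ν M p τ ∧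
      ∀ f : X → ℂ, IsLeviPolynomial (n := n) M p f →
        ∃ U ∈ 𝓝 p, ∀ χ : X → ℝ, IsCutoff (n := n) U p χ →
          ∀ Δ : G → ℂ, ContMDiff (𝓡 d) 𝓘(ℝ, ℂ) ∞ Δ → Δ 1 ≠ 0 →
            ¬ IsSmoothUpToBoundaryAt (n := n) M p
                (convolutionOp ν Δ (cutoffPower χ f τ)) := by
  have : IsTopologicalGroup G := topologicalGroup_of_lieGroup (𝓡 d) ∞
  have : LocallyCompactSpace G :=
    ChartedSpace.locallyCompactSpace (EuclideanSpace ℝ (Fin d)) G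
  have hpcl : p ∈ closure M := frontier_subset_closure hp
  have hpM : p ∉ M := by
    rw [hM.frontier_eq] at hp
    exact hp.2
  -- the exponent `1 / 4` satisfies `2 τ < 2` and `2 τ < d` for every `d ≥ 1`
  have hτ : (0 : ℝ) < 1 / 4 := by norm_num
  have hτd : 2 * (1 / 4 : ℝ) < d := by
    have : (1 : ℝ) ≤ d := Nat.one_le_cast.mpr hd
    linarith
  have hmain : ∀ f : X → ℂ, IsLeviPolynomial (n := n) M p f →
      ∃ U ∈ 𝓝 p, ∀ χ : X → ℝ, IsCutoff (n := n) U p χ →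
        MemLp (cutoffPower χ f (1 / 4)) 2 (μ.restrict M) ∧
        (∀ z ∈ closure M, Integrable (fun t : G => cutoffPower χ f (1 / 4) (t⁻¹ • z)) ν) ∧
        ∀ Δ : G → ℂ, Continuous Δ → Δ 1 ≠ 0 → ¬ IsSmoothUpToBoundaryAt (n := n) M p
          (convolutionOp ν Δ (cutoffPower χ f (1 / 4))) := by
    intro f hf
    obtain ⟨e, A, V, h⟩ := exists_isAdaptedNhd hpsc hf
    obtain ⟨U, hU, hL2⟩ := exists_memLp_cutoffPower hμ h.mem_atlas h.mem h.map_point h.isOpen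
      h.subset h.eq_leviPoly hτ.le (by norm_num)
    refine ⟨U ∩ V, inter_mem hU (h.isOpen.mem_nhds h.mem), fun χ hχ => ?_⟩
    obtain ⟨hχs, hχc, hχU, hχ1⟩ := hχ
    have hχV : tsupport χ ⊆ V := hχU.trans inter_subset_right
    refine ⟨(hL2 χ hχs.continuous hχc (hχU.trans inter_subset_left) hχV).restrict M, ?_, ?_⟩
    -- on the orbit of `p`, an element `g` with `g • z = p` reduces to `z = p` by right invariance
    · intro z hz
      rw [integrable_comp_inv_smul_iff]
      by_cases hzp : ∃ g : G, g • z = p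
      · obtain ⟨g, rfl⟩ := hzp
        have h1 := (h.integrable_cutoffPower_orbit ν.inv hG hpcl htan hχs hχc hχV hτ hd
          hτd).comp_mul_right g⁻¹
        refine h1.congr (Eventually.of_forall fun t => ?_)
        simp only [mul_smul, inv_smul_smul]
      · have h1 := h.integrable_mul_cutoffPower_of_ne (τ := 1 / 4) ν.inv hG hχs hχc hχV hz
          (fun t ht => hzp ⟨t, ht⟩) (continuous_const (y := (1 : ℂ)))
        simpa only [one_mul] using h1
    · intro Δ hΔ hΔ1
      have h1 : convolutionOp ν Δ (cutoffPower χ f (1 / 4)) =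
          fun z => ∫ t, Δ t⁻¹ * cutoffPower χ f (1 / 4) (t • z) ∂ν.inv :=
        funext fun z => convolutionOp_eq_integral_inv ν Δ _ z
      rw [h1]
      exact h.not_isSmoothUpToBoundaryAt ν.inv hG hpcl hpM htan hχs hχc hχV hχ1 hd hτ
        (hΔ.comp continuous_inv) (by rwa [inv_one])
  have hamen : IsAmenableAt (n := n) d μ ν M p (1 / 4) := by
    intro f hf
    obtain ⟨U, hU, hall⟩ := hmain f hf
    refine ⟨U, hU, fun χ hχ => ⟨(hall χ hχ).1, (hall χ hχ).2.1, fun Δ hΔ hΔ0 hsm => ?_⟩⟩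
    -- translating to a point where `Δ` does not vanish
    obtain ⟨g, hg⟩ := Function.ne_iff.mp hΔ0
    have h1 := (hsm.comp_smul hG g).isSmoothUpToBoundaryAt p
    simp only [convolutionOp_smul] at h1
    refine (hall χ hχ).2.2 (fun t => Δ (g * t)) (hΔ.continuous.comp (continuous_const_mul g)) ?_ h1
    simpa using hg
  refine ⟨⟨p, hp, 1 / 4, hτ, hamen⟩, 1 / 4, hτ, hamen, fun f hf => ?_⟩
  obtain ⟨U, hU, hall⟩ := hmain f hf
  exact ⟨U, hU, fun χ hχ Δ hΔ hΔ1 => (hall χ hχ).2.2 Δ hΔ.continuous hΔ1⟩
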